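/- Fix real numbers $1<q\le Q$. All edges of all trees below carry a bias $\beta_e\in[q,Q]$. Let $B$ be a locally finite infinite weighted tree in which every vertex has at least one offspring; $B$ is either rooted or end-distinguished (i.e. its edges are oriented so that every vertex has exactly one parent). Let $\overline T$ be a finite rooted weighted tree with ordered offspring whose root $\mathrm{head}$ has a unique offspring $\mathrm{ent}$, and let $T_{\mathrm{ent}}$ be the subtree of the descendents of $\mathrm{ent}$ (including $\mathrm{ent}$), rooted at $\mathrm{ent}$. The backbone–tree pair $(B,\overline T)$ is the weighted tree obtained by identifying $\mathrm{head}$ with a distinguished vertex of $B$. Let $X$ be the biased random walk on $(B,\overline T)$: from a vertex it jumps to each neighbour with probability proportional to $1$ for the parent (if there is one) and to $\beta_{v,w}$ for an offspring $w$ of the present vertex $v$. Write $\mathbb P^{v}$ for its law started at $v$. The weight of a finite rooted weighted tree $T$ is $\omega(T)=\sum_{v\in V(T)}\prod_{e}\beta_e$, the product being over the edges of the simple path from the root to $v$. Let $D(T)$ be the depth of $T$, let $v_{\mathrm{base}}$ be the lexicographically minimal vertex at distance $D(T)$ from the root, and let $\psi_0,\dots,\psi_{D(T)}=v_{\mathrm{base}}$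 be the simple path from the root to it. The tree $T$ is $B_0$-bare if, for every $0\le i\le D(T)-1$, the connected component of $\psi_i$ in the graph obtained from $T$ by deleting the edges of this path has at most $B_0\log\log\omega(T)$ vertices. For the pair, let $v_{\mathrm{base}}$ be that of $T_{\mathrm{ent}}$. Let $p_{\mathrm{esc}}$ be the $\mathbb P^{\mathrm{head}}$-probability that $X$ never visits $\mathrm{ent}$, let $p_{\mathrm{de}}$ be the $\mathbb P^{\mathrm{ent}}$-probability that $X$ visits $v_{\mathrm{base}}$ before its first visit to $\mathrm{head}$, and set $c_f=p_{\mathrm{esc}}^{-1}+p_{\mathrm{de}}^{-1}-1$. Let $\tau=|\{i\ge 0: X(i)\in V(T_{\mathrm{ent}})\}|$, let $\mathcal{FD}$ be the event that $X$ visits $v_{\mathrm{base}}$ at some positive time, and let $H$ be the hitting time of $v_{\mathrm{base}}$ ($H=\infty$ if it is never visited). **Proposition.** For every $B_0>0$ there exist $v_0\in(0,\infty)$ and $C_2>0$, depending only on $q$, $Q$ and $B_0$, such that the following holds for every backbone–tree pair $(B,\overline T)$ for which $\omega(T_{\mathrm{ent}})>v_0$ and $T_{\mathrm{ent}}$ is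 $B_0$-bare. One has $$\mathbb P^{\mathrm{ent}}(\mathcal{FD})=\frac{p_{\mathrm{de}}}{1-(1-p_{\mathrm{esc}})(1-p_{\mathrm{de}})},$$ and there is a probability space carrying the walk $X$ with law $\mathbb P^{\mathrm{ent}}$ and real random variables $E$, $\mathcal E$ such that, almost surely, $\tau$ is finite and $$\tau=E\,\mathbf 1_{\mathcal{FD}}+\mathcal E ,$$ where $E$ is an exponential random variable of mean $2c_f\,\omega(T_{\mathrm{ent}})$ which is independent of the walk $X$ up to time $H$ (that is, $E$ is independent of $\mathcal{FD}$; given $\mathcal{FD}$, $E$ is independent of the walk until its arrival at $v_{\mathrm{base}}$; and given $\mathcal{FD}^c$, it is independent of the entire walk), and where $$\mathbb E|\mathcal E|\le C_2\,\omega(T_{\mathrm{ent}})^{1/2}.$$ -/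

import Mathlib

open MeasureTheory ProbabilityTheory
open scoped ENNReal

universe u

noncomputable section

/-! ## Weighted trees (rooted or end-distinguished) -/

/-- A locally finite weighted tree, with edge-biases in `[q, Q]`, which is either rooted or
end-distinguished.  The edges are the pairs `(w, v)` with `parent v = some w`, directed from parent
to offspring.  No vertex is a proper ancestor of itself and any two vertices have a common ancestor
(where a vertex counts as an ancestor of itself): since every vertex has at most one parent, this
says that the graph is a tree.  At most one vertex has no parent; if there is one, it is
the root and the tree is rooted, and if there is none, the tree is end-distinguished.
`bias v` is the bias of the edge from the parent of `v` to `v`; it plays no role for the root. -/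
structure WeightedTree (q Q : ℝ) (V : Type u) where
  parent : V → Option V
  acyclic : ∀ v, ¬ Relation.TransGen (fun a b => parent a = some b) v v
  common_ancestor : ∀ v w, ∃ a,
    Relation.ReflTransGen (fun a b => parent a = some b) v a ∧
      Relation.ReflTransGen (fun a b => parent a = some b) w a
  locallyFinite : ∀ v, {w | parent w = some v}.Finite
  bias : V → ℝ
  bias_mem : ∀ v w, parent v = some w → bias v ∈ Set.Icc q Q

namespace WeightedTree

variable {q Q : ℝ} {V : Type u}

open Classical in
/-- The unnormalised jump rate of the walk from `v` to `w`: it is `1` if `w` is the parent of `v`,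
the bias of the edge `(v, w)` if `w` is an offspring of `v`, and `0` otherwise. -/
def rate (T : WeightedTree q Q V) (v w : V) : ℝ≥0∞ :=
  if T.parent v = some w then 1
  else if T.parent w = some v then ENNReal.ofReal (T.bias w) else 0

theorem tsum_rate_ne_top (T : WeightedTree q Q V) (v : V) : ∑' w, T.rate v w ≠ ∞ := by
  classical
  have hfin : ({w | T.parent v = some w} ∪ {w | T.parent w = some v}).Finite := by
    refine Set.Finite.union (Set.Subsingleton.finite ?_) (T.locallyFinite v)
    intro a ha b hb
    simp only [Set.mem_ofPred_eq] at ha hb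
    exact Option.some_injective _ (ha.symm.trans hb)
  rw [tsum_eq_sum (s := hfin.toFinset)]
  · refine ENNReal.sum_ne_top.2 fun w _ => ?_
    unfold rate
    split_ifs <;> simp
  · intro w hw
    simp only [Set.Finite.mem_toFinset, Set.mem_union, Set.mem_ofPred_eq, not_or] at hw
    simp [rate, hw.1, hw.2]

open Classical in
/-- The jump law of the biased walk at `v`: the walk moves to a neighbour with probability
proportional to `rate`.  (The rates out of `v` sum to zero only for the isolated vertex of a
one-vertex tree, where no jump law is needed.) -/
def step (T : WeightedTree q Q V) (v : V) : PMF V :=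
  if h : ∑' w, T.rate v w = 0 then PMF.pure v
  else PMF.normalize (T.rate v) h (T.tsum_rate_ne_top v)

variable [MeasurableSpace V] [DiscreteMeasurableSpace V]

/-- The transition kernel of the biased walk. -/
def stepKernel (T : WeightedTree q Q V) : Kernel V V where
  toFun v := (T.step v).toMeasure
  measurable' := Measurable.of_discrete

instance (T : WeightedTree q Q V) : IsMarkovKernel T.stepKernel :=
  ⟨fun v => PMF.toMeasure.isProbabilityMeasure (T.step v)⟩

/-- The law, on the space of trajectories `ℕ → V`, of the biased walk `X` with `X 0 = v`: the
Markov chain with transition kernel `stepKernel`. -/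
def walkLaw (T : WeightedTree q Q V) (v : V) : Measure (ℕ → V) :=
  Kernel.traj (X := fun _ => V)
    (fun n => T.stepKernel.comap (fun x : (i : Finset.Iic n) → V => x ⟨n, by simp⟩)
      (measurable_pi_apply _)) 0 (fun _ => v)

end WeightedTree

/-! ## Finite weighted trees with ordered offspring -/

/-- A finite rooted weighted tree whose vertices are coded, in the usual way, by finite sequences of
natural numbers: the root is the empty sequence and the offspring of `v` are
`v ++ [0], …, v ++ [k - 1]` for some `k`.  `bias v` is the bias of the edge from the parent of `v`
to `v`; it plays no role for the root. -/
structure FiniteWeightedTree (q Q : ℝ) where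
  verts : Finset (List ℕ)
  root_mem : [] ∈ verts
  parent_mem : ∀ v j, v ++ [j] ∈ verts → v ∈ verts
  sibling_mem : ∀ v j, v ++ [j + 1] ∈ verts → v ++ [j] ∈ verts
  bias : List ℕ → ℝ
  bias_mem : ∀ v ∈ verts, v ≠ [] → bias v ∈ Set.Icc q Q

namespace FiniteWeightedTree

variable {q Q : ℝ}

/-- The vertex set. -/
abbrev Vertex (T : FiniteWeightedTree q Q) : Type := {v : List ℕ // v ∈ T.verts}

/-- The root. -/
def root (T : FiniteWeightedTree q Q) : T.Vertex := ⟨[], T.root_mem⟩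

theorem dropLast_mem (T : FiniteWeightedTree q Q) {v : List ℕ} (hv : v ∈ T.verts) :
    v.dropLast ∈ T.verts := by
  rcases List.eq_nil_or_concat v with rfl | ⟨w, j, rfl⟩
  · exact hv
  · simpa using T.parent_mem w j (by simpa using hv)

theorem take_mem (T : FiniteWeightedTree q Q) (v : List ℕ) (hv : v ∈ T.verts) (i : ℕ) :
    v.take i ∈ T.verts := by
  induction v using List.reverseRecOn with
  | nil => simpa using hv
  | append_singleton w j ih =>
    rcases le_or_gt i w.length with h | h
    · rw [List.take_append_of_le_length h]
      exact ih (T.parent_mem w j hv)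
    · rw [List.take_of_length_le (by simp; omega)]
      exact hv

/-- The weight of the path from the root to `v`: the product of the biases along it. -/
def pathWeight (T : FiniteWeightedTree q Q) (v : List ℕ) : ℝ :=
  ∏ i ∈ Finset.range v.length, T.bias (v.take (i + 1))

/-- The weight `ω(T)`: the sum of the weights of all simple paths started at the root. -/
def weight (T : FiniteWeightedTree q Q) : ℝ := ∑ v ∈ T.verts, T.pathWeight v

/-- The depth `D(T)`: the maximal distance of a vertex from the root. -/
def depth (T : FiniteWeightedTree q Q) : ℕ := T.verts.sup List.length

theorem exists_depth (T : FiniteWeightedTree q Q) :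
    (T.verts.filter fun v => v.length = T.depth).Nonempty := by
  obtain ⟨v, hv, h⟩ := Finset.exists_mem_eq_sup T.verts ⟨[], T.root_mem⟩ List.length
  exact ⟨v, Finset.mem_filter.2 ⟨hv, h.symm⟩⟩

/-- `v_base`: the lexicographically minimal vertex among those at maximal distance from the root. -/
def base (T : FiniteWeightedTree q Q) : T.Vertex :=
  ⟨(T.verts.filter fun v => v.length = T.depth).min' T.exists_depth,
    (Finset.mem_filter.1 (Finset.min'_mem _ T.exists_depth)).1⟩

/-- The graph of the tree. -/
def graph (T : FiniteWeightedTree q Q) : SimpleGraph T.Vertex :=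
  SimpleGraph.fromRel fun v w => ∃ j, w.1 = v.1 ++ [j]

/-- The vertex `ψ_i` at distance `i` from the root, for `i ≤ D(T)`, on the simple path from the root
to `v_base`. -/
def spine (T : FiniteWeightedTree q Q) (i : ℕ) : T.Vertex :=
  ⟨T.base.1.take i, T.take_mem _ T.base.2 i⟩

/-- The edges of the simple path from the root to `v_base`. -/
def spineEdges (T : FiniteWeightedTree q Q) : Set (Sym2 T.Vertex) :=
  {e | ∃ i < T.depth, e = s(T.spine i, T.spine (i + 1))}

/-- The vertex set of the `i`-th outgrowth `J_i`: the connected component of `ψ_i` in the graph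
obtained by deleting the edges of the simple path from the root to `v_base`. -/
def outgrowth (T : FiniteWeightedTree q Q) (i : ℕ) : Set T.Vertex :=
  ((T.graph.deleteEdges T.spineEdges).connectedComponentMk (T.spine i)).supp

/-- `B₀`-bare trees. -/
def IsBare (B₀ : ℝ) (T : FiniteWeightedTree q Q) : Prop :=
  ∀ i < T.depth, ((T.outgrowth i).ncard : ℝ) ≤ B₀ * Real.log (Real.log T.weight)

end FiniteWeightedTree

/-! ## Backbone-tree pairs -/

/-- The data of a backbone-tree pair: a weighted tree `backbone` without leaves (every vertex has an
offspring, so the tree is infinite) with a distinguished vertex `head`, and a single-entry weighted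
tree, given by the bias `entBias` of its edge `(head, ent)` and by the finite weighted tree `trap`
of the descendents of `ent`. -/
structure BackboneTreePair (q Q : ℝ) (V : Type u) where
  backbone : WeightedTree q Q V
  leafless : ∀ v, ∃ w, backbone.parent w = some v
  distinguished : V
  trap : FiniteWeightedTree q Q
  entBias : ℝ
  entBias_mem : entBias ∈ Set.Icc q Q

namespace BackboneTreePair

variable {q Q : ℝ} {V : Type u}

/-- The vertices of the pair: those of the backbone (the vertex `head` of the single-entry tree
being identified with the distinguished vertex) and those of the trap. -/
def Vertex (P : BackboneTreePair q Q V) : Type u := V ⊕ P.trap.Vertex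

instance (P : BackboneTreePair q Q V) : MeasurableSpace P.Vertex := ⊤

instance (P : BackboneTreePair q Q V) : DiscreteMeasurableSpace P.Vertex := ⟨fun _ => trivial⟩

/-- The vertex `head`. -/
def head (P : BackboneTreePair q Q V) : P.Vertex := Sum.inl P.distinguished

/-- The vertex `ent`, which is the root of the trap. -/
def ent (P : BackboneTreePair q Q V) : P.Vertex := Sum.inr P.trap.root

/-- The vertex `v_base` of the trap. -/
def base (P : BackboneTreePair q Q V) : P.Vertex := Sum.inr P.trap.base

/-- The vertex set of the trap `T_ent`. -/
def trapSet (P : BackboneTreePair q Q V) : Set P.Vertex := Set.range Sum.inr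

/-- The parent map of the pair. -/
def parentMap (P : BackboneTreePair q Q V) : P.Vertex → Option P.Vertex
  | Sum.inl b => (P.backbone.parent b).map Sum.inl
  | Sum.inr x =>
      if x.1 = [] then some P.head
      else some (Sum.inr ⟨x.1.dropLast, P.trap.dropLast_mem x.2⟩)

/-- The biases of the pair. -/
def biasMap (P : BackboneTreePair q Q V) : P.Vertex → ℝ
  | Sum.inl b => P.backbone.bias b
  | Sum.inr x => if x.1 = [] then P.entBias else P.trap.bias x.1

theorem parentMap_inl (P : BackboneTreePair q Q V) {b : V} {y : P.Vertex}
    (h : P.parentMap (Sum.inl b) = some y) :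
    ∃ c, P.backbone.parent b = some c ∧ y = Sum.inl c := by
  obtain ⟨c, hc, rfl⟩ := Option.map_eq_some_iff.1 h
  exact ⟨c, hc, rfl⟩

theorem transGen_inl (P : BackboneTreePair q Q V) {b : V} {y : P.Vertex}
    (h : Relation.TransGen (fun a b => P.parentMap a = some b) (Sum.inl b) y) :
    ∃ c, y = Sum.inl c ∧ Relation.TransGen (fun a b => P.backbone.parent a = some b) b c := by
  induction h with
  | single h =>
    obtain ⟨c, hc, rfl⟩ := P.parentMap_inl h
    exact ⟨c, rfl, .single hc⟩
  | tail _ h ih =>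
    obtain ⟨c, rfl, hc⟩ := ih
    obtain ⟨d, hd, rfl⟩ := P.parentMap_inl h
    exact ⟨d, rfl, hc.tail hd⟩

theorem transGen_inr (P : BackboneTreePair q Q V) {x : P.trap.Vertex} {y : P.Vertex}
    (h : Relation.TransGen (fun a b => P.parentMap a = some b) (Sum.inr x) y) :
    (∃ c, y = Sum.inl c) ∨ ∃ z : P.trap.Vertex, y = Sum.inr z ∧ z.1.length < x.1.length := by
  have key : ∀ (x : P.trap.Vertex) (y : P.Vertex), P.parentMap (Sum.inr x) = some y →
      (∃ c, y = Sum.inl c) ∨ ∃ z : P.trap.Vertex, y = Sum.inr z ∧ z.1.length < x.1.length := by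
    intro x y h
    simp only [parentMap] at h
    split_ifs at h with h0
    · exact Or.inl ⟨_, (Option.some_injective _ h).symm⟩
    · refine Or.inr ⟨_, (Option.some_injective _ h).symm, ?_⟩
      have := List.length_pos_iff.2 h0
      simp only [List.length_dropLast]
      omega
  induction h with
  | single h => exact key _ _ h
  | tail _ h ih =>
    rcases ih with ⟨c, rfl⟩ | ⟨z, rfl, hz⟩
    · obtain ⟨d, -, rfl⟩ := P.parentMap_inl h
      exact Or.inl ⟨d, rfl⟩
    · rcases key _ _ h with h | ⟨w, rfl, hw⟩
      · exact Or.inl h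
      · exact Or.inr ⟨w, rfl, hw.trans hz⟩

theorem reach_inl (P : BackboneTreePair q Q V) {b c : V}
    (h : Relation.ReflTransGen (fun a b => P.backbone.parent a = some b) b c) :
    Relation.ReflTransGen (fun a b => P.parentMap a = some b) (Sum.inl b) (Sum.inl c) :=
  h.lift Sum.inl fun _ _ hab => congrArg (Option.map Sum.inl) hab

theorem reach_inr (P : BackboneTreePair q Q V) (x : List ℕ) (hx : x ∈ P.trap.verts) :
    Relation.ReflTransGen (fun a b => P.parentMap a = some b) (Sum.inr ⟨x, hx⟩) P.head := by
  induction x using List.reverseRecOn with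
  | nil => exact .single (by simp [parentMap])
  | append_singleton w j ih =>
    refine .head ?_ (ih (P.trap.parent_mem w j hx))
    simp [parentMap]

/-- The backbone-tree pair as a weighted tree: the single-entry tree is attached to the backbone by
identifying its root `head` with the distinguished vertex of the backbone. -/
def tree (P : BackboneTreePair q Q V) : WeightedTree q Q P.Vertex where
  parent := P.parentMap
  acyclic v h := by
    rcases v with b | x
    · obtain ⟨c, hc, h'⟩ := P.transGen_inl h
      cases Sum.inl_injective hc
      exact P.backbone.acyclic b h'
    · rcases P.transGen_inr h with ⟨c, hc⟩ | ⟨z, hz, hlt⟩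
      · cases hc
      · cases Sum.inr_injective hz
        exact lt_irrefl _ hlt
  common_ancestor v w := by
    have red : ∀ v : P.Vertex, ∃ b : V,
        Relation.ReflTransGen (fun a b => P.parentMap a = some b) v (Sum.inl b) := by
      rintro (b | x)
      · exact ⟨b, .refl⟩
      · exact ⟨P.distinguished, P.reach_inr x.1 x.2⟩
    obtain ⟨b, hb⟩ := red v
    obtain ⟨c, hc⟩ := red w
    obtain ⟨a, ha₁, ha₂⟩ := P.backbone.common_ancestor b c
    exact ⟨Sum.inl a, hb.trans (P.reach_inl ha₁), hc.trans (P.reach_inl ha₂)⟩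
  locallyFinite v := by
    have hr : (Set.range (Sum.inr : P.trap.Vertex → P.Vertex)).Finite := Set.finite_range _
    rcases v with b | x
    · refine (((P.backbone.locallyFinite b).image Sum.inl).union hr).subset ?_
      rintro (c | y) h
      · obtain ⟨d, hd, hd'⟩ := P.parentMap_inl h
        cases Sum.inl_injective hd'
        exact Or.inl ⟨c, hd, rfl⟩
      · exact Or.inr ⟨y, rfl⟩
    · refine hr.subset ?_
      rintro (c | y) h
      · obtain ⟨d, -, hd'⟩ := P.parentMap_inl h
        cases hd'
      · exact ⟨y, rfl⟩
  bias := P.biasMap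
  bias_mem v w h := by
    rcases v with b | x
    · obtain ⟨c, hc, -⟩ := P.parentMap_inl h
      exact P.backbone.bias_mem b c hc
    · simp only [biasMap]
      split_ifs with h0
      · exact P.entBias_mem
      · exact P.trap.bias_mem x.1 x.2 h0

/-- The law of the biased walk on the pair started at `v`. -/
def law (P : BackboneTreePair q Q V) (v : P.Vertex) : Measure (ℕ → P.Vertex) := P.tree.walkLaw v

/-- The escape probability `p_esc`: the probability that the walk started at `head` never visits
`ent`. -/
def pEsc (P : BackboneTreePair q Q V) : ℝ :=
  (P.law P.head).real {x | ∀ n, x n ≠ P.ent}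

/-- The probability `p_de` that the walk started at `ent` visits `v_base` before its first visit
to `head`. -/
def pDe (P : BackboneTreePair q Q V) : ℝ :=
  (P.law P.ent).real {x | ∃ n, x n = P.base ∧ ∀ m ≤ n, x m ≠ P.head}

/-- The correction factor `c_f`. -/
def correction (P : BackboneTreePair q Q V) : ℝ := P.pEsc⁻¹ + P.pDe⁻¹ - 1

/-- The trajectories that fall deeply into the trap: they visit `v_base` at a positive time. -/
def fallsDeeply (P : BackboneTreePair q Q V) : Set (ℕ → P.Vertex) :=
  {x | ∃ n, 0 < n ∧ x n = P.base}

/-- The set of times that a trajectory spends in the trap. -/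
def trapTimes (P : BackboneTreePair q Q V) (x : ℕ → P.Vertex) : Set ℕ :=
  {n | x n ∈ P.trapSet}

end BackboneTreePair

/-- The hitting time of `v` by the trajectory `x`, infinite if `x` never visits `v`. -/
def hitTime {S : Type u} (x : ℕ → S) (v : S) : ℕ∞ := ⨅ n ∈ {n : ℕ | x n = v}, (n : ℕ∞)

/-- The trajectory `x` stopped at its hitting time of `v`, which carries the information of `x` on
the time-interval `{0, …, hitTime x v}`. -/
def stoppedAt {S : Type u} (v : S) (x : ℕ → S) : ℕ → S :=
  fun n => x (min (n : ℕ∞) (hitTime x v)).toNat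

end

noncomputable section

/-! ## The Markov property of the biased walk -/

/-! The time in the trap does not see how long the excursions into the backbone last. From `head`
the walk returns to `ent` with probability 1 - p_esc, so τ is the lifetime of a walk on the finite
tree which, when it steps above the root, is killed with probability e = p_esc and is put back at
the root otherwise. Its transition operator P (`killedOp`) is symmetric for the measure π
(`revMeasure`) of total mass 2ω - 1. The expected lifetime L, with L - PL = 1, and the Green
function g with pole at v_base are explicit: g(v) is 1/e plus the resistance of the part of the
spine that v has above it (`potential`). Uniqueness for the Dirichlet problem expresses p_de and the
probability of hitting v_base through g, and c_f = g(v_base) (`correction_eq`). By symmetry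
L(v_base) = Σ π g. As g is close to c_f except far up the spine, where π is small, this is nearly M
= 2 c_f ω.

Approximate exponential law: let t_k be the probability that τ > k from v_base, and a_k = (P^k
L)(v_base). Then a_{k+1} = a_k - t_k exactly, and M t_k - a_k = P^k(M - L)(v_base). Summing over k,
the Green function bounds the total of |M t_k - a_k| by Σ π |M - L| g. So t_k nearly satisfies the
recursion of the powers of 1 - 1/M, and Σ |t_k - exp(-k/M)| is controlled
(`sum_abs_survival_sub_exp_le`).

Bareness makes these errors polylogarithmic in ω. With N = O(log log ω) bounding the outgrowths,
each vertex is within N steps of the spine, so its weight is at most Q^N times the weight w of its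
branch point, and Q^N is a power of log ω. The deviations of g and L from their values at v_base are
of order 1/w and ω/w, up to polylogarithmic terms, and there are at most N D + 1 vertices with D =
O(log ω). A superharmonic function on the backbone bounds p_esc below, and hence c_f above.

Coupling: for an exponential E of mean M, the number of k with exp(-E/M) < t_k has the law of τ from
v_base, and its L¹ distance from E is at most Σ |t_k - exp(-k/M)| + 1. Given the walk, E is drawn
from its conditional law given that this number equals the time in the trap after H; by the strong
Markov property E is then independent of the walk up to H. The time spent before H (all of it if H =
∞) has mean L(root) - P(H < ∞) L(v_base). Here the leading terms cancel, because P(H < ∞) = 1/(p_esc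
c_f). -/

theorem PMF.lintegral_toMeasure {α : Type*} [MeasurableSpace α] [MeasurableSingletonClass α]
    (p : PMF α) {g : α → ℝ≥0∞} (hg : Measurable g) :
    ∫⁻ a, g a ∂p.toMeasure = ∑' a, p a * g a := by
  have h : p.toMeasure = Measure.sum fun a => p a • Measure.dirac a := by
    ext s hs
    rw [PMF.toMeasure_apply _ hs, Measure.sum_apply _ hs]
    refine tsum_congr fun a => ?_
    by_cases ha : a ∈ s <;> simp [ha, hs]
  rw [h, lintegral_sum_measure]
  refine tsum_congr fun a => ?_
  rw [lintegral_smul_measure, lintegral_dirac' a hg, smul_eq_mul]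

namespace WeightedTree

variable {q Q : ℝ} {V : Type u} [MeasurableSpace V] [DiscreteMeasurableSpace V]

/-- The transition kernels of the walk, as kernels from finite histories. -/
def historyKernel (T : WeightedTree q Q V) (n : ℕ) : Kernel ((i : Finset.Iic n) → V) V :=
  T.stepKernel.comap (fun x : (i : Finset.Iic n) → V => x ⟨n, by simp⟩) (measurable_pi_apply _)

instance (T : WeightedTree q Q V) (n : ℕ) : IsMarkovKernel (T.historyKernel n) := by
  unfold historyKernel; infer_instance

theorem walkLaw_eq (T : WeightedTree q Q V) (v : V) :
    T.walkLaw v = Kernel.traj (X := fun _ => V) T.historyKernel 0 (fun _ => v) := rfl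

instance (T : WeightedTree q Q V) (v : V) : IsProbabilityMeasure (T.walkLaw v) := by
  rw [walkLaw_eq]; infer_instance

/-- Two laws of Markov chains with the same initial law and the same transition kernels agree. -/
theorem eq_of_markov (T : WeightedTree q Q V) {m₁ m₂ : Measure (ℕ → V)} [IsProbabilityMeasure m₁]
    [IsProbabilityMeasure m₂] (h0 : m₁.map (fun x => x 0) = m₂.map (fun x => x 0))
    (h₁ : ∀ n, m₁.map (fun x => (Preorder.frestrictLe (π := fun _ => V) n x, x (n + 1))) =
      m₁.map (Preorder.frestrictLe n) ⊗ₘ T.historyKernel n)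
    (h₂ : ∀ n, m₂.map (fun x => (Preorder.frestrictLe (π := fun _ => V) n x, x (n + 1))) =
      m₂.map (Preorder.frestrictLe n) ⊗ₘ T.historyKernel n) : m₁ = m₂ := by
  have key : ∀ n, m₁.map (Preorder.frestrictLe (π := fun _ => V) n) =
      m₂.map (Preorder.frestrictLe n) := by
    intro n
    induction n with
    | zero =>
      have hf : Preorder.frestrictLe (π := fun _ => V) 0 =
          (fun v : V => fun _ : Finset.Iic 0 => v) ∘ (fun x : ℕ → V => x 0) := by
        ext x i
        obtain ⟨i, hi⟩ := i
        have : i = 0 := by simpa using hi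
        subst this
        rfl
      rw [hf, ← Measure.map_map (by fun_prop) (by fun_prop),
        ← Measure.map_map (by fun_prop) (by fun_prop), h0]
    | succ n ih =>
      let G : ((i : Finset.Iic n) → V) × V → ((i : Finset.Iic (n + 1)) → V) :=
        fun p i => if h : i.1 ≤ n then p.1 ⟨i.1, by simpa using h⟩ else p.2
      have hG : Measurable G := by
        refine measurable_pi_iff.2 fun i => ?_
        by_cases h : i.1 ≤ n
        · simp only [G, h, dite_true]; fun_prop
        · simp only [G, h, dite_false]; fun_prop
      have hf : Preorder.frestrictLe (π := fun _ => V) (n + 1) =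
          G ∘ (fun x : ℕ → V => (Preorder.frestrictLe (π := fun _ => V) n x, x (n + 1))) := by
        ext x i
        by_cases h : i.1 ≤ n
        · simp [G, h]
        · have hi : i.1 = n + 1 := by
            have := Finset.mem_Iic.1 i.2
            omega
          simp [G, hi]
      rw [hf, ← Measure.map_map hG (by fun_prop), ← Measure.map_map hG (by fun_prop), h₁, h₂, ih]
  -- Every finite set of times lies in an initial segment, so the marginals on initial segments
  -- determine the law.
  have hproj : IsProjectiveLimit m₁ (fun I : Finset ℕ => m₂.map I.restrict) := by
    intro I
    have hI : I ⊆ Finset.Iic (I.sup id) := fun i hi => Finset.mem_Iic.2 (Finset.le_sup (f := id) hi)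
    have hr₂ : Measurable (Finset.restrict₂ (π := fun _ => V) hI) :=
      measurable_pi_iff.2 fun i => measurable_pi_apply _
    have hr : (I.restrict : (ℕ → V) → _) =
        Finset.restrict₂ (π := fun _ => V) hI ∘ Preorder.frestrictLe (I.sup id) := rfl
    rw [hr, ← Measure.map_map hr₂ (by fun_prop), key, Measure.map_map hr₂ (by fun_prop)]
    rfl
  have : ∀ I : Finset ℕ, IsFiniteMeasure (m₂.map (I.restrict (π := fun _ => V))) :=
    fun I => Measure.isFiniteMeasure_map _ _
  exact hproj.unique fun I => rfl

/-- This is the one-step recursion that `eq_of_markov` asks for, for a chain continued from a given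
history up to time `a`. -/
theorem map_pair_traj (T : WeightedTree q Q V) {a b : ℕ} (hab : a ≤ b)
    (z : (i : Finset.Iic a) → V) :
    (Kernel.traj (X := fun _ => V) T.historyKernel a z).map
        (fun x => (Preorder.frestrictLe (π := fun _ => V) b x, x (b + 1))) =
      (Kernel.traj (X := fun _ => V) T.historyKernel a z).map (Preorder.frestrictLe b) ⊗ₘ
        T.historyKernel b := by
  rw [← Kernel.partialTraj_compProd_eq_map_traj hab, Kernel.traj_map_frestrictLe_apply]

/-- The chain after time `b` is the chain started at its position at time `b`. -/
theorem map_shift_traj (T : WeightedTree q Q V) (b : ℕ) (z : (i : Finset.Iic b) → V) :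
    (Kernel.traj (X := fun _ => V) T.historyKernel b z).map (fun x k => x (b + k)) =
      T.walkLaw (z ⟨b, by simp⟩) := by
  have hs : Measurable (fun (x : ℕ → V) (k : ℕ) => x (b + k)) := by fun_prop
  have : IsProbabilityMeasure ((Kernel.traj (X := fun _ => V) T.historyKernel b z).map
      (fun x k => x (b + k))) := Measure.isProbabilityMeasure_map hs.aemeasurable
  have hdet : ∀ (a : ℕ) (y : (i : Finset.Iic a) → V),
      (Kernel.traj (X := fun _ => V) T.historyKernel a y).map (fun x => x a) =
        Measure.dirac (y ⟨a, by simp⟩) := by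
    intro a y
    have hf : (fun x : ℕ → V => x a) = (fun y : (i : Finset.Iic a) → V => y ⟨a, by simp⟩) ∘
        Preorder.frestrictLe a := rfl
    rw [hf, ← Measure.map_map (by fun_prop) (by fun_prop), Kernel.traj_map_frestrictLe_apply,
      Kernel.partialTraj_self, Kernel.id_apply, Measure.map_dirac' (by fun_prop)]
  refine T.eq_of_markov ?_ ?_ ?_
  · rw [Measure.map_map (by fun_prop) hs, walkLaw_eq, hdet 0]
    exact hdet b z
  · intro n
    have h := T.map_pair_traj (Nat.le_add_right b n) z
    -- `R` forgets the first `b` coordinates. It is harmless because the transition kernel reads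
    -- only the last coordinate of the history, which `R` keeps.
    let R : ((i : Finset.Iic (b + n)) → V) → ((i : Finset.Iic n) → V) :=
      fun y i => y ⟨b + i.1, by have := Finset.mem_Iic.1 i.2; simpa using this⟩
    have hR : Measurable R := by fun_prop
    have e1 : (fun x : ℕ → V => (Preorder.frestrictLe (π := fun _ => V) n x, x (n + 1))) ∘
        (fun x k => x (b + k)) = (Prod.map R id) ∘
          (fun x : ℕ → V => (Preorder.frestrictLe (π := fun _ => V) (b + n) x, x (b + n + 1))) := rfl
    have e2 : (Preorder.frestrictLe (π := fun _ => V) n) ∘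
        (fun (x : ℕ → V) k => x (b + k)) = R ∘ Preorder.frestrictLe (π := fun _ => V) (b + n) := rfl
    rw [Measure.map_map (by fun_prop) hs, Measure.map_map (by fun_prop) hs, e1, e2,
      ← Measure.map_map (by fun_prop) (by fun_prop), ← Measure.map_map hR (by fun_prop), h]
    ext s hs'
    rw [Measure.map_apply (by fun_prop) hs', Measure.compProd_apply (hs'.preimage (by fun_prop)),
      Measure.compProd_apply hs', lintegral_map _ hR]
    · rfl
    · exact Kernel.measurable_kernel_prodMk_left hs'
  · intro n
    rw [walkLaw_eq]
    exact T.map_pair_traj (Nat.zero_le n) _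

theorem ae_zero (T : WeightedTree q Q V) (v : V) : ∀ᵐ x ∂T.walkLaw v, x 0 = v := by
  have h : (T.walkLaw v).map (fun x => x 0) = Measure.dirac v := by
    have hf : (fun x : ℕ → V => x 0) = (fun y : (i : Finset.Iic 0) → V => y ⟨0, by simp⟩) ∘
        Preorder.frestrictLe 0 := rfl
    rw [hf, ← Measure.map_map (by fun_prop) (by fun_prop), walkLaw_eq,
      Kernel.traj_map_frestrictLe_apply,
      Kernel.partialTraj_self, Kernel.id_apply, Measure.map_dirac' (by fun_prop)]
  have h2 : ∀ᵐ y ∂(T.walkLaw v).map (fun x => x 0), y = v := by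
    rw [h]
    exact (ae_dirac_iff (measurableSet_eq (a := v))).2 rfl
  exact ae_of_ae_map (measurable_pi_apply 0).aemeasurable h2

/-- The Markov property at a fixed time. -/
theorem lintegral_shift (T : WeightedTree q Q V) (v : V) (n : ℕ)
    {A : Set ((i : Finset.Iic n) → V)} (hA : MeasurableSet A) {g : (ℕ → V) → ℝ≥0∞}
    (hg : Measurable g) :
    ∫⁻ x in Preorder.frestrictLe n ⁻¹' A, g (fun k => x (n + k)) ∂T.walkLaw v =
      ∫⁻ x in Preorder.frestrictLe n ⁻¹' A, (∫⁻ y, g y ∂T.walkLaw (x n)) ∂T.walkLaw v := by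
  have hs : Measurable (fun (x : ℕ → V) (k : ℕ) => x (n + k)) := by fun_prop
  -- Disintegration over the past: the trajectory is a random history up to time `n`, continued by
  -- the chain started from that history.
  have h := Kernel.partialTraj_compProd_traj (X := fun _ => V) (κ := T.historyKernel)
    (Nat.zero_le n) (fun _ => v)
  have hm : Measurable (fun x : ℕ → V => (Preorder.frestrictLe (π := fun _ => V) n x, x)) := by
    fun_prop
  have hAm : MeasurableSet (Preorder.frestrictLe (π := fun _ => V) n ⁻¹' A) :=
    hA.preimage (by fun_prop)
  let F : ((i : Finset.Iic n) → V) × (ℕ → V) → ℝ≥0∞ :=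
    (Prod.fst ⁻¹' A).indicator (fun p => g (fun k => p.2 (n + k)))
  have hF : Measurable F :=
    (hg.comp (hs.comp measurable_snd)).indicator (hA.preimage measurable_fst)
  have e : ∫⁻ p, F p ∂_ = ∫⁻ p, F p ∂_ := congrArg (fun m => ∫⁻ p, F p ∂m) h
  rw [lintegral_map hF hm, Measure.lintegral_compProd hF, ← Kernel.traj_map_frestrictLe_apply,
    lintegral_map (hF.lintegral_kernel_prod_right') (by fun_prop)] at e
  rw [← lintegral_indicator hAm, ← lintegral_indicator hAm]
  refine Eq.trans ?_ (e.symm.trans ?_)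
  · rfl
  · refine lintegral_congr fun x => ?_
    by_cases hx : Preorder.frestrictLe n x ∈ A
    · have : x ∈ Preorder.frestrictLe (π := fun _ => V) n ⁻¹' A := hx
      rw [Set.indicator_of_mem this]
      have h3 := T.map_shift_traj n (Preorder.frestrictLe (π := fun _ => V) n x)
      have h4 : Preorder.frestrictLe (π := fun _ => V) n x ⟨n, by simp⟩ = x n := rfl
      rw [h4] at h3
      rw [← h3, lintegral_map hg hs]
      refine lintegral_congr fun y => ?_
      simp [F, hx]
    · have : x ∉ Preorder.frestrictLe (π := fun _ => V) n ⁻¹' A := hx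
      rw [Set.indicator_of_notMem this]
      simp [F, hx]

/-- The first-step decomposition. -/
theorem lintegral_first_step (T : WeightedTree q Q V) (v : V) {g : (ℕ → V) → ℝ≥0∞}
    (hg : Measurable g) :
    ∫⁻ x, g (fun k => x (k + 1)) ∂T.walkLaw v = ∑' w, T.step v w * ∫⁻ y, g y ∂T.walkLaw w := by
  have h := T.lintegral_shift v 1 MeasurableSet.univ hg
  simp only [Set.preimage_univ, Measure.restrict_univ] at h
  have h1 : (T.walkLaw v).map (fun x => x 1) = (T.step v).toMeasure := by
    have := Kernel.map_traj_succ_self (X := fun _ => V) (κ := T.historyKernel) (a := 0)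
    rw [walkLaw_eq, ← Kernel.map_apply _ (by fun_prop)]
    have := DFunLike.congr_fun this (fun _ => v)
    exact this
  have h2 : ∫⁻ x, (∫⁻ y, g y ∂T.walkLaw (x 1)) ∂T.walkLaw v =
      ∫⁻ w, (∫⁻ y, g y ∂T.walkLaw w) ∂(T.walkLaw v).map (fun x => x 1) :=
    (lintegral_map (f := fun w => ∫⁻ y, g y ∂T.walkLaw w) Measurable.of_discrete
      (measurable_pi_apply 1)).symm
  rw [h2, h1, PMF.lintegral_toMeasure _ Measurable.of_discrete] at h
  rw [← h]
  refine lintegral_congr fun x => ?_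
  congr 1
  ext k
  rw [add_comm]

theorem measure_first_step (T : WeightedTree q Q V) (v : V) {A : Set (ℕ → V)}
    (hA : MeasurableSet A) :
    T.walkLaw v {x | (fun k => x (k + 1)) ∈ A} = ∑' w, T.step v w * T.walkLaw w A := by
  have hs : Measurable (fun (x : ℕ → V) (k : ℕ) => x (k + 1)) := by fun_prop
  have h := T.lintegral_first_step v (g := A.indicator 1) (measurable_one.indicator hA)
  simp only [lintegral_indicator_one hA] at h
  rw [← h]
  exact (lintegral_indicator_one (hA.preimage hs)).symm

/-- A transition that has probability zero is almost surely never made. -/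
theorem ae_no_jump (T : WeightedTree q Q V) (v : V) {A B : Set V}
    (h : ∀ a ∈ A, ∀ b ∈ B, T.rate a b = 0) (hAB : Disjoint A B) :
    ∀ᵐ x ∂T.walkLaw v, ∀ n, x n ∈ A → x (n + 1) ∉ B := by
  have hstep : ∀ a ∈ A, ∀ b ∈ B, T.step a b = 0 := by
    intro a ha b hb
    unfold step
    split_ifs with h0
    -- When all rates out of a vertex vanish, `step` stays put; disjointness of `A` and `B` excludes
    -- this as a transition.
    · rw [PMF.pure_apply, if_neg]
      rintro rfl
      exact Set.disjoint_left.1 hAB ha hb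
    · simp [h a ha b hb]
  rw [ae_all_iff]
  intro n
  have hA : MeasurableSet {y : (i : Finset.Iic n) → V | y ⟨n, by simp⟩ ∈ A} :=
    (MeasurableSet.of_discrete (s := A)).preimage (measurable_pi_apply _)
  have hB : MeasurableSet {y : ℕ → V | y 1 ∈ B} :=
    (MeasurableSet.of_discrete (s := B)).preimage (measurable_pi_apply _)
  have hg : Measurable ({y : ℕ → V | y 1 ∈ B}.indicator (1 : (ℕ → V) → ℝ≥0∞)) :=
    measurable_one.indicator hB
  have e := T.lintegral_shift v n hA hg
  have hAm : MeasurableSet (Preorder.frestrictLe (π := fun _ => V) n ⁻¹'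
      {y : (i : Finset.Iic n) → V | y ⟨n, by simp⟩ ∈ A}) :=
    hA.preimage (Preorder.measurable_frestrictLe (X := fun _ => V) n)
  have z : ∫⁻ x in Preorder.frestrictLe n ⁻¹' {y : (i : Finset.Iic n) → V | y ⟨n, by simp⟩ ∈ A},
      (∫⁻ y, {y : ℕ → V | y 1 ∈ B}.indicator (1 : (ℕ → V) → ℝ≥0∞) y ∂T.walkLaw (x n))
        ∂T.walkLaw v = 0 := by
    rw [← lintegral_indicator hAm]
    refine (lintegral_congr fun x => ?_).trans lintegral_zero
    by_cases hx : x n ∈ A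
    · have hx' : x ∈ Preorder.frestrictLe n ⁻¹'
          {y : (i : Finset.Iic n) → V | y ⟨n, by simp⟩ ∈ A} := hx
      rw [Set.indicator_of_mem hx', lintegral_indicator_one hB]
      have hB0 : MeasurableSet {y : ℕ → V | y 0 ∈ B} :=
        (MeasurableSet.of_discrete (s := B)).preimage (measurable_pi_apply _)
      refine (T.measure_first_step (x n) hB0).trans (ENNReal.tsum_eq_zero.2 fun w => ?_)
      by_cases hw : w ∈ B
      · rw [hstep _ hx _ hw, zero_mul]
      · have : T.walkLaw w {y : ℕ → V | y 0 ∈ B} = 0 := by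
          rw [measure_eq_zero_iff_ae_notMem]
          filter_upwards [T.ae_zero w] with y hy hyB
          exact hw (hy ▸ hyB)
        rw [this, mul_zero]
    · have hx' : x ∉ Preorder.frestrictLe n ⁻¹'
          {y : (i : Finset.Iic n) → V | y ⟨n, by simp⟩ ∈ A} := hx
      rw [Set.indicator_of_notMem hx']
  have hs : Measurable (fun (x : ℕ → V) (k : ℕ) => x (n + k)) := by fun_prop
  have e' := (lintegral_eq_zero_iff (hg.comp hs)).1 (e.trans z)
  rw [Filter.EventuallyEq, ae_restrict_iff' hAm] at e'
  filter_upwards [e'] with x hx hxA hxB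
  have := hx hxA
  rw [Function.comp_apply, Set.indicator_of_mem (show (fun k => x (n + k)) ∈ {y | y 1 ∈ B} from hxB)]
    at this
  simp at this

end WeightedTree

/-! ## Hitting times -/

section HitTime

variable {S : Type u}

/-- The trajectories that hit `s` for the first time at time `n`. -/
def firstHit (s : S) (n : ℕ) : Set (ℕ → S) := {x | x n = s ∧ ∀ m < n, x m ≠ s}

/-- The trajectories that hit `s`. -/
def hits (s : S) : Set (ℕ → S) := {x | ∃ n, x n = s}

/-- The trajectory after it has hit `s`. -/
def afterHit (s : S) (x : ℕ → S) : ℕ → S := fun k => x ((hitTime x s).toNat + k)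

theorem hitTime_eq_coe_iff {x : ℕ → S} {s : S} {n : ℕ} :
    hitTime x s = n ↔ x ∈ firstHit s n := by
  constructor
  · intro h
    have hlt : ∀ m < n, x m ≠ s := by
      intro m hm hx
      have : hitTime x s ≤ m := iInf₂_le (f := fun (n : ℕ) (_ : n ∈ {n : ℕ | x n = s}) => (n : ℕ∞)) m hx
      rw [h] at this
      exact absurd (Nat.cast_le.1 this) (by omega)
    refine ⟨?_, hlt⟩
    by_contra hn
    have : ((n + 1 : ℕ) : ℕ∞) ≤ hitTime x s := by
      refine le_iInf₂ fun m hm => Nat.cast_le.2 ?_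
      by_contra hc
      rcases Nat.lt_or_ge m n with h1 | h1
      · exact hlt m h1 hm
      · have : m = n := by omega
        subst this
        exact hn hm
    rw [h] at this
    exact absurd (Nat.cast_le.1 this) (by omega)
  · rintro ⟨h1, h2⟩
    refine le_antisymm
      (iInf₂_le (f := fun (n : ℕ) (_ : n ∈ {n : ℕ | x n = s}) => (n : ℕ∞)) n h1) ?_
    refine le_iInf₂ fun m hm => Nat.cast_le.2 ?_
    by_contra hc
    exact h2 m (by omega) hm

theorem hits_eq_iUnion (s : S) : hits s = ⋃ n, firstHit s n := by
  classical
  ext x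
  simp only [hits, Set.mem_ofPred_eq, Set.mem_iUnion]
  constructor
  · intro h
    exact ⟨Nat.find h, Nat.find_spec h, fun m hm => Nat.find_min h hm⟩
  · rintro ⟨n, hn, -⟩
    exact ⟨n, hn⟩

theorem hitTime_eq_top_iff {x : ℕ → S} {s : S} : hitTime x s = ⊤ ↔ x ∉ hits s := by
  constructor
  · intro h hx
    rw [hits_eq_iUnion, Set.mem_iUnion] at hx
    obtain ⟨n, hn⟩ := hx
    rw [hitTime_eq_coe_iff.2 hn] at h
    exact ENat.natCast_ne_top n h
  · intro h
    by_contra hc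
    obtain ⟨n, hn⟩ := ENat.ne_top_iff_exists.1 hc
    exact h ⟨n, (hitTime_eq_coe_iff.1 hn.symm).1⟩

theorem pairwise_disjoint_firstHit (s : S) : Pairwise (Function.onFun Disjoint (firstHit s)) := by
  intro m n hmn
  refine Set.disjoint_left.2 fun x hx hy => hmn ?_
  have h1 := hitTime_eq_coe_iff.2 hx
  rw [hitTime_eq_coe_iff.2 hy] at h1
  exact (Nat.cast_inj.1 h1).symm

theorem stoppedAt_of_mem_firstHit {x : ℕ → S} {s : S} {n : ℕ} (h : x ∈ firstHit s n) :
    stoppedAt s x = fun k => x (min k n) := by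
  ext k
  rw [stoppedAt, hitTime_eq_coe_iff.2 h, ← Nat.mono_cast.map_min, ENat.toNat_natCast]

theorem stoppedAt_of_notMem_hits {x : ℕ → S} {s : S} (h : x ∉ hits s) : stoppedAt s x = x := by
  ext k
  rw [stoppedAt, hitTime_eq_top_iff.2 h, min_top_right, ENat.toNat_natCast]

theorem afterHit_of_mem_firstHit {x : ℕ → S} {s : S} {n : ℕ} (h : x ∈ firstHit s n) :
    afterHit s x = fun k => x (n + k) := by
  ext k
  rw [afterHit, hitTime_eq_coe_iff.2 h, ENat.toNat_natCast]

/-- The stopped trajectory still knows whether `s` is hit, so independence of it entails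
independence of the event of hitting. -/
theorem stoppedAt_mem_hits_iff {x : ℕ → S} {s : S} : stoppedAt s x ∈ hits s ↔ x ∈ hits s := by
  by_cases h : x ∈ hits s
  · refine iff_of_true ?_ h
    rw [hits_eq_iUnion, Set.mem_iUnion] at h
    obtain ⟨n, hn⟩ := h
    rw [stoppedAt_of_mem_firstHit hn]
    exact ⟨n, by simpa using hn.1⟩
  · rw [stoppedAt_of_notMem_hits h]

variable [MeasurableSpace S] [DiscreteMeasurableSpace S]

theorem measurableSet_coord (n : ℕ) (A : Set S) : MeasurableSet {x : ℕ → S | x n ∈ A} :=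
  (MeasurableSet.of_discrete (s := A)).preimage (measurable_pi_apply n)

theorem measurableSet_firstHit (s : S) (n : ℕ) : MeasurableSet (firstHit s n) := by
  have : firstHit s n = {x | x n ∈ ({s} : Set S)} ∩ ⋂ m, ⋂ (_ : m < n), {x | x m ∈ ({s}ᶜ : Set S)} := by
    ext x
    simp [firstHit]
  rw [this]
  exact (measurableSet_coord _ _).inter
    (MeasurableSet.iInter fun m => MeasurableSet.iInter fun _ => measurableSet_coord _ _)

theorem measurableSet_hits (s : S) : MeasurableSet (hits s) := by
  rw [hits_eq_iUnion]
  exact MeasurableSet.iUnion fun n => measurableSet_firstHit s n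

theorem measurable_hitTime (s : S) : Measurable (fun x : ℕ → S => hitTime x s) := by
  refine measurable_to_countable' fun n => ?_
  induction n using ENat.recTopCoe with
  | top =>
    have : (fun x : ℕ → S => hitTime x s) ⁻¹' {⊤} = (hits s)ᶜ := by
      ext x
      exact hitTime_eq_top_iff
    rw [this]
    exact (measurableSet_hits s).compl
  | coe n =>
    have : (fun x : ℕ → S => hitTime x s) ⁻¹' {(n : ℕ∞)} = firstHit s n := by
      ext x
      exact hitTime_eq_coe_iff
    rw [this]
    exact measurableSet_firstHit s n

theorem measurable_eval_comp {N : (ℕ → S) → ℕ} (hN : Measurable N) :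
    Measurable (fun x : ℕ → S => x (N x)) := by
  intro A _
  have : (fun x : ℕ → S => x (N x)) ⁻¹' A = ⋃ n, N ⁻¹' {n} ∩ {x | x n ∈ A} := by
    ext x
    simp
  rw [this]
  exact MeasurableSet.iUnion fun n =>
    ((measurableSet_singleton n).preimage hN).inter (measurableSet_coord _ _)

theorem measurable_stoppedAt (s : S) : Measurable (stoppedAt s) :=
  measurable_pi_iff.2 fun k => measurable_eval_comp
    ((Measurable.of_discrete (f := fun n : ℕ∞ => (min (k : ℕ∞) n).toNat)).comp (measurable_hitTime s))

theorem measurable_afterHit (s : S) : Measurable (afterHit s) :=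
  measurable_pi_iff.2 fun k => measurable_eval_comp
    ((Measurable.of_discrete (f := fun n : ℕ∞ => n.toNat + k)).comp (measurable_hitTime s))

end HitTime

/-- The strong Markov property at the hitting time of a vertex. -/
theorem WeightedTree.lintegral_afterHit {q Q : ℝ} {V : Type u} [MeasurableSpace V]
    [DiscreteMeasurableSpace V] (T : WeightedTree q Q V) (v s : V) {C : Set (ℕ → V)}
    (hC : MeasurableSet C) {g : (ℕ → V) → ℝ≥0∞} (hg : Measurable g) :
    ∫⁻ x in hits s ∩ stoppedAt s ⁻¹' C, g (afterHit s x) ∂T.walkLaw v =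
      T.walkLaw v (hits s ∩ stoppedAt s ⁻¹' C) * ∫⁻ y, g y ∂T.walkLaw s := by
  have hCm : MeasurableSet (stoppedAt s ⁻¹' C) := hC.preimage (measurable_stoppedAt s)
  have hm : ∀ n, MeasurableSet (firstHit s n ∩ stoppedAt s ⁻¹' C) :=
    fun n => (measurableSet_firstHit s n).inter hCm
  have hd : Pairwise (Function.onFun Disjoint fun n => firstHit s n ∩ stoppedAt s ⁻¹' C) :=
    fun m n hmn => (pairwise_disjoint_firstHit s hmn).mono Set.inter_subset_left
      Set.inter_subset_left
  rw [hits_eq_iUnion, Set.iUnion_inter, lintegral_iUnion hm hd, measure_iUnion hd hm,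
    ← ENNReal.tsum_mul_right]
  refine tsum_congr fun n => ?_
  -- On `firstHit s n` the stopped trajectory is the history up to `n` frozen from then on. The
  -- event is thus decided at time `n`, and the Markov property at a fixed time applies.
  let ext : ((i : Finset.Iic n) → V) → ℕ → V := fun y k => y ⟨min k n, by simp⟩
  have hext : Measurable ext := by fun_prop
  let A : Set ((i : Finset.Iic n) → V) := ext ⁻¹' (firstHit s n ∩ C)
  have hA : MeasurableSet A := ((measurableSet_firstHit s n).inter hC).preimage hext
  have hAeq : firstHit s n ∩ stoppedAt s ⁻¹' C = Preorder.frestrictLe n ⁻¹' A := by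
    ext x
    have h1 : ext (Preorder.frestrictLe n x) = fun k => x (min k n) := rfl
    have h2 : (fun k => x (min k n)) ∈ firstHit s n ↔ x ∈ firstHit s n := by
      simp only [firstHit, Set.mem_ofPred_eq, min_self]
      refine and_congr_right fun _ => forall₂_congr fun m hm => ?_
      rw [min_eq_left hm.le]
    simp only [A, Set.mem_inter_iff, Set.mem_preimage, h1, h2]
    refine and_congr_right fun hx => ?_
    rw [stoppedAt_of_mem_firstHit hx]
  have e := T.lintegral_shift v n hA hg
  rw [← hAeq] at e
  rw [mul_comm, ← setLIntegral_const]
  refine (setLIntegral_congr_fun (hm n) fun x hx => ?_).trans (e.trans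
    (setLIntegral_congr_fun (hm n) fun x hx => ?_))
  · simp only [afterHit_of_mem_firstHit hx.1]
  · simp only [hx.1.1]

/-! ## The walk observed in the trap: a reversible substochastic operator -/

namespace FiniteWeightedTree

variable {q Q : ℝ}

/-- The offspring of `v`. -/
def children (T : FiniteWeightedTree q Q) (v : List ℕ) : Finset (List ℕ) :=
  T.verts.filter fun c => c ≠ [] ∧ c.dropLast = v

/-- The total jump rate out of `v`, with rate `1` towards the parent. -/
def totalRate (T : FiniteWeightedTree q Q) (v : List ℕ) : ℝ := 1 + ∑ c ∈ T.children v, T.bias c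

/-- The reversible measure of the walk. -/
def revMeasure (T : FiniteWeightedTree q Q) (v : List ℕ) : ℝ := T.pathWeight v * T.totalRate v

/-- The transition operator of the walk on the tree which, when it leaves through the root, is
killed with probability `e` and sent back to the root otherwise. -/
def killedOp (T : FiniteWeightedTree q Q) (e : ℝ) (f : List ℕ → ℝ) (v : List ℕ) : ℝ :=
  ((if v = [] then (1 - e) * f [] else f v.dropLast) + ∑ c ∈ T.children v, T.bias c * f c) /
    T.totalRate v

/-- The sum of `g` over the vertices other than the root on the path from the root to `v`. -/
def pathSum (g : List ℕ → ℝ) (v : List ℕ) : ℝ := ∑ i ∈ Finset.range v.length, g (v.take (i + 1))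

theorem pathSum_nil (g : List ℕ → ℝ) : pathSum g [] = 0 := by simp [pathSum]

theorem pathSum_of_ne_nil (g : List ℕ → ℝ) {v : List ℕ} (hv : v ≠ []) :
    pathSum g v = pathSum g v.dropLast + g v := by
  obtain ⟨w, j, rfl⟩ := (List.eq_nil_or_concat v).resolve_left hv
  simp only [pathSum, List.concat_eq_append, List.length_append, List.length_singleton,
    List.dropLast_concat, Finset.sum_range_succ]
  congr 1
  · refine Finset.sum_congr rfl fun i hi => ?_
    rw [List.take_append_of_le_length (by have := Finset.mem_range.1 hi; omega)]
  · rw [List.take_of_length_le (by simp)]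

variable (T : FiniteWeightedTree q Q)

theorem pathWeight_nil : T.pathWeight [] = 1 := by simp [pathWeight]

theorem pathWeight_of_ne_nil {v : List ℕ} (hv : v ≠ []) :
    T.pathWeight v = T.pathWeight v.dropLast * T.bias v := by
  obtain ⟨w, j, rfl⟩ := (List.eq_nil_or_concat v).resolve_left hv
  simp only [pathWeight, List.concat_eq_append, List.length_append, List.length_singleton,
    List.dropLast_concat, Finset.prod_range_succ]
  congr 1
  · refine Finset.prod_congr rfl fun i hi => ?_
    rw [List.take_append_of_le_length (by have := Finset.mem_range.1 hi; omega)]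
  · rw [List.take_of_length_le (by simp)]

theorem mem_children {v c : List ℕ} : c ∈ T.children v ↔ c ∈ T.verts ∧ c ≠ [] ∧ c.dropLast = v := by
  simp [children]

/-- Every vertex other than the root is the offspring of exactly one vertex, so a sum over edges may
be indexed by the lower endpoints. -/
theorem sum_sum_children (F : List ℕ → List ℕ → ℝ) :
    ∑ v ∈ T.verts, ∑ c ∈ T.children v, F v c = ∑ c ∈ T.verts with c ≠ [], F c.dropLast c := by
  have h := Finset.sum_fiberwise_of_maps_to (s := T.verts.filter fun c => c ≠ []) (t := T.verts)
    (g := List.dropLast) (fun c hc => T.dropLast_mem (Finset.mem_filter.1 hc).1)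
    (fun c => F c.dropLast c)
  rw [← h]
  refine Finset.sum_congr rfl fun v _ => ?_
  rw [children, Finset.filter_filter]
  refine Finset.sum_congr rfl fun c hc => ?_
  rw [(Finset.mem_filter.1 hc).2.2]

theorem sum_eq_root_add (F : List ℕ → ℝ) :
    ∑ v ∈ T.verts, F v = F [] + ∑ v ∈ T.verts with v ≠ [], F v := by
  have h : (T.verts.filter fun v => v ≠ []) = T.verts.erase [] := by
    ext v
    simp [and_comm]
  rw [h, Finset.add_sum_erase _ _ T.root_mem]

/-- `revMeasure v` is the sum of the conductances of the edges at `v`, where the edge above `c` has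
conductance `pathWeight c`. Each edge therefore contributes once at its lower and once at its upper
end. -/
theorem sum_revMeasure_mul (F : List ℕ → ℝ) :
    ∑ v ∈ T.verts, T.revMeasure v * F v = ∑ v ∈ T.verts, T.pathWeight v * F v +
      ∑ c ∈ T.verts with c ≠ [], T.pathWeight c * F c.dropLast := by
  have h := T.sum_sum_children fun v c => T.pathWeight v * T.bias c * F v
  have h2 : ∑ c ∈ T.verts with c ≠ [], T.pathWeight c * F c.dropLast =
      ∑ c ∈ T.verts with c ≠ [], T.pathWeight c.dropLast * T.bias c * F c.dropLast :=
    Finset.sum_congr rfl fun c hc => by rw [T.pathWeight_of_ne_nil (Finset.mem_filter.1 hc).2]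
  rw [h2, ← h, ← Finset.sum_add_distrib]
  refine Finset.sum_congr rfl fun v _ => ?_
  rw [revMeasure, totalRate, mul_add, mul_one, add_mul, Finset.mul_sum, Finset.sum_mul]

/-- All edges count twice except the edge above the root, of conductance 1, whose upper end lies
outside the tree. -/
theorem sum_revMeasure : ∑ v ∈ T.verts, T.revMeasure v = 2 * T.weight - 1 := by
  have h := T.sum_revMeasure_mul fun _ => 1
  have h2 := T.sum_eq_root_add T.pathWeight
  rw [T.pathWeight_nil] at h2
  simp only [mul_one] at h
  rw [h, weight]
  linarith

section Pos

variable {T}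

theorem bias_pos (hq : 1 < q) {v : List ℕ} (hv : v ∈ T.verts) (h0 : v ≠ []) : 0 < T.bias v :=
  (zero_lt_one.trans hq).trans_le (T.bias_mem v hv h0).1

theorem pathWeight_pos (hq : 1 < q) {v : List ℕ} (hv : v ∈ T.verts) : 0 < T.pathWeight v := by
  induction v using List.reverseRecOn with
  | nil => simp [pathWeight]
  | append_singleton w j ih =>
    rw [T.pathWeight_of_ne_nil (by simp)]
    refine mul_pos ?_ (bias_pos hq hv (by simp))
    simpa using ih (T.parent_mem w j hv)

theorem child_bias_pos (hq : 1 < q) {v c : List ℕ} (hc : c ∈ T.children v) : 0 < T.bias c :=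
  bias_pos hq (T.mem_children.1 hc).1 (T.mem_children.1 hc).2.1

theorem one_le_totalRate (hq : 1 < q) (v : List ℕ) : 1 ≤ T.totalRate v :=
  le_add_of_nonneg_right (Finset.sum_nonneg fun _ hc => (child_bias_pos hq hc).le)

theorem totalRate_pos (hq : 1 < q) (v : List ℕ) : 0 < T.totalRate v :=
  zero_lt_one.trans_le (one_le_totalRate hq v)

theorem revMeasure_pos (hq : 1 < q) {v : List ℕ} (hv : v ∈ T.verts) : 0 < T.revMeasure v :=
  mul_pos (pathWeight_pos hq hv) (totalRate_pos hq v)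

theorem one_le_weight (hq : 1 < q) : 1 ≤ T.weight := by
  rw [weight, sum_eq_root_add, T.pathWeight_nil]
  exact le_add_of_nonneg_right (Finset.sum_nonneg fun v hv =>
    (pathWeight_pos hq (Finset.mem_filter.1 hv).1).le)

/-- Detailed balance: both sides are a symmetric sum over edges, in which the return after leaving
through the root acts as a loop of conductance `1 - e`. -/
theorem sum_revMeasure_mul_killedOp (hq : 1 < q) (e : ℝ) (f g : List ℕ → ℝ) :
    ∑ v ∈ T.verts, T.revMeasure v * (f v * T.killedOp e g v) =
      ∑ v ∈ T.verts, T.revMeasure v * (T.killedOp e f v * g v) := by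
  have key : ∀ f g : List ℕ → ℝ, ∑ v ∈ T.verts, T.revMeasure v * (f v * T.killedOp e g v) =
      (1 - e) * (f [] * g []) + (∑ c ∈ T.verts with c ≠ [], T.pathWeight c * (f c * g c.dropLast) +
        ∑ c ∈ T.verts with c ≠ [], T.pathWeight c * (f c.dropLast * g c)) := by
    intro f g
    have h := T.sum_sum_children fun v c => T.pathWeight v * T.bias c * (f v * g c)
    have h2 : ∑ c ∈ T.verts with c ≠ [], T.pathWeight c * (f c.dropLast * g c) =
        ∑ c ∈ T.verts with c ≠ [], T.pathWeight c.dropLast * T.bias c * (f c.dropLast * g c) :=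
      Finset.sum_congr rfl fun c hc => by rw [T.pathWeight_of_ne_nil (Finset.mem_filter.1 hc).2]
    have h3 : ∀ v ∈ T.verts, T.revMeasure v * (f v * T.killedOp e g v) =
        T.pathWeight v * f v * (if v = [] then (1 - e) * g [] else g v.dropLast) +
          ∑ c ∈ T.children v, T.pathWeight v * T.bias c * (f v * g c) := by
      intro v hv
      have hZ := (totalRate_pos (T := T) hq v).ne'
      have h4 : ∑ c ∈ T.children v, T.pathWeight v * T.bias c * (f v * g c) =
          T.pathWeight v * f v * ∑ c ∈ T.children v, T.bias c * g c := by
        rw [Finset.mul_sum]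
        exact Finset.sum_congr rfl fun c _ => by ring
      rw [h4, revMeasure, killedOp]
      field_simp
    rw [Finset.sum_congr rfl h3, Finset.sum_add_distrib, h, h2, T.sum_eq_root_add, if_pos rfl,
      T.pathWeight_nil, add_assoc]
    congr 1
    · ring
    · congr 1
      refine Finset.sum_congr rfl fun c hc => ?_
      rw [if_neg (Finset.mem_filter.1 hc).2]
      ring
  rw [key f g]
  have h5 := key g f
  calc _ = (1 - e) * (g [] * f []) + (∑ c ∈ T.verts with c ≠ [], T.pathWeight c * (g c * f c.dropLast) +
        ∑ c ∈ T.verts with c ≠ [], T.pathWeight c * (g c.dropLast * f c)) := by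
        rw [mul_comm (f []), add_comm (∑ c ∈ T.verts with c ≠ [], T.pathWeight c * (f c * _))]
        simp only [mul_comm (f _)]
    _ = _ := by
        rw [← h5]
        exact Finset.sum_congr rfl fun c _ => by rw [mul_comm (g c)]

theorem killedOp_congr (e : ℝ) {f g : List ℕ → ℝ} (h : ∀ v ∈ T.verts, f v = g v) {v : List ℕ}
    (hv : v ∈ T.verts) : T.killedOp e f v = T.killedOp e g v := by
  rw [killedOp, killedOp, h [] T.root_mem, h _ (T.dropLast_mem hv),
    Finset.sum_congr rfl fun c hc => by rw [h c (T.mem_children.1 hc).1]]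

theorem killedOp_mono (hq : 1 < q) {e : ℝ} (he : e ≤ 1) {f g : List ℕ → ℝ} (h : ∀ v ∈ T.verts, f v ≤ g v)
    {v : List ℕ} (hv : v ∈ T.verts) : T.killedOp e f v ≤ T.killedOp e g v := by
  rw [killedOp, killedOp]
  refine div_le_div_of_nonneg_right (add_le_add ?_ (Finset.sum_le_sum fun c hc =>
    mul_le_mul_of_nonneg_left (h c (T.mem_children.1 hc).1) (child_bias_pos hq hc).le))
    (totalRate_pos hq v).le
  split_ifs
  · exact mul_le_mul_of_nonneg_left (h [] T.root_mem) (by linarith)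
  · exact h _ (T.dropLast_mem hv)

end Pos

theorem killedOp_linear (e a b : ℝ) (f g : List ℕ → ℝ) (v : List ℕ) :
    T.killedOp e (fun u => a * f u + b * g u) v = a * T.killedOp e f v + b * T.killedOp e g v := by
  have : ∑ c ∈ T.children v, T.bias c * (a * f c + b * g c) =
      a * ∑ c ∈ T.children v, T.bias c * f c + b * ∑ c ∈ T.children v, T.bias c * g c := by
    rw [Finset.mul_sum, Finset.mul_sum, ← Finset.sum_add_distrib]
    exact Finset.sum_congr rfl fun c _ => by ring
  simp only [killedOp, this]
  split_ifs <;> ring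

theorem killedOp_zero (e : ℝ) (v : List ℕ) : T.killedOp e (fun _ => 0) v = 0 := by
  simp [killedOp]

/-- The generator applied to a function given by its increments along the edges. -/
theorem totalRate_mul_sub_killedOp (hq : 1 < q) (e a : ℝ) (g : List ℕ → ℝ) {v : List ℕ} :
    T.totalRate v * ((a + pathSum g v) - T.killedOp e (fun u => a + pathSum g u) v) =
      (if v = [] then e * a else g v) - ∑ c ∈ T.children v, T.bias c * g c := by
  have hZ := (totalRate_pos (T := T) hq v).ne'
  have h : ∑ c ∈ T.children v, T.bias c * (a + pathSum g c) =
      (T.totalRate v - 1) * (a + pathSum g v) + ∑ c ∈ T.children v, T.bias c * g c := by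
    rw [totalRate, add_sub_cancel_left, Finset.sum_mul, ← Finset.sum_add_distrib]
    refine Finset.sum_congr rfl fun c hc => ?_
    obtain ⟨-, h0, hd⟩ := T.mem_children.1 hc
    rw [pathSum_of_ne_nil g h0, hd]
    ring
  rw [killedOp, h, mul_sub, mul_div_cancel₀ _ hZ]
  split_ifs with h0
  · subst h0
    rw [pathSum_nil]
    ring
  · rw [pathSum_of_ne_nil g h0]
    ring

/-- The total path weight of the descendents of `u` (including `u`). -/
def branchWeight (u : List ℕ) : ℝ := ∑ v ∈ T.verts with u <+: v, T.pathWeight v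

/-- The expected time the walk takes from `u` to the parent of `u`. -/
def climbTime (u : List ℕ) : ℝ := 2 * T.branchWeight u / T.pathWeight u - 1

/-- The expected lifetime of the killed walk. -/
def lifetime (e : ℝ) (v : List ℕ) : ℝ := (2 * T.weight - 1) / e + pathSum T.climbTime v

theorem branchWeight_nil : T.branchWeight [] = T.weight := by simp [branchWeight, weight]

/-- The proper descendents of a vertex are distributed over the branches of its offspring;
`eq_of_mem_children` says that the branch is unique. -/
theorem prefix_child_iff {v u : List ℕ} (hu : u ∈ T.verts) :
    (∃ c ∈ T.children v, c <+: u) ↔ v <+: u ∧ u ≠ v := by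
  constructor
  · rintro ⟨c, hc, hcu⟩
    obtain ⟨-, h0, rfl⟩ := T.mem_children.1 hc
    refine ⟨(List.dropLast_prefix c).trans hcu, ?_⟩
    rintro rfl
    have := hcu.length_le
    have := List.length_pos_iff.2 h0
    simp at *
    omega
  · rintro ⟨⟨t, rfl⟩, hne⟩
    rcases t with _ | ⟨j, t⟩
    · simp at hne
    · refine ⟨v ++ [j], T.mem_children.2 ⟨?_, by simp, by simp⟩, ⟨t, by simp⟩⟩
      have := T.take_mem _ hu (v.length + 1)
      rwa [List.take_append, List.take_of_length_le (by omega), Nat.add_sub_cancel_left] at this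

theorem eq_of_mem_children {v u c c' : List ℕ} (hc : c ∈ T.children v) (hc' : c' ∈ T.children v)
    (h : c <+: u) (h' : c' <+: u) : c = c' := by
  obtain ⟨-, h0, hd⟩ := T.mem_children.1 hc
  obtain ⟨-, h0', hd'⟩ := T.mem_children.1 hc'
  have hl : c.length = c'.length := by
    have h1 := congrArg List.length (hd.trans hd'.symm)
    have h2 := List.length_pos_iff.2 h0
    have h3 := List.length_pos_iff.2 h0'
    simp only [List.length_dropLast] at h1
    omega
  exact (List.prefix_of_prefix_length_le h h' hl.le).eq_of_length hl

theorem branchWeight_eq {v : List ℕ} (hv : v ∈ T.verts) :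
    T.branchWeight v = T.pathWeight v + ∑ c ∈ T.children v, T.branchWeight c := by
  have h1 : ∑ c ∈ T.children v, T.branchWeight c =
      ∑ u ∈ T.verts, ∑ c ∈ T.children v, if c <+: u then T.pathWeight u else 0 := by
    rw [Finset.sum_comm]
    exact Finset.sum_congr rfl fun c _ => by rw [branchWeight, Finset.sum_filter]
  have h2 : ∀ u ∈ T.verts, (∑ c ∈ T.children v, if c <+: u then T.pathWeight u else 0) =
      if v <+: u ∧ u ≠ v then T.pathWeight u else 0 := by
    intro u hu
    split_ifs with h
    · obtain ⟨c, hc, hcu⟩ := (T.prefix_child_iff hu).2 h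
      rw [Finset.sum_eq_single_of_mem c hc, if_pos hcu]
      intro c' hc' hne
      exact if_neg fun h' => hne (T.eq_of_mem_children hc' hc h' hcu)
    · refine Finset.sum_eq_zero fun c hc => if_neg fun hcu => h ?_
      exact (T.prefix_child_iff hu).1 ⟨c, hc, hcu⟩
  rw [h1, Finset.sum_congr rfl h2, branchWeight, Finset.sum_filter,
    ← Finset.add_sum_erase _ _ hv, ← Finset.add_sum_erase T.verts (fun u => if v <+: u ∧ u ≠ v
      then T.pathWeight u else 0) hv, if_pos (List.prefix_refl v)]
  simp only [ne_eq, not_true_eq_false, and_false, if_false, zero_add]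
  congr 1
  refine Finset.sum_congr rfl fun u hu => ?_
  simp [(Finset.mem_erase.1 hu).1]

theorem pathWeight_le_branchWeight (hq : 1 < q) {v : List ℕ} (hv : v ∈ T.verts) :
    T.pathWeight v ≤ T.branchWeight v :=
  Finset.single_le_sum (f := T.pathWeight) (fun _ hu =>
    (pathWeight_pos hq (Finset.mem_filter.1 hu).1).le)
    (Finset.mem_filter.2 ⟨hv, List.prefix_refl v⟩)

theorem branchWeight_le_weight (hq : 1 < q) (v : List ℕ) : T.branchWeight v ≤ T.weight :=
  Finset.sum_le_sum_of_subset_of_nonneg (Finset.filter_subset _ _)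
    fun _ hu _ => (pathWeight_pos hq hu).le

theorem one_le_climbTime (hq : 1 < q) {v : List ℕ} (hv : v ∈ T.verts) : 1 ≤ T.climbTime v := by
  have h1 := T.pathWeight_le_branchWeight hq hv
  have h2 := pathWeight_pos hq hv
  have : 1 ≤ T.branchWeight v / T.pathWeight v := by rwa [one_le_div h2]
  rw [climbTime, mul_div_assoc]
  linarith

theorem climbTime_nil : T.climbTime [] = 2 * T.weight - 1 := by
  rw [climbTime, branchWeight_nil, pathWeight_nil, div_one]

/-- First-step analysis: with h the climbing time and Z the total rate, Z h(v) = Z + Σ β_c (h(c) +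
h(v)), and Z - Σ β_c = 1. -/
theorem climbTime_eq (hq : 1 < q) {v : List ℕ} (hv : v ∈ T.verts) :
    T.climbTime v - ∑ c ∈ T.children v, T.bias c * T.climbTime c = T.totalRate v := by
  have hw := (pathWeight_pos hq hv).ne'
  have h : ∀ c ∈ T.children v, T.bias c * T.climbTime c =
      2 / T.pathWeight v * T.branchWeight c - T.bias c := by
    intro c hc
    obtain ⟨hcv, h0, hd⟩ := T.mem_children.1 hc
    have hb := (bias_pos hq hcv h0).ne'
    rw [climbTime, T.pathWeight_of_ne_nil h0, hd]
    field_simp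
  rw [Finset.sum_congr rfl h, Finset.sum_sub_distrib, ← Finset.mul_sum, climbTime,
    T.branchWeight_eq hv, totalRate]
  field_simp
  ring

theorem pathSum_nonneg_of {g : List ℕ → ℝ} (hg : ∀ v ∈ T.verts, 0 ≤ g v) {v : List ℕ}
    (hv : v ∈ T.verts) : 0 ≤ pathSum g v :=
  Finset.sum_nonneg fun _ _ => hg _ (T.take_mem v hv _)

theorem lifetime_pos (hq : 1 < q) {e : ℝ} (he : 0 < e) {v : List ℕ} (hv : v ∈ T.verts) :
    0 < T.lifetime e v := by
  have h1 := one_le_weight (T := T) hq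
  refine add_pos_of_pos_of_nonneg (div_pos (by linarith) he)
    (T.pathSum_nonneg_of (fun u hu => ?_) hv)
  linarith [T.one_le_climbTime hq hu]

/-- The increments of `lifetime` along the edges solve `climbTime_eq`. At the root, `(2 * T.weight -
1) / e` is the climbing time multiplied by the mean number `1 / e` of exits until the killing. -/
theorem killedOp_lifetime (hq : 1 < q) {e : ℝ} (he : 0 < e) {v : List ℕ} (hv : v ∈ T.verts) :
    T.killedOp e (T.lifetime e) v = T.lifetime e v - 1 := by
  have h := T.totalRate_mul_sub_killedOp hq e ((2 * T.weight - 1) / e) T.climbTime (v := v)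
  have h2 : (if v = [] then e * ((2 * T.weight - 1) / e) else T.climbTime v) = T.climbTime v := by
    split_ifs with h0
    · rw [h0, climbTime_nil, mul_div_cancel₀ _ he.ne']
    · rfl
  rw [h2, T.climbTime_eq hq hv] at h
  have hZ := (totalRate_pos (T := T) hq v).ne'
  have h3 := mul_left_cancel₀ hZ (h.trans (mul_one _).symm)
  have h4 : T.killedOp e (T.lifetime e) v =
    T.killedOp e (fun u => (2 * T.weight - 1) / e + pathSum T.climbTime u) v := rfl
  rw [h4, lifetime]
  linarith

/-- The maximum principle. -/
theorem nonpos_of_le_killedOp (hq : 1 < q) {e : ℝ} (he : 0 < e) (he1 : e ≤ 1) {f : List ℕ → ℝ}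
    (hf : ∀ v ∈ T.verts, 0 < f v → f v ≤ T.killedOp e f v) {v : List ℕ} (hv : v ∈ T.verts) :
    f v ≤ 0 := by
  -- Comparison with `lifetime`, which is positive and lowered by exactly 1 by the operator: at a
  -- positive maximum of the quotient, `f` would be strictly larger than its image.
  obtain ⟨u, hu, hmax⟩ := Finset.exists_max_image T.verts (fun v => f v / T.lifetime e v)
    ⟨[], T.root_mem⟩
  have hpos : ∀ v ∈ T.verts, 0 < T.lifetime e v := fun v hv => T.lifetime_pos hq he hv
  set c := f u / T.lifetime e u with hc
  -- The summand `0 * 0` only gives the bound the shape of `killedOp_linear`.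
  have hle : ∀ v ∈ T.verts, f v ≤ c * T.lifetime e v + 0 * 0 := fun v hv => by
    rw [mul_zero, add_zero]
    exact (div_le_iff₀ (hpos v hv)).1 (hmax v hv)
  have hcu : f u = c * T.lifetime e u := (div_mul_cancel₀ _ (hpos u hu).ne').symm
  have hc0 : c ≤ 0 := by
    by_contra hc0
    push Not at hc0
    have h1 := hf u hu (by rw [hcu]; exact mul_pos hc0 (hpos u hu))
    have h2 := killedOp_mono hq he1 hle hu
    rw [T.killedOp_linear e c 0 (T.lifetime e) (fun _ => 0) u, T.killedOp_lifetime hq he hu] at h2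
    nlinarith
  have := hle v hv
  nlinarith [hpos v hv]

/-- Uniqueness for the Dirichlet problem with boundary point `b`: where the difference is positive
the vertex is not `b`, so the maximum principle applies to both signs of the difference. -/
theorem eq_of_eq_killedOp (hq : 1 < q) {e : ℝ} (he : 0 < e) (he1 : e ≤ 1) {f g : List ℕ → ℝ}
    {b : List ℕ} (hb : f b = g b)
    (hf : ∀ v ∈ T.verts, v ≠ b → f v = T.killedOp e f v)
    (hg : ∀ v ∈ T.verts, v ≠ b → g v = T.killedOp e g v) {v : List ℕ} (hv : v ∈ T.verts) :
    f v = g v := by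
  have key : ∀ f g : List ℕ → ℝ, f b = g b → (∀ v ∈ T.verts, v ≠ b → f v = T.killedOp e f v) →
      (∀ v ∈ T.verts, v ≠ b → g v = T.killedOp e g v) → f v ≤ g v := by
    intro f g hb hf hg
    have := T.nonpos_of_le_killedOp hq he he1 (f := fun v => 1 * f v + (-1) * g v) (fun u hu h0 => by
      rcases eq_or_ne u b with rfl | hub
      · exact absurd h0 (by rw [hb]; simp)
      · rw [T.killedOp_linear, ← hf u hu hub, ← hg u hu hub]) hv
    linarith
  exact le_antisymm (key f g hb hf hg) (key g f hb.symm hg hf)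

end FiniteWeightedTree

/-! ## Comparison of the lifetime from the base with the exponential law -/

section Sequence

variable {M : ℝ}

/-- If `M * t k` were equal to `a k`, then `a` would be exactly geometric of ratio `1 - 1 / M`, and
so would `t`. The contraction by this ratio sums the perturbations up to a factor `M`, which the
division by `M` absorbs. -/
theorem sum_abs_sub_geometric_le (hM : 1 ≤ M) {t a : ℕ → ℝ} (hat : ∀ k, a (k + 1) = a k - t k)
    {S : ℝ} (hS : ∀ n, ∑ k ∈ Finset.range n, |M * t k - a k| ≤ S) (n : ℕ) :
    ∑ k ∈ Finset.range n, |t k - (1 - 1 / M) ^ k| ≤ 2 * S / M + |a 0 - M| := by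
  have hM0 : 0 < M := by linarith
  set r := 1 - 1 / M with hr
  have hr0 : 0 ≤ r := by rw [hr, sub_nonneg, div_le_one hM0]; exact hM
  have hrM : 1 - r = 1 / M := by rw [hr]; ring
  have hr1 : r < 1 := by
    have : 0 < 1 / M := by positivity
    linarith
  -- `e` is the defect in the recursion `a (k + 1) = r * a k`, and `d` is the resulting deviation of
  -- `a` from the geometric sequence.
  set e : ℕ → ℝ := fun k => (a k - M * t k) / M with he
  set d : ℕ → ℝ := fun k => a k - r ^ k * a 0 with hd
  have hE : ∀ n, ∑ k ∈ Finset.range n, |e k| ≤ S / M := by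
    intro n
    rw [le_div_iff₀ hM0, Finset.sum_mul]
    refine le_trans (le_of_eq (Finset.sum_congr rfl fun k _ => ?_)) (hS n)
    rw [he, abs_div, abs_of_pos hM0, div_mul_cancel₀ _ hM0.ne', abs_sub_comm]
  have hd1 : ∀ k, d (k + 1) = r * d k + e k := by
    intro k
    have h1 : a k / M = (1 - r) * a k := by rw [hrM]; ring
    have h2 : e k = a k / M - t k := by
      simp only [he]
      field_simp
    rw [h2, h1]
    simp only [hd, hat, pow_succ]
    ring
  -- Summing |d(k+1)| ≤ r |d(k)| + |e(k)| from d(0) = 0 gives (1 - r) Σ |d| ≤ S / M, and 1 - r = 1 /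
  -- M.
  have hD : ∀ n, ∑ k ∈ Finset.range n, |d k| ≤ S := by
    intro n
    have h0 : d 0 = 0 := by simp [hd]
    have h1 : ∑ k ∈ Finset.range (n + 1), |d k| ≤
        r * ∑ k ∈ Finset.range n, |d k| + ∑ k ∈ Finset.range n, |e k| := by
      rw [Finset.sum_range_succ', h0, abs_zero, add_zero, Finset.mul_sum, ← Finset.sum_add_distrib]
      refine Finset.sum_le_sum fun k _ => ?_
      rw [hd1]
      refine (abs_add_le _ _).trans ?_
      rw [abs_mul, abs_of_nonneg hr0]
    have h2 : ∑ k ∈ Finset.range n, |d k| ≤ ∑ k ∈ Finset.range (n + 1), |d k| := by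
      rw [Finset.sum_range_succ]
      exact le_add_of_nonneg_right (abs_nonneg _)
    have h3 : (1 - r) * ∑ k ∈ Finset.range n, |d k| ≤ S / M := by linarith [hE n]
    rw [hrM, one_div_mul_eq_div] at h3
    exact (div_le_div_iff_of_pos_right hM0).1 h3
  have hgeo : ∑ k ∈ Finset.range n, r ^ k ≤ M := by
    have h := geom_sum_mul_neg r n
    rw [hrM, mul_one_div, div_eq_iff hM0.ne'] at h
    rw [h]
    nlinarith [pow_nonneg hr0 n]
  have hterm : ∀ k, |t k - r ^ k| ≤ |d k| / M + |e k| + r ^ k * (|a 0 - M| / M) := by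
    intro k
    have h1 : t k - r ^ k = d k / M + (-e k) + r ^ k * ((a 0 - M) / M) := by
      simp only [hd, he]
      field_simp
      ring
    rw [h1]
    refine (abs_add_three _ _ _).trans ?_
    rw [abs_neg, abs_mul, abs_div (d k), abs_div (a 0 - M), abs_of_pos hM0,
      abs_of_nonneg (pow_nonneg hr0 k)]
  refine (Finset.sum_le_sum fun k _ => hterm k).trans ?_
  rw [Finset.sum_add_distrib, Finset.sum_add_distrib, ← Finset.sum_div, ← Finset.sum_mul]
  have h1 : (∑ k ∈ Finset.range n, |d k|) / M ≤ S / M := div_le_div_of_nonneg_right (hD n) hM0.le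
  have h2 : (∑ k ∈ Finset.range n, r ^ k) * (|a 0 - M| / M) ≤ |a 0 - M| := by
    refine (mul_le_mul_of_nonneg_right hgeo (by positivity)).trans (le_of_eq ?_)
    rw [mul_div_cancel₀ _ hM0.ne']
  have := hE n
  have h3 : 2 * S / M = S / M + S / M := by ring
  linarith

/-- Since 1 - 1/M ≤ exp(-1/M), all differences have one sign and their sum is at most the difference
of two geometric series. The series are M and (1 - exp(-1/M))⁻¹ ≤ M + 1. -/
theorem sum_abs_geometric_sub_exp_le (hM : 1 ≤ M) (n : ℕ) :
    ∑ k ∈ Finset.range n, |(1 - 1 / M) ^ k - Real.exp (-(k / M))| ≤ 1 := by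
  have hM0 : 0 < M := by linarith
  set r := 1 - 1 / M with hr
  have hr0 : 0 ≤ r := by rw [hr, sub_nonneg, div_le_one hM0]; exact hM
  have hrM : 1 - r = 1 / M := by rw [hr]; ring
  have hr1 : r < 1 := by
    have : 0 < 1 / M := by positivity
    linarith
  set s := Real.exp (-(1 / M)) with hs
  have hs0 : 0 ≤ s := (Real.exp_pos _).le
  have hrs : r ≤ s := by
    have := Real.add_one_le_exp (-(1 / M))
    rw [hs, hr]
    linarith
  have hsM : 1 / (M + 1) ≤ 1 - s := by
    have h1 : 1 / M + 1 ≤ Real.exp (1 / M) := Real.add_one_le_exp _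
    have h2 : s ≤ (1 / M + 1)⁻¹ := by
      rw [hs, Real.exp_neg]
      exact inv_anti₀ (by positivity) h1
    have h3 : (1 / M + 1)⁻¹ = 1 - 1 / (M + 1) := by
      field_simp
      ring
    linarith
  have hs1 : s < 1 := by
    have : 0 < 1 / (M + 1) := by positivity
    linarith
  have hpow : ∀ k : ℕ, Real.exp (-(k / M)) = s ^ k := by
    intro k
    rw [hs, ← Real.exp_nat_mul]
    congr 1
    ring
  have hle : ∀ k : ℕ, r ^ k ≤ s ^ k := fun k => pow_le_pow_left₀ hr0 hrs k
  have h1 : ∀ k ∈ Finset.range n, |r ^ k - Real.exp (-(k / M))| = s ^ k - r ^ k := by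
    intro k _
    rw [hpow, abs_sub_comm, abs_of_nonneg (sub_nonneg.2 (hle k))]
  rw [Finset.sum_congr rfl h1]
  have hsum := (hasSum_geometric_of_lt_one hs0 hs1).sub (hasSum_geometric_of_lt_one hr0 hr1)
  refine (sum_le_hasSum (Finset.range n) (fun k _ => sub_nonneg.2 (hle k)) hsum).trans ?_
  rw [hrM, one_div, inv_inv]
  have : (1 - s)⁻¹ ≤ M + 1 := by
    rw [inv_le_comm₀ (by linarith) (by linarith), ← one_div]
    exact hsM
  linarith

end Sequence

namespace FiniteWeightedTree

variable {q Q : ℝ} (T : FiniteWeightedTree q Q)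

theorem length_le_depth {v : List ℕ} (hv : v ∈ T.verts) : v.length ≤ T.depth :=
  Finset.le_sup (f := List.length) hv

theorem length_base : T.base.1.length = T.depth :=
  (Finset.mem_filter.1 (Finset.min'_mem _ T.exists_depth)).2

/-- The resistance of the edge above `u` if `u` lies on the path from the root to the base. -/
def spineResistance (u : List ℕ) : ℝ := if u <+: T.base.1 then 1 / T.pathWeight u else 0

/-- The Green function of the killed walk with pole at the base, up to normalisation. -/
def potential (e : ℝ) (v : List ℕ) : ℝ := 1 / e + pathSum T.spineResistance v

theorem spineResistance_nonneg (hq : 1 < q) {v : List ℕ} (hv : v ∈ T.verts) :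
    0 ≤ T.spineResistance v := by
  unfold spineResistance
  split_ifs
  · exact one_div_nonneg.2 (pathWeight_pos hq hv).le
  · exact le_rfl

/-- Kirchhoff's law for a unit current that runs from the base up the spine and leaves at the root.
A drop `1 / pathWeight` on a spine edge is unit current, and so is the killing term `e * (1 / e)` at
the root; no current enters the outgrowths. -/
theorem revMeasure_mul_sub_killedOp_potential (hq : 1 < q) {e : ℝ} (he : 0 < e) {v : List ℕ}
    (hv : v ∈ T.verts) :
    T.revMeasure v * (T.potential e v - T.killedOp e (T.potential e) v) =
      if v = T.base.1 then 1 else 0 := by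
  have hw := (pathWeight_pos hq hv).ne'
  have h := T.totalRate_mul_sub_killedOp hq e (1 / e) T.spineResistance (v := v)
  have h1 : (if v = [] then e * (1 / e) else T.spineResistance v) = T.spineResistance v := by
    split_ifs with h0
    · rw [h0, spineResistance, if_pos List.nil_prefix, pathWeight_nil, mul_one_div_cancel he.ne',
        div_one]
    · rfl
  have h2 : ∑ c ∈ T.children v, T.bias c * T.spineResistance c =
      if v <+: T.base.1 ∧ T.base.1 ≠ v then 1 / T.pathWeight v else 0 := by
    have h3 : ∀ c ∈ T.children v, T.bias c * T.spineResistance c =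
        if c <+: T.base.1 then 1 / T.pathWeight v else 0 := by
      intro c hc
      obtain ⟨hcv, h0, hd⟩ := T.mem_children.1 hc
      have hb := (bias_pos hq hcv h0).ne'
      rw [spineResistance, T.pathWeight_of_ne_nil h0, hd]
      split_ifs
      · field_simp
      · rw [mul_zero]
    rw [Finset.sum_congr rfl h3]
    split_ifs with h
    · obtain ⟨c, hc, hcu⟩ := (T.prefix_child_iff T.base.2).2 h
      rw [Finset.sum_eq_single_of_mem c hc, if_pos hcu]
      intro c' hc' hne
      exact if_neg fun h' => hne (T.eq_of_mem_children hc' hc h' hcu)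
    · exact Finset.sum_eq_zero fun c hc => if_neg fun hcu =>
        h ((T.prefix_child_iff T.base.2).1 ⟨c, hc, hcu⟩)
  rw [h1, h2] at h
  have h4 : T.revMeasure v * (T.potential e v - T.killedOp e (T.potential e) v) =
      T.pathWeight v * (T.totalRate v * (T.potential e v - T.killedOp e (T.potential e) v)) := by
    rw [revMeasure]
    ring
  rw [h4]
  refine (congrArg (T.pathWeight v * ·) h).trans ?_
  simp only [spineResistance]
  by_cases hb : v = T.base.1
  · subst hb
    rw [if_pos (List.prefix_refl _), if_neg (by simp), if_pos rfl]
    field_simp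
    ring
  · rw [if_neg hb]
    by_cases hp : v <+: T.base.1
    · rw [if_pos hp, if_pos ⟨hp, Ne.symm hb⟩, sub_self, mul_zero]
    · rw [if_neg hp, if_neg (fun h => hp h.1), sub_self, mul_zero]

theorem killedOp_potential (hq : 1 < q) {e : ℝ} (he : 0 < e) {v : List ℕ}
    (hv : v ∈ T.verts) (hb : v ≠ T.base.1) : T.killedOp e (T.potential e) v = T.potential e v := by
  have h := T.revMeasure_mul_sub_killedOp_potential hq he hv
  rw [if_neg hb] at h
  have := (mul_eq_zero.1 h).resolve_left (revMeasure_pos hq hv).ne'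
  linarith

theorem potential_pos (hq : 1 < q) {e : ℝ} (he : 0 < e) {v : List ℕ} (hv : v ∈ T.verts) :
    0 < T.potential e v :=
  add_pos_of_pos_of_nonneg (one_div_pos.2 he)
    (T.pathSum_nonneg_of (fun _ hu => T.spineResistance_nonneg hq hu) hv)

/-- Pairing with the potential evaluates at the base. -/
theorem sum_potential_mul_sub_killedOp (hq : 1 < q) {e : ℝ} (he : 0 < e) (f : List ℕ → ℝ) :
    ∑ v ∈ T.verts, T.revMeasure v * ((f v - T.killedOp e f v) * T.potential e v) =
      f T.base.1 := by
  have h1 : ∑ v ∈ T.verts, f v * (T.revMeasure v *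
      (T.potential e v - T.killedOp e (T.potential e) v)) = f T.base.1 := by
    rw [Finset.sum_congr rfl fun v hv => by
      rw [T.revMeasure_mul_sub_killedOp_potential hq he hv]]
    simp [T.base.2]
  rw [← h1]
  have h2 := sum_revMeasure_mul_killedOp (T := T) hq e f (T.potential e)
  have h3 : ∀ v, f v * (T.revMeasure v * (T.potential e v - T.killedOp e (T.potential e) v)) =
      T.revMeasure v * (f v * T.potential e v) -
        T.revMeasure v * (f v * T.killedOp e (T.potential e) v) := fun v => by ring
  have h4 : ∀ v, T.revMeasure v * ((f v - T.killedOp e f v) * T.potential e v) =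
      T.revMeasure v * (f v * T.potential e v) -
        T.revMeasure v * (T.killedOp e f v * T.potential e v) := fun v => by ring
  simp only [h3, h4, Finset.sum_sub_distrib, h2]

/-- The pairing is applied to `lifetime`, on which the generator is constantly 1. -/
theorem lifetime_base (hq : 1 < q) {e : ℝ} (he : 0 < e) :
    T.lifetime e T.base.1 = ∑ v ∈ T.verts, T.revMeasure v * T.potential e v := by
  rw [← T.sum_potential_mul_sub_killedOp hq he (T.lifetime e)]
  refine Finset.sum_congr rfl fun v hv => ?_
  rw [T.killedOp_lifetime hq he hv]
  ring

/-! ### Iterates of the killed operator and survival probabilities -/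

section Iterate

variable {T}

theorem iterate_congr (e : ℝ) {f g : List ℕ → ℝ} (h : ∀ v ∈ T.verts, f v = g v) (k : ℕ) :
    ∀ v ∈ T.verts, (T.killedOp e)^[k] f v = (T.killedOp e)^[k] g v := by
  induction k with
  | zero => exact h
  | succ k ih =>
    intro v hv
    rw [Function.iterate_succ_apply', Function.iterate_succ_apply']
    exact killedOp_congr e ih hv

theorem iterate_mono (hq : 1 < q) {e : ℝ} (he : e ≤ 1) {f g : List ℕ → ℝ}
    (h : ∀ v ∈ T.verts, f v ≤ g v) (k : ℕ) :
    ∀ v ∈ T.verts, (T.killedOp e)^[k] f v ≤ (T.killedOp e)^[k] g v := by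
  induction k with
  | zero => exact h
  | succ k ih =>
    intro v hv
    rw [Function.iterate_succ_apply', Function.iterate_succ_apply']
    exact killedOp_mono hq he ih hv

theorem iterate_linear (e a b : ℝ) (f g : List ℕ → ℝ) (k : ℕ) :
    (T.killedOp e)^[k] (fun u => a * f u + b * g u) =
      fun u => a * (T.killedOp e)^[k] f u + b * (T.killedOp e)^[k] g u := by
  induction k with
  | zero => rfl
  | succ k ih =>
    ext v
    rw [Function.iterate_succ_apply', ih, killedOp_linear, Function.iterate_succ_apply',
      Function.iterate_succ_apply']

theorem iterate_zero (e : ℝ) (k : ℕ) :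
    (T.killedOp e)^[k] (fun _ => 0) = fun _ => 0 := by
  induction k with
  | zero => rfl
  | succ k ih =>
    ext v
    rw [Function.iterate_succ_apply', ih, killedOp_zero]

theorem iterate_nonneg (hq : 1 < q) {e : ℝ} (he : e ≤ 1) {f : List ℕ → ℝ}
    (h : ∀ v ∈ T.verts, 0 ≤ f v) (k : ℕ) {v : List ℕ} (hv : v ∈ T.verts) :
    0 ≤ (T.killedOp e)^[k] f v := by
  have := iterate_mono (T := T) hq he (f := fun _ => 0) h k v hv
  rwa [iterate_zero] at this

end Iterate

/-- The probability that the killed walk makes at least `k` steps. -/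
def survival (e : ℝ) (k : ℕ) : List ℕ → ℝ := (T.killedOp e)^[k] fun _ => 1

theorem survival_nonneg (hq : 1 < q) {e : ℝ} (he : e ≤ 1) (k : ℕ) {v : List ℕ}
    (hv : v ∈ T.verts) : 0 ≤ T.survival e k v :=
  iterate_nonneg hq he (fun _ _ => zero_le_one) k hv

/-- The `k`-th iterate of `lifetime` is the expected lifetime still to come after `k` steps; one
more step uses up the probability of being alive. -/
theorem iterate_lifetime_succ (hq : 1 < q) {e : ℝ} (he : 0 < e) (k : ℕ) {v : List ℕ}
    (hv : v ∈ T.verts) : (T.killedOp e)^[k + 1] (T.lifetime e) v =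
      (T.killedOp e)^[k] (T.lifetime e) v - T.survival e k v := by
  have h : ∀ u ∈ T.verts, T.killedOp e (T.lifetime e) u = 1 * T.lifetime e u + (-1) * 1 := by
    intro u hu
    rw [T.killedOp_lifetime hq he hu]
    ring
  rw [Function.iterate_succ_apply, iterate_congr e h k v hv,
    iterate_linear e 1 (-1) (T.lifetime e) (fun _ => 1) k, survival]
  ring

theorem sum_survival (hq : 1 < q) {e : ℝ} (he : 0 < e) (n : ℕ) {v : List ℕ} (hv : v ∈ T.verts) :
    ∑ k ∈ Finset.range n, T.survival e k v =
      T.lifetime e v - (T.killedOp e)^[n] (T.lifetime e) v := by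
  induction n with
  | zero => simp
  | succ n ih =>
    rw [Finset.sum_range_succ, ih, T.iterate_lifetime_succ hq he n hv]
    ring

theorem hasSum_survival (hq : 1 < q) {e : ℝ} (he : 0 < e) (he1 : e ≤ 1) {v : List ℕ}
    (hv : v ∈ T.verts) : HasSum (fun k => T.survival e k v) (T.lifetime e v) := by
  have hnn : ∀ k, 0 ≤ T.survival e k v := fun k => T.survival_nonneg hq he1 k hv
  have hlt : ∀ u ∈ T.verts, 0 ≤ T.lifetime e u := fun u hu => (T.lifetime_pos hq he hu).le
  have hs : Summable fun k => T.survival e k v := by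
    refine summable_of_sum_range_le (c := T.lifetime e v) hnn fun n => ?_
    rw [T.sum_survival hq he n hv]
    linarith [iterate_nonneg hq he1 hlt n hv]
  -- The remainder of the telescoped sum is at most the maximal lifetime multiplied by the survival
  -- probability, which tends to 0 as the term of a convergent series.
  obtain ⟨u, hu, hmax⟩ := Finset.exists_max_image T.verts (T.lifetime e) ⟨[], T.root_mem⟩
  have hzero : Filter.Tendsto (fun n => (T.killedOp e)^[n] (T.lifetime e) v) Filter.atTop
      (nhds 0) := by
    have h1 := hs.tendsto_atTop_zero.const_mul (T.lifetime e u)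
    rw [mul_zero] at h1
    refine squeeze_zero (fun n => iterate_nonneg hq he1 hlt n hv) (fun n => ?_) h1
    have h2 := iterate_mono (T := T) hq he1 (f := T.lifetime e)
      (g := fun _ => T.lifetime e u * 1 + 0 * 0) (fun w hw => by simpa using hmax w hw) n v hv
    rw [iterate_linear e (T.lifetime e u) 0 (fun _ => 1) (fun _ => 0) n] at h2
    simpa [survival] using h2
  have h3 := hs.hasSum.tendsto_sum_nat
  have h4 : Filter.Tendsto (fun n => ∑ k ∈ Finset.range n, T.survival e k v) Filter.atTop
      (nhds (T.lifetime e v)) := by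
    simp only [T.sum_survival hq he _ hv]
    simpa using hzero.const_sub (T.lifetime e v)
  rw [← tendsto_nhds_unique h3 h4]
  exact hs.hasSum

theorem survival_antitone (hq : 1 < q) {e : ℝ} (he : 0 < e) (he1 : e ≤ 1) {v : List ℕ}
    (hv : v ∈ T.verts) : Antitone fun k => T.survival e k v := by
  have h1 : ∀ u ∈ T.verts, T.killedOp e (fun _ => 1) u ≤ 1 := by
    intro u hu
    have hZ := totalRate_pos (T := T) hq u
    rw [killedOp, div_le_one hZ, totalRate]
    simp only [mul_one]
    split_ifs
    · linarith
    · exact le_rfl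
  refine antitone_nat_of_succ_le fun k => ?_
  rw [survival, survival, Function.iterate_succ_apply]
  exact iterate_mono hq he1 h1 k v hv

/-- Paired with the potential, the sum of the iterates telescopes to that of `f` minus its `n`-th
iterate, which is nonnegative. This is the Green function estimate for occupation sums from the
base. -/
theorem sum_iterate_base_le (hq : 1 < q) {e : ℝ} (he : 0 < e) (he1 : e ≤ 1) {f : List ℕ → ℝ}
    (hf : ∀ v ∈ T.verts, 0 ≤ f v) (n : ℕ) :
    ∑ k ∈ Finset.range n, (T.killedOp e)^[k] f T.base.1 ≤
      ∑ v ∈ T.verts, T.revMeasure v * (f v * T.potential e v) := by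
  have h : ∀ n, ∑ k ∈ Finset.range n, (T.killedOp e)^[k] f T.base.1 =
      ∑ v ∈ T.verts, T.revMeasure v * ((f v - (T.killedOp e)^[n] f v) * T.potential e v) := by
    intro n
    induction n with
    | zero => simp
    | succ n ih =>
      rw [Finset.sum_range_succ, ih,
        ← T.sum_potential_mul_sub_killedOp hq he ((T.killedOp e)^[n] f),
        ← Finset.sum_add_distrib]
      refine Finset.sum_congr rfl fun v _ => ?_
      rw [Function.iterate_succ_apply']
      ring
  rw [h]
  refine Finset.sum_le_sum fun v hv => mul_le_mul_of_nonneg_left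
    (mul_le_mul_of_nonneg_right ?_ (T.potential_pos hq he hv).le) (revMeasure_pos hq hv).le
  linarith [iterate_nonneg hq he1 hf n hv]

/-- `sum_abs_sub_geometric_le` is used with the survival probabilities as `t` and the iterates of
`lifetime` as `a`. By linearity and positivity, `|M * t k - a k|` is at most the `k`-th iterate of
`|M - lifetime|`, to which `sum_iterate_base_le` applies; the final 1 passes from geometric to
exponential. -/
theorem sum_abs_survival_sub_exp_le (hq : 1 < q) {e : ℝ} (he : 0 < e) (he1 : e ≤ 1) {M : ℝ}
    (hM : 1 ≤ M) (n : ℕ) :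
    ∑ k ∈ Finset.range n, |T.survival e k T.base.1 - Real.exp (-(k / M))| ≤
      2 * (∑ v ∈ T.verts, T.revMeasure v * (|M - T.lifetime e v| * T.potential e v)) / M +
        |T.lifetime e T.base.1 - M| + 1 := by
  have h1 := sum_abs_sub_geometric_le hM (t := fun k => T.survival e k T.base.1)
    (a := fun k => (T.killedOp e)^[k] (T.lifetime e) T.base.1)
    (fun k => T.iterate_lifetime_succ hq he k T.base.2)
    (S := ∑ v ∈ T.verts, T.revMeasure v * (|M - T.lifetime e v| * T.potential e v))
    (fun n => ?_) n
  · have h2 := sum_abs_geometric_sub_exp_le hM n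
    refine (Finset.sum_le_sum fun k _ => abs_sub_le _ ((1 - 1 / M) ^ k) _).trans ?_
    rw [Finset.sum_add_distrib]
    exact add_le_add h1 h2
  · refine le_trans (Finset.sum_le_sum fun k _ => ?_)
      (T.sum_iterate_base_le hq he he1 (f := fun v => |M - T.lifetime e v|)
        (fun _ _ => abs_nonneg _) n)
    have h3 := congrFun (iterate_linear (T := T) e M (-1) (fun _ => 1) (T.lifetime e) k) T.base.1
    have h4 : M * T.survival e k T.base.1 - (T.killedOp e)^[k] (T.lifetime e) T.base.1 =
        (T.killedOp e)^[k] (fun u => M * 1 + (-1) * T.lifetime e u) T.base.1 := by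
      rw [h3, survival]
      ring
    rw [h4, abs_le]
    constructor
    · have h5 := congrFun (iterate_linear (T := T) e (-1) 0 (fun v => |M - T.lifetime e v|)
        (fun _ => 0) k) T.base.1
      have h6 := iterate_mono (T := T) hq he1
        (f := fun u => (-1) * |M - T.lifetime e u| + 0 * 0)
        (g := fun u => M * 1 + (-1) * T.lifetime e u)
        (fun u _ => by linarith [neg_abs_le (M - T.lifetime e u)]) k T.base.1 T.base.2
      simp only [h5] at h6
      linarith
    · exact iterate_mono hq he1
        (fun u _ => by linarith [le_abs_self (M - T.lifetime e u)]) k T.base.1 T.base.2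

end FiniteWeightedTree

/-! ## Jump rates -/

namespace WeightedTree

variable {q Q : ℝ} {V : Type u}

open Classical in
-- By acyclicity no vertex is both parent and offspring of another, so the nested cases may be
-- added.
theorem rate_eq (T : WeightedTree q Q V) (v w : V) :
    T.rate v w = (if T.parent v = some w then 1 else 0) +
      (if T.parent w = some v then ENNReal.ofReal (T.bias w) else 0) := by
  unfold rate
  split_ifs with h1 h2
  · exact absurd (Relation.TransGen.tail (r := fun a b => T.parent a = some b) (Relation.TransGen.single h1) h2) (T.acyclic v)
  all_goals simp

open Classical in
theorem tsum_rate_mul (T : WeightedTree q Q V) (v : V) (G : V → ℝ≥0∞) :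
    ∑' w, T.rate v w * G w = (∑' w, if T.parent v = some w then G w else 0) +
      ∑' w, if T.parent w = some v then ENNReal.ofReal (T.bias w) * G w else 0 := by
  rw [← ENNReal.tsum_add]
  refine tsum_congr fun w => ?_
  rw [rate_eq, add_mul]
  split_ifs <;> simp

theorem tsum_step_mul (T : WeightedTree q Q V) {v : V} (h : ∑' w, T.rate v w ≠ 0)
    (G : V → ℝ≥0∞) :
    ∑' w, T.step v w * G w = (∑' w, T.rate v w * G w) / ∑' w, T.rate v w := by
  rw [div_eq_mul_inv, ← ENNReal.tsum_mul_right]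
  refine tsum_congr fun w => ?_
  rw [step, dif_neg h, PMF.normalize_apply]
  ring

/-- With unnormalised rates superharmonicity also makes sense where all rates vanish; there `step`
is a point mass and the inequality is trivial. -/
theorem tsum_step_mul_le (T : WeightedTree q Q V) {v : V} {F : V → ℝ≥0∞}
    (h : ∑' w, T.rate v w * F w ≤ F v * ∑' w, T.rate v w) : ∑' w, T.step v w * F w ≤ F v := by
  by_cases h0 : ∑' w, T.rate v w = 0
  · rw [tsum_eq_single v fun w hw => by rw [step, dif_pos h0, PMF.pure_apply, if_neg hw, zero_mul]]
    rw [step, dif_pos h0, PMF.pure_apply, if_pos rfl, one_mul]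
  · rw [T.tsum_step_mul h0]
    exact ENNReal.div_le_of_le_mul h

/-- A superharmonic function bounds the hitting probabilities. -/
theorem walkLaw_hits_le [MeasurableSpace V] [DiscreteMeasurableSpace V] (T : WeightedTree q Q V)
    {s : V} {F : V → ℝ≥0∞} (hs : 1 ≤ F s)
    (hF : ∀ v, v ≠ s → ∑' w, T.rate v w * F w ≤ F v * ∑' w, T.rate v w) (v : V) :
    T.walkLaw v (hits s) ≤ F v := by
  let A : ℕ → Set (ℕ → V) := fun n => {x | ∃ m ≤ n, x m = s}
  have hA : ∀ n, MeasurableSet (A n) := by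
    intro n
    have : A n = ⋃ m, ⋃ (_ : m ≤ n), {x | x m ∈ ({s} : Set V)} := by
      ext x
      simp [A]
    rw [this]
    exact MeasurableSet.iUnion fun m => MeasurableSet.iUnion fun _ => measurableSet_coord _ _
  have hmono : Monotone A := fun m n hmn x ⟨k, hk, hx⟩ => ⟨k, hk.trans hmn, hx⟩
  have hU : hits s = ⋃ n, A n := by
    ext x
    simp only [hits, A, Set.mem_iUnion, Set.mem_ofPred_eq]
    exact ⟨fun ⟨n, hn⟩ => ⟨n, n, le_rfl, hn⟩, fun ⟨_, n, _, hn⟩ => ⟨n, hn⟩⟩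
  rw [hU, hmono.measure_iUnion]
  refine iSup_le fun n => ?_
  -- Induction on the time horizon: away from `s`, hitting by time `n + 1` is hitting by time `n`
  -- after the first step.
  have key : ∀ n v, T.walkLaw v (A n) ≤ F v := by
    intro n
    induction n with
    | zero =>
      intro v
      by_cases hv : v = s
      · subst hv
        exact prob_le_one.trans hs
      · have : T.walkLaw v (A 0) = 0 := by
          rw [measure_eq_zero_iff_ae_notMem]
          filter_upwards [T.ae_zero v] with x hx ⟨m, hm, hxm⟩
          rw [Nat.le_zero.1 hm, hx] at hxm
          exact hv hxm
        rw [this]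
        exact zero_le
    | succ n ih =>
      intro v
      by_cases hv : v = s
      · subst hv
        exact prob_le_one.trans hs
      · have : T.walkLaw v (A (n + 1)) = T.walkLaw v {x | (fun k => x (k + 1)) ∈ A n} := by
          refine measure_congr ?_
          filter_upwards [T.ae_zero v] with x hx
          refine propext ⟨?_, ?_⟩
          · rintro ⟨m, hm, hxm⟩
            rcases m with _ | m
            · exact absurd (hx.symm.trans hxm) hv
            · exact ⟨m, by omega, hxm⟩
          · rintro ⟨m, hm, hxm⟩
            exact ⟨m + 1, by omega, hxm⟩
        rw [this, T.measure_first_step v (hA n)]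
        exact (ENNReal.tsum_le_tsum fun w => by gcongr; exact ih w).trans
          (T.tsum_step_mul_le (hF v hv))
  exact key n v

end WeightedTree

/-! ## The walk in the trap and the killed operator -/

namespace BackboneTreePair

variable {q Q : ℝ} {V : Type u} (P : BackboneTreePair q Q V)

/-- The vertices of the trap as vertices of the pair. -/
def ofTrap (x : P.trap.Vertex) : P.Vertex := Sum.inr x

theorem ofTrap_injective : Function.Injective P.ofTrap := fun _ _ h => Sum.inr_injective h

/-- The vertex reached by a jump towards the root from a vertex of the trap. -/
def trapParent (x : P.trap.Vertex) : P.Vertex :=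
  if x.1 = [] then P.head else P.ofTrap ⟨x.1.dropLast, P.trap.dropLast_mem x.2⟩

theorem parent_ofTrap (x : P.trap.Vertex) : P.tree.parent (P.ofTrap x) = some (P.trapParent x) := by
  have h : P.tree.parent (P.ofTrap x) =
      if x.1 = [] then some P.head else some (P.ofTrap ⟨x.1.dropLast, P.trap.dropLast_mem x.2⟩) := rfl
  rw [h, trapParent]
  split_ifs <;> rfl

theorem parent_ofTrap_eq_iff (y x : P.trap.Vertex) :
    P.tree.parent (P.ofTrap y) = some (P.ofTrap x) ↔ y.1 ≠ [] ∧ y.1.dropLast = x.1 := by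
  rw [P.parent_ofTrap, Option.some_inj, trapParent]
  split_ifs with h0
  · refine iff_of_false (fun h => ?_) (fun h => h.1 h0)
    cases h
  · rw [P.ofTrap_injective.eq_iff, Subtype.ext_iff]
    exact ⟨fun h => ⟨h0, h⟩, fun h => h.2⟩

open Classical in
/-- A function on the vertices of the trap, extended by zero to all sequences. -/
def onTrap {α : Type*} [Zero α] (G : P.Vertex → α) (v : List ℕ) : α :=
  if h : v ∈ P.trap.verts then G (P.ofTrap ⟨v, h⟩) else 0

theorem onTrap_coe {α : Type*} [Zero α] (G : P.Vertex → α) (x : P.trap.Vertex) :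
    P.onTrap G x.1 = G (P.ofTrap x) := by
  rw [onTrap, dif_pos x.2]

open Classical in
theorem tsum_rate_ofTrap (x : P.trap.Vertex) (G : P.Vertex → ℝ≥0∞) :
    ∑' w, P.tree.rate (P.ofTrap x) w * G w = G (P.trapParent x) +
      ∑ c ∈ P.trap.children x.1, ENNReal.ofReal (P.trap.bias c) * P.onTrap G c := by
  rw [P.tree.tsum_rate_mul]
  congr 1
  · rw [tsum_eq_single (P.trapParent x), if_pos (P.parent_ofTrap x)]
    intro w hw
    refine if_neg fun h => hw ?_
    rw [P.parent_ofTrap] at h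
    exact (Option.some_injective _ h).symm
  · let e : P.trap.Vertex ↪ P.Vertex := ⟨P.ofTrap, P.ofTrap_injective⟩
    rw [tsum_eq_sum (s := Finset.univ.map e), Finset.sum_map]
    · have h : ∀ y : P.trap.Vertex, (if P.tree.parent (e y) = some (P.ofTrap x) then
          ENNReal.ofReal (P.tree.bias (e y)) * G (e y) else 0) =
          (fun c => if c ≠ [] ∧ c.dropLast = x.1 then
            ENNReal.ofReal (P.trap.bias c) * P.onTrap G c else 0) y.1 := by
        intro y
        change (if P.tree.parent (P.ofTrap y) = some (P.ofTrap x) then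
          ENNReal.ofReal (P.tree.bias (P.ofTrap y)) * G (P.ofTrap y) else 0) = _
        have hb : P.tree.bias (P.ofTrap y) = if y.1 = [] then P.entBias else P.trap.bias y.1 := rfl
        simp only [P.onTrap_coe]
        by_cases hy : y.1 ≠ [] ∧ y.1.dropLast = x.1
        · rw [if_pos ((P.parent_ofTrap_eq_iff y x).2 hy), if_pos hy, hb, if_neg hy.1]
        · rw [if_neg (fun h => hy ((P.parent_ofTrap_eq_iff y x).1 h)), if_neg hy]
      rw [Finset.sum_congr rfl fun y _ => h y, FiniteWeightedTree.children, Finset.sum_filter]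
      exact Finset.sum_coe_sort P.trap.verts (fun c => if c ≠ [] ∧ c.dropLast = x.1 then
            ENNReal.ofReal (P.trap.bias c) * P.onTrap G c else 0)
    · rintro (b | y) hy
      · refine if_neg fun h => ?_
        obtain ⟨c, -, hc⟩ := P.parentMap_inl h
        cases hc
      · exact absurd (Finset.mem_map_of_mem e (Finset.mem_univ y)) hy

instance (v : P.Vertex) : IsProbabilityMeasure (P.law v) :=
  inferInstanceAs (IsProbabilityMeasure (P.tree.walkLaw v))

/-- The first-step decomposition from a vertex of the trap. -/
theorem real_first_step (hq : 1 < q) (x : P.trap.Vertex) {A : Set (ℕ → P.Vertex)}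
    (hA : MeasurableSet A) :
    (P.law (P.ofTrap x)).real {y | (fun k => y (k + 1)) ∈ A} =
      ((P.law (P.trapParent x)).real A + ∑ c ∈ P.trap.children x.1,
        P.trap.bias c * P.onTrap (fun w => (P.law w).real A) c) / P.trap.totalRate x.1 := by
  have hZ := FiniteWeightedTree.totalRate_pos (T := P.trap) hq x.1
  have htot : ∑' w, P.tree.rate (P.ofTrap x) w = ENNReal.ofReal (P.trap.totalRate x.1) := by
    have h := P.tsum_rate_ofTrap x (fun _ => 1)
    simp only [mul_one] at h
    rw [h, FiniteWeightedTree.totalRate, ENNReal.ofReal_add zero_le_one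
      (Finset.sum_nonneg fun c hc => (FiniteWeightedTree.child_bias_pos hq hc).le),
      ENNReal.ofReal_one, ENNReal.ofReal_sum_of_nonneg
        (fun c hc => (FiniteWeightedTree.child_bias_pos hq hc).le)]
    congr 1
    refine Finset.sum_congr rfl fun c hc => ?_
    rw [onTrap, dif_pos (P.trap.mem_children.1 hc).1, mul_one]
  have htot0 : ∑' w, P.tree.rate (P.ofTrap x) w ≠ 0 := by
    rw [htot]
    exact (ENNReal.ofReal_pos.2 hZ).ne'
  have h : P.law (P.ofTrap x) {y | (fun k => y (k + 1)) ∈ A} =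
      ∑' w, P.tree.step (P.ofTrap x) w * P.law w A := P.tree.measure_first_step (P.ofTrap x) hA
  rw [P.tree.tsum_step_mul htot0, P.tsum_rate_ofTrap, htot] at h
  rw [measureReal_def, h, ENNReal.toReal_div, ENNReal.toReal_ofReal hZ.le, ENNReal.toReal_add, ENNReal.toReal_sum]
  · congr 2
    refine Finset.sum_congr rfl fun c hc => ?_
    rw [ENNReal.toReal_mul, ENNReal.toReal_ofReal (FiniteWeightedTree.child_bias_pos hq hc).le,
      onTrap, onTrap, dif_pos (P.trap.mem_children.1 hc).1, dif_pos (P.trap.mem_children.1 hc).1]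
    rfl
  · intro c hc
    rw [onTrap, dif_pos (P.trap.mem_children.1 hc).1]
    exact ENNReal.mul_ne_top ENNReal.ofReal_ne_top (measure_ne_top (P.law _) _)
  · exact measure_ne_top (P.law _) _
  · refine ENNReal.sum_ne_top.2 fun c hc => ?_
    rw [onTrap, dif_pos (P.trap.mem_children.1 hc).1]
    exact ENNReal.mul_ne_top ENNReal.ofReal_ne_top (measure_ne_top (P.law _) _)

/-- This is the only link between the walk on the pair and the killed operator. The backbone enters
solely through the factor `1 - e` relating the probabilities at `head` and at `ent`: `e` is `pEsc`
for the time in the trap and for hitting the base, and 1 for `pDe`. -/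
theorem real_eq_killedOp (hq : 1 < q) (x : P.trap.Vertex) {A B : Set (ℕ → P.Vertex)}
    (hA : MeasurableSet A) {e : ℝ}
    (hhead : (P.law P.head).real A = (1 - e) * (P.law P.ent).real A)
    (hAB : ∀ᵐ y ∂P.law (P.ofTrap x), y ∈ B ↔ (fun k => y (k + 1)) ∈ A) :
    (P.law (P.ofTrap x)).real B =
      P.trap.killedOp e (P.onTrap fun w => (P.law w).real A) x.1 := by
  have h1 : (P.law (P.ofTrap x)).real B =
      (P.law (P.ofTrap x)).real {y | (fun k => y (k + 1)) ∈ A} := by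
    rw [measureReal_def, measureReal_def]
    congr 1
    refine measure_congr ?_
    filter_upwards [hAB] with y hy
    exact propext hy
  have h2 : (P.law (P.trapParent x)).real A =
      if x.1 = [] then (1 - e) * P.onTrap (fun w => (P.law w).real A) []
      else P.onTrap (fun w => (P.law w).real A) x.1.dropLast := by
    have hr := P.onTrap_coe (fun w => (P.law w).real A) P.trap.root
    have hx := P.onTrap_coe (fun w => (P.law w).real A)
      ⟨x.1.dropLast, P.trap.dropLast_mem x.2⟩
    change P.onTrap (fun w => (P.law w).real A) [] = (P.law P.ent).real A at hr
    rw [hr, hx, trapParent]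
    split_ifs
    · exact hhead
    · rfl
  rw [h1, P.real_first_step hq x hA, h2, FiniteWeightedTree.killedOp]

end BackboneTreePair

/-! ## The escape probability is bounded below -/

namespace BackboneTreePair

variable {q Q : ℝ} {V : Type u} (P : BackboneTreePair q Q V)

/-- The vertices of the backbone as vertices of the pair. -/
def ofBackbone (b : V) : P.Vertex := Sum.inl b

theorem ofBackbone_injective : Function.Injective P.ofBackbone := fun _ _ h => Sum.inl_injective h

open Classical in
/-- The total bias of the offspring of `b` in the backbone. -/
def offspringBias (b : V) : ℝ≥0∞ :=
  ∑' c, if P.backbone.parent c = some b then ENNReal.ofReal (P.backbone.bias c) else 0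

theorem parent_ofBackbone_eq_iff (c b : V) :
    P.tree.parent (P.ofBackbone c) = some (P.ofBackbone b) ↔ P.backbone.parent c = some b := by
  constructor
  · intro h
    obtain ⟨d, hd, hd'⟩ := P.parentMap_inl h
    rw [hd, P.ofBackbone_injective hd']
  · intro h
    exact congrArg (Option.map Sum.inl) h

theorem parent_ofTrap_eq_ofBackbone_iff (y : P.trap.Vertex) (b : V) :
    P.tree.parent (P.ofTrap y) = some (P.ofBackbone b) ↔
      P.ofTrap y = P.ent ∧ b = P.distinguished := by
  rw [P.parent_ofTrap, Option.some_inj, trapParent]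
  split_ifs with h0
  · have h1 : P.ofTrap y = P.ent := congrArg P.ofTrap (Subtype.ext h0 : y = P.trap.root)
    refine ⟨fun h => ⟨h1, (P.ofBackbone_injective h).symm⟩, fun h => ?_⟩
    rw [h.2]
    rfl
  · refine iff_of_false (fun h => ?_) (fun h => h0 ?_)
    · cases h
    · have h2 : P.ofTrap y = P.ofTrap P.trap.root := h.1
      rw [P.ofTrap_injective h2]
      rfl

open Classical in
theorem tsum_rate_ofBackbone (b : V) (G : P.Vertex → ℝ≥0∞) :
    ∑' w, P.tree.rate (P.ofBackbone b) w * G w =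
      (P.backbone.parent b).elim 0 (fun p => G (P.ofBackbone p)) +
      ((∑' c, if P.backbone.parent c = some b then
          ENNReal.ofReal (P.backbone.bias c) * G (P.ofBackbone c) else 0) +
        if b = P.distinguished then ENNReal.ofReal P.entBias * G P.ent else 0) := by
  rw [P.tree.tsum_rate_mul]
  congr 1
  · have hp : P.tree.parent (P.ofBackbone b) = (P.backbone.parent b).map P.ofBackbone := rfl
    rw [hp]
    rcases P.backbone.parent b with _ | p
    · simp
    · rw [tsum_eq_single (P.ofBackbone p)]
      · simp
      · intro w hw
        exact if_neg fun h => hw (Option.some_injective _ h).symm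
  · set f : P.Vertex → ℝ≥0∞ := fun w => if P.tree.parent w = some (P.ofBackbone b) then
      ENNReal.ofReal (P.tree.bias w) * G w else 0 with hf
    -- The vertex `ent` is split off, being the only offspring of a backbone vertex that lies
    -- outside the backbone.
    have h1 : ∀ w, f w = (if w = P.ent then 0 else f w) + (if w = P.ent then f w else 0) := by
      intro w
      split_ifs <;> simp
    rw [tsum_congr h1, ENNReal.tsum_add]
    congr 1
    · rw [← P.ofBackbone_injective.tsum_eq]
      · refine tsum_congr fun c => ?_
        have hne : P.ofBackbone c ≠ P.ent := fun h => by cases h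
        simp only [hf, if_neg hne, P.parent_ofBackbone_eq_iff]
        rfl
      · rintro (c | y) hw
        · exact ⟨c, rfl⟩
        · exfalso
          refine hw ?_
          change (if P.ofTrap y = P.ent then 0 else f (P.ofTrap y)) = 0
          split_ifs with h
          · rfl
          · exact if_neg fun h' => h ((P.parent_ofTrap_eq_ofBackbone_iff y b).1 h').1
    · rw [tsum_eq_single P.ent (fun w hw => if_neg hw), if_pos rfl]
      have hb : P.tree.bias P.ent = P.entBias := by
        change (if ([] : List ℕ) = [] then P.entBias else P.trap.bias []) = _
        rw [if_pos rfl]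
      have h2 := P.parent_ofTrap_eq_ofBackbone_iff P.trap.root b
      change P.tree.parent P.ent = _ ↔ _ at h2
      simp only [hf, hb, h2]
      by_cases hbd : b = P.distinguished
      · rw [if_pos hbd, if_pos ⟨rfl, hbd⟩]
      · rw [if_neg hbd, if_neg fun h => hbd h.2]

theorem le_offspringBias (b : V) : ENNReal.ofReal q ≤ P.offspringBias b := by
  classical
  obtain ⟨c, hc⟩ := P.leafless b
  refine le_trans ?_ (ENNReal.le_tsum c)
  rw [if_pos hc]
  exact ENNReal.ofReal_le_ofReal (P.backbone.bias_mem c b hc).1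

theorem offspringBias_ne_top (b : V) : P.offspringBias b ≠ ∞ := by
  classical
  have h := P.backbone.tsum_rate_mul b (fun _ => 1)
  simp only [mul_one] at h
  refine ne_top_of_le_ne_top (P.backbone.tsum_rate_ne_top b) ?_
  rw [h]
  exact le_add_left le_rfl

/-- `b` is a descendent of the distinguished vertex, in the generation `n` below it. -/
def IsBelow (n : ℕ) (b : V) : Prop :=
  (fun o : Option V => o.bind P.backbone.parent)^[n] (some b) = some P.distinguished

theorem isBelow_zero_iff {b : V} : P.IsBelow 0 b ↔ b = P.distinguished := Option.some_inj

theorem isBelow_succ_iff {n : ℕ} {b : V} :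
    P.IsBelow (n + 1) b ↔ ∃ p, P.backbone.parent b = some p ∧ P.IsBelow n p := by
  unfold IsBelow
  rw [Function.iterate_succ_apply, Option.bind_some]
  rcases P.backbone.parent b with _ | p
  · have : ∀ n, (fun o : Option V => o.bind P.backbone.parent)^[n] none = none := by
      intro n
      induction n with
      | zero => rfl
      | succ n ih => rw [Function.iterate_succ_apply]; exact ih
    simp [this]
  · simp

theorem IsBelow.reflTransGen {n : ℕ} {b : V} (h : P.IsBelow n b) :
    Relation.ReflTransGen (fun a b => P.backbone.parent a = some b) b P.distinguished := by
  induction n generalizing b with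
  | zero => rw [P.isBelow_zero_iff.1 h]
  | succ n ih =>
    obtain ⟨p, hp, h'⟩ := P.isBelow_succ_iff.1 h
    exact .head hp (ih h')

open Classical in
/-- A function that is superharmonic away from `ent`. -/
def escapeBound : P.Vertex → ℝ≥0∞
  | Sum.inl b => if h : ∃ n, P.IsBelow n b then
      ENNReal.ofReal ((Q + 1) / (Q + q) / q ^ Nat.find h) else 1
  | Sum.inr _ => 1

/-- Acyclicity makes the generation unique; carrying its minimality as a hypothesis avoids having to
prove this. -/
theorem escapeBound_of_find {b : V} {n : ℕ} (h : P.IsBelow n b) (hmin : ∀ m < n, ¬ P.IsBelow m b) :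
    P.escapeBound (P.ofBackbone b) = ENNReal.ofReal ((Q + 1) / (Q + q) / q ^ n) := by
  classical
  have he : ∃ n, P.IsBelow n b := ⟨n, h⟩
  have hf : Nat.find he = n := (Nat.find_eq_iff he).2 ⟨h, hmin⟩
  have : P.escapeBound (P.ofBackbone b) = if h : ∃ n, P.IsBelow n b then
      ENNReal.ofReal ((Q + 1) / (Q + q) / q ^ Nat.find h) else 1 := rfl
  rw [this, dif_pos he, hf]

theorem escapeBound_child {b c : V} {n : ℕ} (h : P.IsBelow n b) (hmin : ∀ m < n, ¬ P.IsBelow m b)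
    (hc : P.backbone.parent c = some b) :
    P.escapeBound (P.ofBackbone c) = ENNReal.ofReal ((Q + 1) / (Q + q) / q ^ (n + 1)) := by
  refine P.escapeBound_of_find (P.isBelow_succ_iff.2 ⟨b, hc, h⟩) ?_
  rintro (_ | m) hm hlt
  -- If the offspring were the distinguished vertex, from which `b` descends, there would be a
  -- cycle.
  · rw [P.isBelow_zero_iff] at hlt
    subst hlt
    exact P.backbone.acyclic _ (Relation.TransGen.head' hc (IsBelow.reflTransGen P h))
  · obtain ⟨p, hp, h'⟩ := P.isBelow_succ_iff.1 hlt
    rw [hc] at hp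
    cases hp
    exact hmin m (by omega) h'

theorem escapeBound_le_one (hq : 1 < q) (hqQ : q ≤ Q) (v : P.Vertex) : P.escapeBound v ≤ 1 := by
  classical
  rcases v with b | y
  · change (if h : ∃ n, P.IsBelow n b then
      ENNReal.ofReal ((Q + 1) / (Q + q) / q ^ Nat.find h) else 1) ≤ 1
    split_ifs with h
    · rw [← ENNReal.ofReal_one]
      refine ENNReal.ofReal_le_ofReal ?_
      have h1 : (1 : ℝ) ≤ q ^ Nat.find h := one_le_pow₀ hq.le
      have h2 : (Q + 1) / (Q + q) ≤ 1 := (div_le_one (by linarith)).2 (by linarith)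
      exact (div_le_one (by linarith)).2 (h2.trans h1)
    · exact le_rfl
  · exact le_rfl

/-- Where the value is 1 there is nothing to show, as the function is at most 1. With offspring of
total bias s ≥ q, the decay by 1/q per generation is superharmonic because q + s/q ≤ 1 + s. At the
head the worst case is a parent and `ent` both of value 1, with entrance bias Q and s = q; then θ =
(Q+1)/(Q+q) is the value that solves (1 - θ)(1 + Q) = θ(q - 1). -/
theorem escapeBound_superharmonic (hq : 1 < q) (hqQ : q ≤ Q) (v : P.Vertex) :
    ∑' w, P.tree.rate v w * P.escapeBound w ≤ P.escapeBound v * ∑' w, P.tree.rate v w := by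
  classical
  have htriv : P.escapeBound v = 1 →
      ∑' w, P.tree.rate v w * P.escapeBound w ≤ P.escapeBound v * ∑' w, P.tree.rate v w := by
    intro h
    rw [h, one_mul]
    exact ENNReal.tsum_le_tsum fun w =>
      (mul_le_mul_right (P.escapeBound_le_one hq hqQ w) _).trans (mul_one _).le
  rcases v with b | y
  swap
  · exact htriv rfl
  by_cases hex : ∃ n, P.IsBelow n b
  swap
  · exact htriv (dif_neg hex)
  set n := Nat.find hex with hn
  have hb : P.IsBelow n b := Nat.find_spec hex
  have hmin : ∀ m < n, ¬ P.IsBelow m b := fun m hm => Nat.find_min hex hm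
  change ∑' w, P.tree.rate (P.ofBackbone b) w * _ ≤ P.escapeBound (P.ofBackbone b) *
    ∑' w, P.tree.rate (P.ofBackbone b) w
  have htot := P.tsum_rate_ofBackbone b (fun _ => 1)
  simp only [mul_one] at htot
  have hch : (∑' c, if P.backbone.parent c = some b then
      ENNReal.ofReal (P.backbone.bias c) * P.escapeBound (P.ofBackbone c) else 0) =
      P.offspringBias b * ENNReal.ofReal ((Q + 1) / (Q + q) / q ^ (n + 1)) := by
    rw [offspringBias, ← ENNReal.tsum_mul_right]
    refine tsum_congr fun c => ?_
    split_ifs with hc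
    · rw [P.escapeBound_child hb hmin hc]
    · rw [zero_mul]
  rw [P.tsum_rate_ofBackbone, hch, htot, P.escapeBound_of_find hb hmin]
  have hS1 := P.le_offspringBias b
  have hStop := P.offspringBias_ne_top b
  change _ ≤ _ * (_ + (P.offspringBias b + _))
  set S := P.offspringBias b
  obtain ⟨s, hs0, hs⟩ : ∃ s : ℝ, 0 ≤ s ∧ S = ENNReal.ofReal s :=
    ⟨S.toReal, ENNReal.toReal_nonneg, (ENNReal.ofReal_toReal hStop).symm⟩
  have hqs : q ≤ s := by
    rw [hs] at hS1
    exact (ENNReal.ofReal_le_ofReal_iff hs0).1 hS1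
  rw [hs]
  have hQq : 0 < Q + q := by linarith
  have hθ : 0 < (Q + 1) / (Q + q) := div_pos (by linarith) hQq
  have hq0 : 0 < q := by linarith
  rcases hn0 : n with _ | m
  · rw [hn0] at hb hmin
    have hbd : b = P.distinguished := P.isBelow_zero_iff.1 hb
    rw [if_pos hbd, if_pos hbd]
    have hent : P.escapeBound P.ent = 1 := rfl
    rw [hent, mul_one, zero_add, pow_one, pow_zero, div_one]
    set θ := (Q + 1) / (Q + q) with hθd
    have hβ := P.entBias_mem
    -- `x` is the rate towards the parent of the head, namely 0 or 1 according to whether the head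
    -- is the root of the backbone.
    obtain ⟨x, hx0, hx1, hx2, hx3⟩ : ∃ x : ℝ, 0 ≤ x ∧ x ≤ 1 ∧
        (P.backbone.parent b).elim 0 (fun p => P.escapeBound (P.ofBackbone p)) ≤ ENNReal.ofReal x ∧
        (P.backbone.parent b).elim 0 (fun _ => (1 : ℝ≥0∞)) = ENNReal.ofReal x := by
      rcases P.backbone.parent b with _ | p
      · exact ⟨0, le_rfl, zero_le_one, by simp, by simp⟩
      · exact ⟨1, zero_le_one, le_rfl, by simpa using P.escapeBound_le_one hq hqQ _, by simp⟩
    rw [hx3]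
    refine (add_le_add_left hx2 _).trans ?_
    have hβ0 : 0 ≤ P.entBias := by linarith [hβ.1]
    rw [← ENNReal.ofReal_mul hs0, ← ENNReal.ofReal_add (by positivity) hβ0,
      ← ENNReal.ofReal_add hx0 (by positivity), ← ENNReal.ofReal_add hs0 hβ0,
      ← ENNReal.ofReal_add hx0 (by positivity), ← ENNReal.ofReal_mul hθ.le]
    refine ENNReal.ofReal_le_ofReal ?_
    have h1 : (1 - θ) * (x + P.entBias) ≤ θ * (s * (1 - 1 / q)) := by
      have h2 : 1 - θ = (q - 1) / (Q + q) := by rw [hθd]; field_simp; ring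
      have h3 : (1 - θ) * (x + P.entBias) ≤ (1 - θ) * (1 + Q) := by
        refine mul_le_mul_of_nonneg_left (by linarith [hβ.2]) ?_
        rw [h2]
        exact div_nonneg (by linarith) hQq.le
      have h4 : q - 1 ≤ s * (1 - 1 / q) := by
        have : q - 1 = q * (1 - 1 / q) := by field_simp
        rw [this]
        refine mul_le_mul_of_nonneg_right hqs ?_
        rw [sub_nonneg, div_le_one hq0]
        exact hq.le
      have h5 := mul_le_mul_of_nonneg_left h4 hθ.le
      have h6 : (1 - θ) * (1 + Q) = θ * (q - 1) := by rw [h2, hθd]; field_simp; ring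
      linarith
    have h7 : s * (θ / q) = θ * s - θ * (s * (1 - 1 / q)) := by field_simp; ring
    linarith
  · rw [hn0] at hb hmin
    have hbd : b ≠ P.distinguished := fun h => hmin 0 (by omega) (P.isBelow_zero_iff.2 h)
    rw [if_neg hbd, if_neg hbd, add_zero, add_zero]
    obtain ⟨p, hp, hpb⟩ := P.isBelow_succ_iff.1 hb
    have hpm : ∀ k < m, ¬ P.IsBelow k p := fun k hk h =>
      hmin (k + 1) (by omega) (P.isBelow_succ_iff.2 ⟨p, hp, h⟩)
    rw [hp, Option.elim_some, Option.elim_some, P.escapeBound_of_find hpb hpm]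
    set θ := (Q + 1) / (Q + q) with hθd
    rw [← ENNReal.ofReal_mul hs0, ← ENNReal.ofReal_add (by positivity) (by positivity),
      ← ENNReal.ofReal_one, ← ENNReal.ofReal_add zero_le_one hs0,
      ← ENNReal.ofReal_mul (by positivity)]
    refine ENNReal.ofReal_le_ofReal ?_
    have h1 : θ / q ^ m + s * (θ / q ^ (m + 1 + 1)) = θ / q ^ (m + 1) * (q + s / q) := by
      field_simp
      ring
    rw [h1]
    refine mul_le_mul_of_nonneg_left ?_ (by positivity)
    have h2 : 1 + s - (q + s / q) = (s - q) * (1 - 1 / q) := by field_simp; ring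
    have h3 : 0 ≤ (s - q) * (1 - 1 / q) := by
      refine mul_nonneg (by linarith) ?_
      rw [sub_nonneg, div_le_one hq0]
      exact hq.le
    linarith

theorem pEsc_eq : P.pEsc = 1 - (P.law P.head).real (hits P.ent) := by
  have h : {x : ℕ → P.Vertex | ∀ n, x n ≠ P.ent} = (hits P.ent)ᶜ := by
    ext x
    simp [hits]
  rw [pEsc, h, probReal_compl_eq_one_sub (measurableSet_hits _)]

/-- The superharmonic function is 1 at `ent`, so its value at `head` bounds the probability of
visiting `ent`. The bound is uniform over all pairs. -/
theorem pEsc_ge (hq : 1 < q) (hqQ : q ≤ Q) : (q - 1) / (Q + q) ≤ P.pEsc := by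
  have h := P.tree.walkLaw_hits_le (s := P.ent) (F := P.escapeBound) le_rfl
    (fun v _ => P.escapeBound_superharmonic hq hqQ v) P.head
  have h1 : P.escapeBound P.head = ENNReal.ofReal ((Q + 1) / (Q + q)) := by
    have := P.escapeBound_of_find (b := P.distinguished) (n := 0)
      (P.isBelow_zero_iff.2 rfl) (by simp)
    rw [pow_zero, div_one] at this
    exact this
  rw [h1] at h
  have hQ : 0 < Q + q := by linarith
  have h2 : (P.law P.head).real (hits P.ent) ≤ (Q + 1) / (Q + q) :=
    ENNReal.toReal_le_of_le_ofReal (div_nonneg (by linarith) hQ.le) h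
  rw [P.pEsc_eq]
  have h3 : (q - 1) / (Q + q) = 1 - (Q + 1) / (Q + q) := by field_simp; ring
  linarith

theorem pEsc_pos (hq : 1 < q) (hqQ : q ≤ Q) : 0 < P.pEsc :=
  (div_pos (by linarith) (by linarith)).trans_le (P.pEsc_ge hq hqQ)

theorem pEsc_le_one : P.pEsc ≤ 1 := measureReal_le_one

end BackboneTreePair

/-! ## The time in the trap and the hitting probabilities -/

namespace BackboneTreePair

variable {q Q : ℝ} {V : Type u} (P : BackboneTreePair q Q V)

/-- The total time that a trajectory spends in the trap. -/
def trapTime (x : ℕ → P.Vertex) : ℝ≥0∞ := ∑' n, P.trapSet.indicator 1 (x n)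

theorem measurable_trapTime : Measurable P.trapTime :=
  Measurable.tsum fun n =>
    (Measurable.of_discrete (f := P.trapSet.indicator (1 : P.Vertex → ℝ≥0∞))).comp
      (measurable_pi_apply n)

theorem trapTime_eq_sum_add (x : ℕ → P.Vertex) (n : ℕ) :
    P.trapTime x = ∑ m ∈ Finset.range n, P.trapSet.indicator 1 (x m) +
      P.trapTime fun k => x (n + k) := by
  rw [trapTime, trapTime, ← ENNReal.summable.sum_add_tsum_nat_add' (k := n)]
  simp only [add_comm]

theorem trapTime_eq_add (x : ℕ → P.Vertex) :
    P.trapTime x = P.trapSet.indicator 1 (x 0) + P.trapTime fun k => x (k + 1) := by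
  rw [P.trapTime_eq_sum_add x 1, Finset.sum_range_one]
  simp only [add_comm]

theorem trapTime_eq_encard (x : ℕ → P.Vertex) : P.trapTime x = (P.trapTimes x).encard := by
  rw [← ENNReal.tsum_set_one, tsum_subtype (P.trapTimes x) (fun _ => (1 : ℝ≥0∞)), trapTime]
  refine tsum_congr fun n => ?_
  by_cases h : x n ∈ P.trapSet
  · rw [Set.indicator_of_mem h, Set.indicator_of_mem (show n ∈ P.trapTimes x from h)]
    rfl
  · rw [Set.indicator_of_notMem h, Set.indicator_of_notMem (show n ∉ P.trapTimes x from h)]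

theorem finite_trapTimes {x : ℕ → P.Vertex} (h : P.trapTime x ≠ ∞) :
    (P.trapTimes x).Finite ∧ ((P.trapTimes x).ncard : ℝ) = (P.trapTime x).toReal := by
  rw [trapTime_eq_encard] at h ⊢
  have hf : (P.trapTimes x).Finite := by
    rw [← Set.encard_ne_top_iff]
    intro h'
    rw [h'] at h
    exact h rfl
  refine ⟨hf, ?_⟩
  rw [← hf.cast_ncard_eq]
  simp

theorem measurableSet_lt_trapTime (c : ℝ≥0∞) : MeasurableSet {x | c < P.trapTime x} :=
  measurableSet_lt measurable_const P.measurable_trapTime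

theorem law_ae_zero (v : P.Vertex) : ∀ᵐ x ∂P.law v, x 0 = v := P.tree.ae_zero v

theorem ofTrap_mem_trapSet (x : P.trap.Vertex) : P.ofTrap x ∈ P.trapSet := ⟨x, rfl⟩

theorem head_notMem_trapSet : P.head ∉ P.trapSet := by
  rintro ⟨y, hy⟩
  cases hy

/-- The edge from `head` to `ent` is the only one between backbone and trap, so the trap can be
entered only at `ent`. -/
theorem ae_ent_of_mem_trapSet :
    ∀ᵐ x ∂P.law P.head, ∀ n, x n ∈ P.trapSet → ∃ m ≤ n, x m = P.ent := by
  have h := P.tree.ae_no_jump P.head (A := P.trapSetᶜ) (B := P.trapSet \ {P.ent}) (by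
    rintro (b | y) ha w ⟨⟨z, rfl⟩, hz⟩
    · have h1 : P.tree.parent (P.ofBackbone b) ≠ some (P.ofTrap z) := by
        intro h
        obtain ⟨c, -, hc⟩ := P.parentMap_inl h
        cases hc
      have h2 : P.tree.parent (P.ofTrap z) ≠ some (P.ofBackbone b) := fun h =>
        hz ((P.parent_ofTrap_eq_ofBackbone_iff z b).1 h).1
      change P.tree.rate (P.ofBackbone b) (P.ofTrap z) = 0
      rw [WeightedTree.rate, if_neg h1, if_neg h2]
    · exact absurd (P.ofTrap_mem_trapSet y) ha)
    (Set.disjoint_left.2 fun _ h1 h2 => h1 h2.1)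
  filter_upwards [h, P.law_ae_zero P.head] with x hx hx0 n
  induction n with
  | zero =>
    intro h
    rw [hx0] at h
    exact absurd h P.head_notMem_trapSet
  | succ n ih =>
    intro hn
    by_cases h : x n ∈ P.trapSet
    · obtain ⟨m, hm, hxm⟩ := ih h
      exact ⟨m, by omega, hxm⟩
    · refine ⟨n + 1, le_rfl, ?_⟩
      by_contra hne
      exact hx n h ⟨hn, hne⟩

/-- The strong Markov property at the first visit to `ent`, for events that what happens before this
visit cannot affect. It supplies the hypothesis at `head` of `real_eq_killedOp`. -/
theorem real_head_eq {A : Set (ℕ → P.Vertex)} (hA : MeasurableSet A)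
    (h : ∀ᵐ x ∂P.law P.head, x ∈ A ↔ x ∈ hits P.ent ∧ afterHit P.ent x ∈ A) :
    (P.law P.head).real A = (1 - P.pEsc) * (P.law P.ent).real A := by
  have h1 : P.law P.head A = P.law P.head (hits P.ent) * P.law P.ent A := by
    have e := P.tree.lintegral_afterHit P.head P.ent (C := Set.univ) MeasurableSet.univ
      (g := A.indicator 1) (measurable_one.indicator hA)
    simp only [Set.preimage_univ, Set.inter_univ] at e
    rw [lintegral_indicator_one hA, ← lintegral_indicator (measurableSet_hits _)] at e
    refine Eq.trans ?_ e
    rw [← lintegral_indicator_one hA]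
    refine lintegral_congr_ae ?_
    filter_upwards [h] with x hx
    by_cases hxA : x ∈ A
    · rw [Set.indicator_of_mem hxA, Set.indicator_of_mem (hx.1 hxA).1,
        Set.indicator_of_mem (hx.1 hxA).2]
      rfl
    · rw [Set.indicator_of_notMem hxA]
      by_cases hh : x ∈ hits P.ent
      · rw [Set.indicator_of_mem hh, Set.indicator_of_notMem fun h' => hxA (hx.2 ⟨hh, h'⟩)]
      · rw [Set.indicator_of_notMem hh]
  rw [measureReal_def, h1, ENNReal.toReal_mul, P.pEsc_eq, sub_sub_cancel]
  rfl

theorem real_head_lt_trapTime (k : ℕ) :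
    (P.law P.head).real {x | (k : ℝ≥0∞) < P.trapTime x} =
      (1 - P.pEsc) * (P.law P.ent).real {x | (k : ℝ≥0∞) < P.trapTime x} := by
  refine P.real_head_eq (P.measurableSet_lt_trapTime k) ?_
  filter_upwards [P.ae_ent_of_mem_trapSet] with x hx
  by_cases hh : x ∈ hits P.ent
  · have hh' := hh
    rw [hits_eq_iUnion, Set.mem_iUnion] at hh'
    obtain ⟨n, hn⟩ := hh'
    rw [afterHit_of_mem_firstHit hn, P.trapTime_eq_sum_add x n, Finset.sum_eq_zero, zero_add]
    · exact ⟨fun h => ⟨hh, h⟩, fun h => h.2⟩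
    · intro m hm
      refine Set.indicator_of_notMem (fun hxm => ?_) _
      obtain ⟨j, hj, hxj⟩ := hx m hxm
      exact hn.2 j (by have := Finset.mem_range.1 hm; omega) hxj
  · refine iff_of_false ?_ (fun h => hh h.1)
    have : P.trapTime x = 0 := ENNReal.tsum_eq_zero.2 fun n =>
      Set.indicator_of_notMem (fun hxn => hh (by
        obtain ⟨m, -, hm⟩ := hx n hxn
        exact ⟨m, hm⟩)) _
    rw [this]
    exact not_lt_zero

theorem real_head_hits_base :
    (P.law P.head).real (hits P.base) = (1 - P.pEsc) * (P.law P.ent).real (hits P.base) := by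
  refine P.real_head_eq (measurableSet_hits _) ?_
  filter_upwards [P.ae_ent_of_mem_trapSet] with x hx
  constructor
  · rintro ⟨n, hn⟩
    obtain ⟨m, hm, hxm⟩ := hx n (by rw [hn]; exact P.ofTrap_mem_trapSet _)
    have hh : x ∈ hits P.ent := ⟨m, hxm⟩
    refine ⟨hh, ?_⟩
    rw [hits_eq_iUnion, Set.mem_iUnion] at hh
    obtain ⟨k, hk⟩ := hh
    rw [afterHit_of_mem_firstHit hk]
    have hkm : k ≤ m := by
      by_contra hlt
      exact hk.2 m (by omega) hxm
    refine ⟨n - k, ?_⟩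
    change x (k + (n - k)) = P.base
    rw [Nat.add_sub_cancel' (hkm.trans hm), hn]
  · rintro ⟨-, n, hn⟩
    exact ⟨_, hn⟩

/-- The law of the time in the trap. -/
theorem real_lt_trapTime (hq : 1 < q) (k : ℕ) (x : P.trap.Vertex) :
    (P.law (P.ofTrap x)).real {y | (k : ℝ≥0∞) < P.trapTime y} =
      P.trap.survival P.pEsc k x.1 := by
  induction k generalizing x with
  | zero =>
    have h : P.law (P.ofTrap x) {y | ((0 : ℕ) : ℝ≥0∞) < P.trapTime y} = 1 := by
      refine prob_compl_eq_zero_iff (P.measurableSet_lt_trapTime _) |>.1 ?_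
      rw [measure_eq_zero_iff_ae_notMem]
      filter_upwards [P.law_ae_zero (P.ofTrap x)] with y hy
      rw [Set.notMem_compl_iff, Set.mem_ofPred_eq, P.trapTime_eq_add, hy,
        Set.indicator_of_mem (P.ofTrap_mem_trapSet x)]
      simp
    rw [measureReal_def, h]
    rfl
  | succ k ih =>
    rw [P.real_eq_killedOp hq x (P.measurableSet_lt_trapTime k) (P.real_head_lt_trapTime k),
      FiniteWeightedTree.survival, Function.iterate_succ_apply']
    · refine FiniteWeightedTree.killedOp_congr _ (fun v hv => ?_) x.2
      exact (P.onTrap_coe _ ⟨v, hv⟩).trans (ih ⟨v, hv⟩)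
    -- The starting vertex uses one unit of trap time, which turns the threshold `k + 1` into `k`
    -- for the shifted walk.
    · filter_upwards [P.law_ae_zero (P.ofTrap x)] with y hy
      rw [P.trapTime_eq_add, hy,
        Set.indicator_of_mem (P.ofTrap_mem_trapSet x), Nat.cast_succ, add_comm, Pi.one_apply,
        ENNReal.add_lt_add_iff_left ENNReal.one_ne_top]

/-- By uniqueness `f` is the potential divided by its value at the base, and the potential is `1 /
e` at the root. -/
theorem potential_of_eq_killedOp (hq : 1 < q) {e : ℝ} (he : 0 < e) (he1 : e ≤ 1)
    {f : List ℕ → ℝ} (hb : f P.trap.base.1 = 1)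
    (hf : ∀ v ∈ P.trap.verts, v ≠ P.trap.base.1 → f v = P.trap.killedOp e f v) :
    f [] = 1 / e / P.trap.potential e P.trap.base.1 := by
  have hpos := P.trap.potential_pos hq he P.trap.base.2
  set c := P.trap.potential e P.trap.base.1 with hc
  have h := P.trap.eq_of_eq_killedOp hq he he1 (f := f)
    (g := fun v => 1 / c * P.trap.potential e v + 0 * 0) (b := P.trap.base.1)
    (by rw [hb, ← hc]; field_simp; ring) hf (fun v hv hvb => by
      rw [P.trap.killedOp_linear e (1 / c) 0 (P.trap.potential e) (fun _ => 0) v,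
        P.trap.killedOp_potential hq he hv hvb]
      ring) P.trap.root_mem
  rw [h, FiniteWeightedTree.potential, FiniteWeightedTree.pathSum_nil]
  ring

theorem real_ent_hits_base (hq : 1 < q) (hqQ : q ≤ Q) :
    (P.law P.ent).real (hits P.base) =
      1 / P.pEsc / P.trap.potential P.pEsc P.trap.base.1 := by
  have h := P.potential_of_eq_killedOp hq (P.pEsc_pos hq hqQ) P.pEsc_le_one
    (f := P.onTrap fun w => (P.law w).real (hits P.base)) ?_ ?_
  · exact (P.onTrap_coe _ P.trap.root).symm.trans h
  · rw [P.onTrap_coe]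
    have : P.law (P.ofTrap P.trap.base) (hits P.base) = 1 := by
      refine prob_compl_eq_zero_iff (measurableSet_hits _) |>.1 ?_
      rw [measure_eq_zero_iff_ae_notMem]
      filter_upwards [P.law_ae_zero (P.ofTrap P.trap.base)] with y hy hy'
      exact hy' ⟨0, hy⟩
    rw [measureReal_def, this]
    rfl
  · intro v hv hvb
    refine (P.onTrap_coe _ ⟨v, hv⟩).trans ?_
    refine P.real_eq_killedOp hq ⟨v, hv⟩ (measurableSet_hits _) P.real_head_hits_base ?_
    filter_upwards [P.law_ae_zero (P.ofTrap ⟨v, hv⟩)] with y hy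
    constructor
    · rintro ⟨n, hn⟩
      rcases n with _ | n
      · rw [hy] at hn
        exact absurd (congrArg Subtype.val (P.ofTrap_injective hn)) hvb
      · exact ⟨n, hn⟩
    · rintro ⟨n, hn⟩
      exact ⟨n + 1, hn⟩

/-- Stopping the walk at `head` amounts to certain killing above the root, that is, to `e = 1`. -/
theorem pDe_eq (hq : 1 < q) : P.pDe = 1 / P.trap.potential 1 P.trap.base.1 := by
  set A : Set (ℕ → P.Vertex) := {x | ∃ n, x n = P.base ∧ ∀ m ≤ n, x m ≠ P.head} with hA
  have hAm : MeasurableSet A := by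
    have : A = ⋃ n, {x | x n ∈ ({P.base} : Set P.Vertex)} ∩
        ⋂ m, ⋂ (_ : m ≤ n), {x | x m ∈ ({P.head}ᶜ : Set P.Vertex)} := by
      ext x
      simp [hA]
    rw [this]
    exact MeasurableSet.iUnion fun n => (measurableSet_coord _ _).inter
      (MeasurableSet.iInter fun m => MeasurableSet.iInter fun _ => measurableSet_coord _ _)
  have hne : ∀ y, P.ofTrap y ≠ P.head := fun y h =>
    P.head_notMem_trapSet (h ▸ P.ofTrap_mem_trapSet y)
  have h := P.potential_of_eq_killedOp hq one_pos le_rfl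
    (f := P.onTrap fun w => (P.law w).real A) ?_ ?_
  · rw [one_div_one] at h
    exact (P.onTrap_coe (fun w => (P.law w).real A) P.trap.root).symm.trans h
  · rw [P.onTrap_coe]
    have : P.law (P.ofTrap P.trap.base) A = 1 := by
      refine prob_compl_eq_zero_iff hAm |>.1 ?_
      rw [measure_eq_zero_iff_ae_notMem]
      filter_upwards [P.law_ae_zero (P.ofTrap P.trap.base)] with y hy hy'
      refine hy' ⟨0, hy, fun m hm => ?_⟩
      rw [Nat.le_zero.1 hm, hy]
      exact hne _
    rw [measureReal_def, this]
    rfl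
  · intro v hv hvb
    refine (P.onTrap_coe _ ⟨v, hv⟩).trans ?_
    refine P.real_eq_killedOp hq ⟨v, hv⟩ hAm ?_ ?_
    · have : P.law P.head A = 0 := by
        rw [measure_eq_zero_iff_ae_notMem]
        filter_upwards [P.law_ae_zero P.head] with y hy hy'
        obtain ⟨n, -, hn⟩ := hy'
        exact hn 0 (Nat.zero_le n) hy
      rw [measureReal_def, this]
      simp
    filter_upwards [P.law_ae_zero (P.ofTrap ⟨v, hv⟩)] with y hy
    constructor
    · rintro ⟨n, hn, hm⟩
      rcases n with _ | n
      · rw [hy] at hn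
        exact absurd (congrArg Subtype.val (P.ofTrap_injective hn)) hvb
      · exact ⟨n, hn, fun m hmn => hm (m + 1) (by omega)⟩
    · rintro ⟨n, hn, hm⟩
      refine ⟨n + 1, hn, fun m hmn => ?_⟩
      rcases m with _ | m
      · rw [hy]
        exact hne _
      · exact hm m (by omega)

/-- The potentials for `pEsc` and for 1 differ only in the constant `1 / e`. With R the resistance
of the spine, 1/p_de = 1 + R, so c_f = 1/p_esc + R. -/
theorem correction_eq (hq : 1 < q) :
    P.correction = P.trap.potential P.pEsc P.trap.base.1 := by
  rw [correction, P.pDe_eq hq, FiniteWeightedTree.potential, FiniteWeightedTree.potential,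
    one_div, one_div, inv_inv]
  ring

/-- The two events could differ only by a visit at time 0, and the walk does not start at the base.
-/
theorem fallsDeeply_ae_eq (h : P.trap.base ≠ P.trap.root) :
    ∀ᵐ x ∂P.law P.ent, x ∈ P.fallsDeeply ↔ x ∈ hits P.base := by
  filter_upwards [P.law_ae_zero P.ent] with x hx
  constructor
  · rintro ⟨n, -, hn⟩
    exact ⟨n, hn⟩
  · rintro ⟨n, hn⟩
    refine ⟨n, Nat.pos_of_ne_zero ?_, hn⟩
    rintro rfl
    exact h (P.ofTrap_injective (hn.symm.trans hx))

theorem real_ent_hits_base_eq_inv (hq : 1 < q) (hqQ : q ≤ Q) :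
    (P.law P.ent).real (hits P.base) = (P.pEsc * P.correction)⁻¹ := by
  rw [P.real_ent_hits_base hq hqQ, P.correction_eq hq, mul_inv, div_eq_mul_inv, one_div]

theorem pDe_pos (hq : 1 < q) : 0 < P.pDe := by
  rw [P.pDe_eq hq]
  exact one_div_pos.2 (P.trap.potential_pos hq one_pos P.trap.base.2)

theorem real_fallsDeeply (hq : 1 < q) (hqQ : q ≤ Q) (h : P.trap.base ≠ P.trap.root) :
    (P.law P.ent).real P.fallsDeeply = P.pDe / (1 - (1 - P.pEsc) * (1 - P.pDe)) := by
  have h1 : (P.law P.ent).real P.fallsDeeply = (P.law P.ent).real (hits P.base) := by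
    rw [measureReal_def, measureReal_def]
    congr 1
    refine measure_congr ?_
    filter_upwards [P.fallsDeeply_ae_eq h] with x hx
    exact propext hx
  have hd := (P.pDe_pos hq).ne'
  have he := (P.pEsc_pos hq hqQ).ne'
  rw [h1, P.real_ent_hits_base_eq_inv hq hqQ, correction]
  have h2 : 1 - (1 - P.pEsc) * (1 - P.pDe) = P.pEsc * (P.pEsc⁻¹ + P.pDe⁻¹ - 1) * P.pDe := by
    field_simp
    ring
  rw [h2, div_mul_cancel_right₀ hd]

end BackboneTreePair

/-! ## Bare trees -/

namespace FiniteWeightedTree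

variable {q Q : ℝ} (T : FiniteWeightedTree q Q)

/-- The distance from the root of the last vertex that the path from the root to `v` shares with
the path from the root to the base. -/
def branchIndex (v : List ℕ) : ℕ := Nat.findGreatest (fun i => v.take i <+: T.base.1) v.length

theorem branchIndex_le_length (v : List ℕ) : T.branchIndex v ≤ v.length := Nat.findGreatest_le _

theorem take_branchIndex_prefix (v : List ℕ) : v.take (T.branchIndex v) <+: T.base.1 :=
  Nat.findGreatest_spec (P := fun i => v.take i <+: T.base.1) (Nat.zero_le v.length) (by simp)

theorem take_prefix_base_iff {v : List ℕ} {j : ℕ} (hj : j ≤ v.length) :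
    v.take j <+: T.base.1 ↔ j ≤ T.branchIndex v := by
  constructor
  · exact fun h => Nat.le_findGreatest hj h
  · exact fun h => (List.take_prefix_take_left h).trans (T.take_branchIndex_prefix v)

theorem take_branchIndex_eq (v : List ℕ) :
    v.take (T.branchIndex v) = T.base.1.take (T.branchIndex v) := by
  have h := List.prefix_iff_eq_take.1 (T.take_branchIndex_prefix v)
  rwa [List.length_take, min_eq_left (T.branchIndex_le_length v)] at h

theorem branchIndex_le_depth (v : List ℕ) : T.branchIndex v ≤ T.depth := by
  have h := (T.take_branchIndex_prefix v).length_le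
  rwa [List.length_take, min_eq_left (T.branchIndex_le_length v), T.length_base] at h

theorem eq_base_of_branchIndex_eq_depth {v : List ℕ} (hv : v ∈ T.verts)
    (h : T.branchIndex v = T.depth) : v = T.base.1 := by
  have h1 := T.length_le_depth hv
  have h2 := T.branchIndex_le_length v
  have h3 := T.take_branchIndex_prefix v
  rw [List.take_of_length_le (by omega)] at h3
  exact h3.eq_of_length (by rw [T.length_base]; omega)

/-- Once a path from the root has left the spine, it does not come back. -/
theorem branchIndex_eq_of_prefix {u x : List ℕ} (hux : u <+: x) (h : T.branchIndex u < u.length) :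
    T.branchIndex x = T.branchIndex u := by
  have hl := hux.length_le
  have ht : ∀ j ≤ u.length, x.take j = u.take j := by
    intro j hj
    obtain ⟨t, rfl⟩ := hux
    exact List.take_append_of_le_length hj
  refine le_antisymm ?_ ?_
  · by_contra hlt
    push Not at hlt
    have h1 := (T.take_prefix_base_iff (v := x) (j := T.branchIndex u + 1) (by omega)).2 hlt
    rw [ht _ h, T.take_prefix_base_iff h] at h1
    omega
  · rw [← T.take_prefix_base_iff (by omega), ht _ h.le]
    exact T.take_branchIndex_prefix u

/-- The path from the branch point down to `v` uses no spine edge, so it stays in one component.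
This translates bareness, stated for graphs, into a statement on prefixes. -/
theorem take_mem_outgrowth {v : List ℕ} (hv : v ∈ T.verts) {j : ℕ} (hj : T.branchIndex v ≤ j) :
    (⟨v.take j, T.take_mem v hv j⟩ : T.Vertex) ∈ T.outgrowth (T.branchIndex v) := by
  have h0 : (⟨v.take (T.branchIndex v), T.take_mem v hv _⟩ : T.Vertex) =
      T.spine (T.branchIndex v) := Subtype.ext (T.take_branchIndex_eq v)
  rw [outgrowth, SimpleGraph.ConnectedComponent.mem_supp_iff, SimpleGraph.ConnectedComponent.eq, ← h0]
  induction j, hj using Nat.le_induction with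
  | base => exact SimpleGraph.Reachable.refl _
  | succ j hj ih =>
    refine SimpleGraph.Reachable.trans ?_ ih
    rcases Nat.lt_or_ge j v.length with hlt | hge
    · refine SimpleGraph.Adj.reachable ?_
      rw [SimpleGraph.deleteEdges_adj]
      have hne : ∀ h, (⟨v.take (j + 1), h⟩ : T.Vertex) ≠ ⟨v.take j, T.take_mem v hv j⟩ := by
        intro h he
        have := congrArg (fun x : T.Vertex => x.1.length) he
        simp only [List.length_take] at this
        omega
      refine ⟨?_, ?_⟩
      · rw [graph, SimpleGraph.fromRel_adj]
        exact ⟨hne _, Or.inr ⟨v[j], by simp⟩⟩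
      · rintro ⟨i, -, he⟩
        have hmem : (⟨v.take (j + 1), T.take_mem v hv _⟩ : T.Vertex) ∈
            s(T.spine i, T.spine (i + 1)) := by
          rw [← he]
          exact Sym2.mem_mk_left _ _
        have hp : v.take (j + 1) <+: T.base.1 := by
          rcases Sym2.mem_iff.1 hmem with h | h
          · have h' : v.take (j + 1) = T.base.1.take i := congrArg Subtype.val h
            rw [h']
            exact List.take_prefix _ _
          · have h' : v.take (j + 1) = T.base.1.take (i + 1) := congrArg Subtype.val h
            rw [h']
            exact List.take_prefix _ _
        rw [T.take_prefix_base_iff hlt] at hp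
        omega
    · have : (⟨v.take (j + 1), T.take_mem v hv _⟩ : T.Vertex) = ⟨v.take j, T.take_mem v hv j⟩ :=
        Subtype.ext (by simp only; rw [List.take_of_length_le (by omega), List.take_of_length_le hge])
      rw [this]

/-! ### Counting vertices of bare trees -/

section Bare

variable {T} {N : ℕ}

theorem card_branchIndex_le (hN : ∀ i < T.depth, (T.outgrowth i).ncard ≤ N) {i : ℕ}
    (hi : i < T.depth) : (T.verts.filter fun v => T.branchIndex v = i).card ≤ N := by
  refine le_trans ?_ (hN i hi)
  rw [Set.ncard_eq_toFinset_card (T.outgrowth i) (Set.toFinite _)]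
  rw [← Finset.card_map ⟨Subtype.val, Subtype.val_injective⟩]
  refine Finset.card_le_card fun v hv => ?_
  obtain ⟨hv', rfl⟩ := Finset.mem_filter.1 hv
  refine Finset.mem_map.2 ⟨⟨v, hv'⟩, ?_, rfl⟩
  rw [Set.Finite.mem_toFinset]
  have := T.take_mem_outgrowth hv' (T.branchIndex_le_length v)
  simpa using this

/-- The vertices on the path from the branch point to `v` are distinct and lie in one outgrowth,
which has at most `N` elements. If the branch point is the base, `v` cannot be longer than the base.
-/
theorem length_le_branchIndex_add (hN : ∀ i < T.depth, (T.outgrowth i).ncard ≤ N) {v : List ℕ}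
    (hv : v ∈ T.verts) : v.length ≤ T.branchIndex v + N := by
  rcases (T.branchIndex_le_depth v).lt_or_eq with hlt | heq
  · refine le_trans ?_ (Nat.add_le_add_left (hN _ hlt) _)
    let f : ℕ → T.Vertex := fun j => ⟨v.take j, T.take_mem v hv j⟩
    have hinj : Set.InjOn f (Finset.Icc (T.branchIndex v) v.length : Finset ℕ) := by
      intro a ha b hb hab
      have h1 := congrArg (fun x : T.Vertex => x.1.length) hab
      simp only [f, List.length_take] at h1
      have ha := Finset.mem_Icc.1 ha
      have hb := Finset.mem_Icc.1 hb
      omega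
    have h := Set.ncard_le_ncard (s := f '' (Finset.Icc (T.branchIndex v) v.length : Finset ℕ))
      (t := T.outgrowth (T.branchIndex v)) (by
        rintro _ ⟨j, hj, rfl⟩
        exact T.take_mem_outgrowth hv (Finset.mem_Icc.1 hj).1) (Set.toFinite _)
    rw [hinj.ncard_image, Set.ncard_coe_finset, Nat.card_Icc] at h
    have := T.branchIndex_le_length v
    omega
  · have := T.length_le_depth hv
    omega

theorem card_verts_le (hN : ∀ i < T.depth, (T.outgrowth i).ncard ≤ N) :
    T.verts.card ≤ N * T.depth + 1 := by
  have h := Finset.card_eq_sum_card_fiberwise (s := T.verts) (t := Finset.range (T.depth + 1))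
    (f := T.branchIndex) (fun v _ => Finset.mem_coe.2 (Finset.mem_range.2
      (Nat.lt_succ_of_le (T.branchIndex_le_depth v))))
  rw [h, Finset.sum_range_succ]
  refine add_le_add ?_ ?_
  · refine (Finset.sum_le_card_nsmul _ _ N fun i hi =>
      card_branchIndex_le hN (Finset.mem_range.1 hi)).trans ?_
    rw [Finset.card_range, smul_eq_mul, mul_comm]
  -- The outgrowth at index `depth` is not bounded by hypothesis, but the base is the only vertex
  -- with this branch index.
  · rw [Finset.card_le_one]
    intro a ha b hb
    rw [Finset.mem_filter] at ha hb
    rw [T.eq_base_of_branchIndex_eq_depth ha.1 ha.2, T.eq_base_of_branchIndex_eq_depth hb.1 hb.2]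

end Bare

/-! ### Growth along the spine and the error terms of bare trees -/

variable {T}

theorem pathWeight_le_take (hq : 1 < q) {v : List ℕ} (hv : v ∈ T.verts) (j : ℕ) :
    T.pathWeight v ≤ T.pathWeight (v.take j) * Q ^ (v.length - j) := by
  induction v using List.reverseRecOn with
  | nil => simp
  | append_singleton w a ih =>
    rcases Nat.lt_or_ge w.length j with h | h
    · rw [List.take_of_length_le (by simp; omega), List.length_append, List.length_singleton,
        Nat.sub_eq_zero_of_le (by omega), pow_zero, mul_one]
    · have hw := T.parent_mem w a hv
      have hb := T.bias_mem _ hv (by simp)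
      have h1 : (w ++ [a]).length - j = w.length - j + 1 := by simp; omega
      rw [T.pathWeight_of_ne_nil (by simp), List.dropLast_concat, h1, pow_succ, ← mul_assoc,
        List.take_append_of_le_length h]
      have hQ : 0 ≤ Q := by linarith [hb.1, hb.2]
      exact mul_le_mul (ih hw) hb.2 (by linarith [hb.1])
        (mul_nonneg (pathWeight_pos hq (T.take_mem w hw j)).le (pow_nonneg hQ _))

theorem le_pathWeight_take (hq : 1 < q) {v : List ℕ} (hv : v ∈ T.verts) (j : ℕ) :
    T.pathWeight (v.take j) * q ^ (v.length - j) ≤ T.pathWeight v := by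
  induction v using List.reverseRecOn with
  | nil => simp
  | append_singleton w a ih =>
    rcases Nat.lt_or_ge w.length j with h | h
    · rw [List.take_of_length_le (by simp; omega), List.length_append, List.length_singleton,
        Nat.sub_eq_zero_of_le (by omega), pow_zero, mul_one]
    · have hw := T.parent_mem w a hv
      have hb := T.bias_mem _ hv (by simp)
      have h1 : (w ++ [a]).length - j = w.length - j + 1 := by simp; omega
      rw [T.pathWeight_of_ne_nil (v := w ++ [a]) (by simp), List.dropLast_concat, h1, pow_succ,
        ← mul_assoc, List.take_append_of_le_length h]
      exact mul_le_mul (ih hw) hb.1 (by linarith) (pathWeight_pos hq hw).le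

theorem pow_depth_le_weight (hq : 1 < q) : q ^ T.depth ≤ T.weight := by
  have h := le_pathWeight_take hq T.base.2 0
  rw [List.take_zero, T.pathWeight_nil, one_mul, Nat.sub_zero, T.length_base] at h
  exact h.trans (Finset.single_le_sum (f := T.pathWeight) (fun v hv => (pathWeight_pos hq hv).le)
    T.base.2)

/-- Weights grow by a factor of at least `q` at each step of the spine, so the resistances below a
point are dominated by a geometric series. -/
theorem sum_spine_le (hq : 1 < q) (i : ℕ) :
    ∑ j ∈ Finset.Ico i T.depth, 1 / T.pathWeight (T.base.1.take (j + 1)) ≤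
      1 / (T.pathWeight (T.base.1.take i)) / (q - 1) := by
  have hq0 : 0 < q := by linarith
  set w := T.pathWeight (T.base.1.take i) with hw
  have hwpos : 0 < w := pathWeight_pos hq (T.take_mem _ T.base.2 i)
  have h1 : ∀ j ∈ Finset.Ico i T.depth, 1 / T.pathWeight (T.base.1.take (j + 1)) ≤
      1 / w * q⁻¹ * q⁻¹ ^ (j - i) := by
    intro j hj
    obtain ⟨hj1, hj2⟩ := Finset.mem_Ico.1 hj
    have h := le_pathWeight_take hq (T.take_mem _ T.base.2 (j + 1)) i
    rw [List.take_take, min_eq_left (by omega), List.length_take, T.length_base,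
      min_eq_left (by omega), ← hw, show j + 1 - i = (j - i) + 1 by omega] at h
    have h2 : 1 / w * q⁻¹ * q⁻¹ ^ (j - i) = 1 / (w * q ^ (j - i + 1)) := by
      rw [inv_pow, pow_succ]
      field_simp
    rw [h2]
    exact one_div_le_one_div_of_le (by positivity) h
  refine (Finset.sum_le_sum h1).trans ?_
  rw [← Finset.mul_sum, Finset.sum_Ico_eq_sum_range]
  simp only [Nat.add_sub_cancel_left]
  have hr : q⁻¹ < 1 := inv_lt_one_of_one_lt₀ hq
  have hg := sum_le_hasSum (Finset.range (T.depth - i)) (fun k _ => by positivity)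
    (hasSum_geometric_of_lt_one (inv_nonneg.2 hq0.le) hr)
  refine (mul_le_mul_of_nonneg_left hg (by positivity)).trans (le_of_eq ?_)
  have : q - 1 ≠ 0 := by linarith
  have h3 : 1 - q⁻¹ ≠ 0 := by
    intro h
    linarith
  field_simp

theorem pathSum_eq_take_add (g : List ℕ → ℝ) {v : List ℕ} {i : ℕ} (hi : i ≤ v.length) :
    pathSum g v = pathSum g (v.take i) + ∑ j ∈ Finset.Ico i v.length, g (v.take (j + 1)) := by
  rw [pathSum, pathSum, List.length_take, min_eq_left hi, ← Finset.sum_range_add_sum_Ico _ hi]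
  congr 1
  refine Finset.sum_congr rfl fun j hj => ?_
  rw [List.take_take, min_eq_left (by have := Finset.mem_range.1 hj; omega)]

theorem pathSum_base_sub (g : List ℕ → ℝ) (v : List ℕ) :
    pathSum g T.base.1 - pathSum g (v.take (T.branchIndex v)) =
      ∑ j ∈ Finset.Ico (T.branchIndex v) T.depth, g (T.base.1.take (j + 1)) := by
  rw [pathSum_eq_take_add g (v := T.base.1) (i := T.branchIndex v)
    (by rw [T.length_base]; exact T.branchIndex_le_depth v), T.length_base, T.take_branchIndex_eq]
  ring

/-- The resistance scale `1 / w` at the point where `v` branches off the spine. -/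
def branchResistance (T : FiniteWeightedTree q Q) (v : List ℕ) : ℝ :=
  1 / T.pathWeight (v.take (T.branchIndex v))

theorem sum_spine_le_branchResistance (hq : 1 < q) (v : List ℕ) :
    ∑ j ∈ Finset.Ico (T.branchIndex v) T.depth, 1 / T.pathWeight (T.base.1.take (j + 1)) ≤
      T.branchResistance v / (q - 1) := by
  rw [branchResistance, T.take_branchIndex_eq]
  exact sum_spine_le hq _

/-- The potential is constant on each outgrowth, so `v` may be replaced by its branch point; the
resistances of the rest of the spine remain. -/
theorem potential_base_sub (e : ℝ) (v : List ℕ) :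
    T.potential e T.base.1 - T.potential e v =
      ∑ j ∈ Finset.Ico (T.branchIndex v) T.depth, 1 / T.pathWeight (T.base.1.take (j + 1)) := by
  have h1 : pathSum T.spineResistance v = pathSum T.spineResistance (v.take (T.branchIndex v)) := by
    rw [pathSum_eq_take_add _ (T.branchIndex_le_length v), add_eq_left]
    refine Finset.sum_eq_zero fun j hj => if_neg fun h => ?_
    obtain ⟨hj1, hj2⟩ := Finset.mem_Ico.1 hj
    rw [T.take_prefix_base_iff hj2] at h
    omega
  rw [potential, potential, h1, add_sub_add_left_eq_sub, pathSum_base_sub]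
  exact Finset.sum_congr rfl fun j _ => if_pos (List.take_prefix _ _)

theorem potential_le_base (hq : 1 < q) (e : ℝ) (v : List ℕ) :
    T.potential e v ≤ T.potential e T.base.1 := by
  have h := potential_base_sub (T := T) e v
  have : 0 ≤ ∑ j ∈ Finset.Ico (T.branchIndex v) T.depth,
      1 / T.pathWeight (T.base.1.take (j + 1)) :=
    Finset.sum_nonneg fun j _ => one_div_nonneg.2 (pathWeight_pos hq (T.take_mem _ T.base.2 _)).le
  linarith

theorem potential_base_le (hq : 1 < q) (e : ℝ) :
    T.potential e T.base.1 ≤ 1 / e + 1 / (q - 1) := by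
  have h := potential_base_sub (T := T) e []
  have h1 : T.branchIndex [] = 0 := Nat.le_zero.1 (T.branchIndex_le_length [])
  have h2 := sum_spine_le_branchResistance (T := T) hq []
  rw [branchResistance, List.take_nil, T.pathWeight_nil, one_div_one] at h2
  rw [← h, potential, potential, pathSum_nil] at h2
  rw [potential]
  linarith

theorem one_div_le_potential_base (hq : 1 < q) (e : ℝ) : 1 / e ≤ T.potential e T.base.1 :=
  le_add_of_nonneg_right (T.pathSum_nonneg_of (fun _ hu => T.spineResistance_nonneg hq hu) T.base.2)

/-- The growth of the measure cancels against the decay of the resistance: a vertex lies at most `N`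
steps below its branch point, so the ratio of their weights is at most `Q ^ N`. There are at most `N
* depth + 1` vertices, and edges are counted at both ends. -/
theorem sum_revMeasure_mul_branchResistance_le (hq : 1 < q) (hqQ : q ≤ Q) {N : ℕ}
    (hN : ∀ i < T.depth, (T.outgrowth i).ncard ≤ N) :
    ∑ v ∈ T.verts, T.revMeasure v * T.branchResistance v ≤
      (N * T.depth + 1) * ((1 + Q) * Q ^ N) := by
  have hQ : 1 ≤ Q := by linarith
  have h1 : ∀ v ∈ T.verts, T.pathWeight v * T.branchResistance v ≤ Q ^ N := by
    intro v hv
    have hw := pathWeight_pos hq (T.take_mem v hv (T.branchIndex v))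
    rw [branchResistance, mul_one_div, div_le_iff₀ hw, mul_comm]
    refine (pathWeight_le_take hq hv (T.branchIndex v)).trans
      (mul_le_mul_of_nonneg_left (pow_le_pow_right₀ hQ ?_) hw.le)
    have := length_le_branchIndex_add hN hv
    omega
  have h2 : ∀ c ∈ T.verts.filter (fun c => c ≠ []),
      T.pathWeight c * T.branchResistance c.dropLast ≤ Q * Q ^ N := by
    intro c hc
    obtain ⟨hc, h0⟩ := Finset.mem_filter.1 hc
    have hd := T.dropLast_mem hc
    have hb := T.bias_mem c hc h0
    rw [T.pathWeight_of_ne_nil h0, mul_right_comm, mul_comm Q]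
    exact mul_le_mul (h1 _ hd) hb.2 (by linarith [hb.1]) (by positivity)
  rw [T.sum_revMeasure_mul]
  have h3 := Finset.sum_le_card_nsmul _ _ _ h1
  have h4 := Finset.sum_le_card_nsmul _ _ _ h2
  have h5 : (T.verts.card : ℝ) ≤ N * T.depth + 1 := by exact_mod_cast card_verts_le hN
  have h6 : ((T.verts.filter fun c => c ≠ []).card : ℝ) ≤ N * T.depth + 1 :=
    le_trans (by exact_mod_cast Finset.card_filter_le _ _) h5
  rw [nsmul_eq_mul] at h3 h4
  have hQN : 0 ≤ Q ^ N := by positivity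
  have h7 := mul_le_mul_of_nonneg_right h5 hQN
  have h8 := mul_le_mul_of_nonneg_right h6 (mul_nonneg (by linarith : 0 ≤ Q) hQN)
  linarith

/-- Off the spine all descendents of `u` lie in the same outgrowth. There are at most `N` of them,
each of weight at most `Q ^ N` relative to `u`. -/
theorem climbTime_le_of_branchIndex_lt (hq : 1 < q) (hqQ : q ≤ Q) {N : ℕ}
    (hN : ∀ i < T.depth, (T.outgrowth i).ncard ≤ N) {u : List ℕ} (hu : u ∈ T.verts)
    (h : T.branchIndex u < u.length) : T.climbTime u ≤ 2 * (N * Q ^ N) := by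
  have hQ : 1 ≤ Q := by linarith
  have hw := pathWeight_pos hq hu
  have h1 : ∀ x ∈ T.verts.filter (fun x => u <+: x), T.pathWeight x ≤ T.pathWeight u * Q ^ N := by
    intro x hx
    obtain ⟨hx, hux⟩ := Finset.mem_filter.1 hx
    have h2 := pathWeight_le_take hq hx u.length
    rw [← List.prefix_iff_eq_take.1 hux] at h2
    refine h2.trans (mul_le_mul_of_nonneg_left (pow_le_pow_right₀ hQ ?_) hw.le)
    have h3 := length_le_branchIndex_add hN hx
    rw [T.branchIndex_eq_of_prefix hux h] at h3
    omega
  have hcard : (T.verts.filter fun x => u <+: x).card ≤ N := by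
    have hi : T.branchIndex u < T.depth := h.trans_le (T.length_le_depth hu)
    refine le_trans (Finset.card_le_card fun x hx => ?_) (card_branchIndex_le hN hi)
    obtain ⟨hx, hux⟩ := Finset.mem_filter.1 hx
    exact Finset.mem_filter.2 ⟨hx, T.branchIndex_eq_of_prefix hux h⟩
  have h4 : T.branchWeight u ≤ N * (T.pathWeight u * Q ^ N) := by
    refine (Finset.sum_le_card_nsmul _ _ _ h1).trans ?_
    rw [nsmul_eq_mul]
    exact mul_le_mul_of_nonneg_right (by exact_mod_cast hcard) (by positivity)
  rw [climbTime]
  have h5 : 2 * T.branchWeight u / T.pathWeight u ≤ 2 * (N * Q ^ N) := by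
    rw [div_le_iff₀ hw]
    linarith
  linarith

/-- Both lifetimes are compared with the one at the branch point of `v`. Down to the base the
climbing times are at most 2ω over the weights, a geometric series; down to `v` there are at most
`N` steps off the spine, each of climbing time at most `2 * (N * Q ^ N)`. -/
theorem abs_lifetime_base_sub_le (hq : 1 < q) (hqQ : q ≤ Q) {N : ℕ}
    (hN : ∀ i < T.depth, (T.outgrowth i).ncard ≤ N) (e : ℝ) {v : List ℕ} (hv : v ∈ T.verts) :
    |T.lifetime e T.base.1 - T.lifetime e v| ≤
      2 * T.weight * (T.branchResistance v / (q - 1)) + 2 * (N ^ 2 * Q ^ N) := by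
  have hQ : 1 ≤ Q := by linarith
  have h1 : T.lifetime e T.base.1 - T.lifetime e v =
      (∑ j ∈ Finset.Ico (T.branchIndex v) T.depth, T.climbTime (T.base.1.take (j + 1))) -
        ∑ j ∈ Finset.Ico (T.branchIndex v) v.length, T.climbTime (v.take (j + 1)) := by
    rw [← pathSum_base_sub, lifetime, lifetime,
      pathSum_eq_take_add T.climbTime (T.branchIndex_le_length v)]
    ring
  have h2 : |∑ j ∈ Finset.Ico (T.branchIndex v) T.depth, T.climbTime (T.base.1.take (j + 1))| ≤
      2 * T.weight * (T.branchResistance v / (q - 1)) := by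
    have hnn : ∀ j, 0 ≤ T.climbTime (T.base.1.take (j + 1)) := fun j =>
      zero_le_one.trans (T.one_le_climbTime hq (T.take_mem _ T.base.2 _))
    rw [abs_of_nonneg (Finset.sum_nonneg fun j _ => hnn j)]
    refine le_trans (Finset.sum_le_sum fun j _ => ?_) (le_trans (Finset.mul_sum _ _ _).symm.le
      (mul_le_mul_of_nonneg_left (sum_spine_le_branchResistance (T := T) hq v)
        (by linarith [one_le_weight (T := T) hq])))
    have hw := pathWeight_pos hq (T.take_mem _ T.base.2 (j + 1))
    have := T.branchWeight_le_weight hq (T.base.1.take (j + 1))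
    rw [climbTime, mul_one_div]
    have h3 : 2 * T.branchWeight (T.base.1.take (j + 1)) / T.pathWeight (T.base.1.take (j + 1)) ≤
        2 * T.weight / T.pathWeight (T.base.1.take (j + 1)) :=
      div_le_div_of_nonneg_right (by linarith) hw.le
    linarith
  have h3 : |∑ j ∈ Finset.Ico (T.branchIndex v) v.length, T.climbTime (v.take (j + 1))| ≤
      2 * (N ^ 2 * Q ^ N) := by
    have hnn : ∀ j, 0 ≤ T.climbTime (v.take (j + 1)) := fun j =>
      zero_le_one.trans (T.one_le_climbTime hq (T.take_mem _ hv _))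
    rw [abs_of_nonneg (Finset.sum_nonneg fun j _ => hnn j)]
    refine (Finset.sum_le_card_nsmul _ _ (2 * (N * Q ^ N)) fun j hj => ?_).trans ?_
    · obtain ⟨hj1, hj2⟩ := Finset.mem_Ico.1 hj
      refine climbTime_le_of_branchIndex_lt hq hqQ hN (T.take_mem v hv _) ?_
      rw [List.length_take, min_eq_left hj2]
      by_contra hcon
      push Not at hcon
      have h4 := (T.take_prefix_base_iff (v := v.take (j + 1)) (j := j + 1)
        (by rw [List.length_take, min_eq_left hj2])).2 hcon
      rw [List.take_take, min_self, T.take_prefix_base_iff hj2] at h4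
      omega
    · rw [Nat.card_Ico, nsmul_eq_mul]
      have h4 := length_le_branchIndex_add hN hv
      have h5 : ((v.length - T.branchIndex v : ℕ) : ℝ) ≤ N := by
        exact_mod_cast (by omega : v.length - T.branchIndex v ≤ N)
      have h6 : 0 ≤ 2 * (N * Q ^ N) := by positivity
      refine (mul_le_mul_of_nonneg_right h5 h6).trans (le_of_eq (by ring))
  rw [h1]
  exact (abs_sub _ _).trans (add_le_add h2 h3)

/-- By `lifetime_base` the lifetime is the integral of the potential against a measure of mass 2ω -
1; replacing the potential by its maximum c gives 2cω - c. -/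
theorem weight_sub_lifetime_base (hq : 1 < q) {e : ℝ} (he : 0 < e) :
    2 * T.potential e T.base.1 * T.weight - T.lifetime e T.base.1 = T.potential e T.base.1 +
      ∑ v ∈ T.verts, T.revMeasure v * (T.potential e T.base.1 - T.potential e v) := by
  simp only [mul_sub, Finset.sum_sub_distrib]
  rw [← T.lifetime_base hq he, ← Finset.sum_mul, T.sum_revMeasure]
  ring

theorem weight_sub_lifetime_base_nonneg (hq : 1 < q) {e : ℝ} (he : 0 < e) :
    0 ≤ 2 * T.potential e T.base.1 * T.weight - T.lifetime e T.base.1 := by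
  rw [weight_sub_lifetime_base hq he]
  exact add_nonneg (T.potential_pos hq he T.base.2).le (Finset.sum_nonneg fun v hv =>
    mul_nonneg (revMeasure_pos hq hv).le (sub_nonneg.2 (potential_le_base hq e v)))

theorem weight_sub_lifetime_base_le (hq : 1 < q) (hqQ : q ≤ Q) {N : ℕ}
    (hN : ∀ i < T.depth, (T.outgrowth i).ncard ≤ N) {e : ℝ} (he : 0 < e) :
    2 * T.potential e T.base.1 * T.weight - T.lifetime e T.base.1 ≤ T.potential e T.base.1 +
      (N * T.depth + 1) * ((1 + Q) * Q ^ N) / (q - 1) := by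
  rw [weight_sub_lifetime_base hq he]
  have hq1 : 0 ≤ q - 1 := by linarith
  have h1 : ∀ v ∈ T.verts, T.revMeasure v * (T.potential e T.base.1 - T.potential e v) ≤
      T.revMeasure v * T.branchResistance v / (q - 1) := by
    intro v hv
    rw [mul_div_assoc, potential_base_sub]
    exact mul_le_mul_of_nonneg_left (sum_spine_le_branchResistance hq v) (revMeasure_pos hq hv).le
  have h2 := Finset.sum_le_sum h1
  rw [← Finset.sum_div] at h2
  exact add_le_add le_rfl (h2.trans (div_le_div_of_nonneg_right
    (sum_revMeasure_mul_branchResistance_le hq hqQ hN) hq1))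

/-- The lifetime of the walk started from the base is close to exponential. -/
theorem sum_abs_survival_sub_exp_le_of_bare (hq : 1 < q) (hqQ : q ≤ Q) {N : ℕ}
    (hN : ∀ i < T.depth, (T.outgrowth i).ncard ≤ N) {e : ℝ} (he : 0 < e) (he1 : e ≤ 1) (n : ℕ) :
    ∑ k ∈ Finset.range n, |T.survival e k T.base.1 -
        Real.exp (-(k / (2 * T.potential e T.base.1 * T.weight)))| ≤
      5 * ((N * T.depth + 1) * ((1 + Q) * Q ^ N) / (q - 1)) + 3 * T.potential e T.base.1 +
        4 * (N ^ 2 * Q ^ N) + 1 := by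
  set c := T.potential e T.base.1 with hc
  set A := (N * T.depth + 1) * ((1 + Q) * Q ^ N) / (q - 1) with hA
  -- The intended mean of the exponential variable: `c` is the correction factor when `e` is the
  -- escape probability.
  set M := 2 * c * T.weight with hM
  have hω := one_le_weight (T := T) hq
  have hc1 : 1 ≤ c := le_trans (by rw [le_div_iff₀ he]; linarith) (one_div_le_potential_base hq e)
  have hM1 : 1 ≤ M := by rw [hM]; nlinarith
  have h1 := weight_sub_lifetime_base_nonneg (T := T) hq he
  have h2 := weight_sub_lifetime_base_le hq hqQ hN he
  rw [← hc, ← hM] at h1 h2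
  rw [← hA] at h2
  have h3 := T.sum_abs_survival_sub_exp_le hq he he1 hM1 n
  have h4 : ∀ v ∈ T.verts, T.revMeasure v * (|M - T.lifetime e v| * T.potential e v) ≤
      c * ((c + A + 2 * (N ^ 2 * Q ^ N)) * T.revMeasure v +
        2 * T.weight / (q - 1) * (T.revMeasure v * T.branchResistance v)) := by
    intro v hv
    have hπ := revMeasure_pos hq hv
    have h5 := abs_lifetime_base_sub_le hq hqQ hN e hv
    have h6 : |M - T.lifetime e v| ≤ (c + A) +
        (2 * T.weight * (T.branchResistance v / (q - 1)) + 2 * (N ^ 2 * Q ^ N)) := by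
      refine (abs_sub_le _ (T.lifetime e T.base.1) _).trans (add_le_add ?_ h5)
      rwa [abs_of_nonneg h1]
    have h7 := mul_le_mul h6 (potential_le_base hq e v) (T.potential_pos hq he hv).le
      ((abs_nonneg _).trans h6)
    refine (mul_le_mul_of_nonneg_left h7 hπ.le).trans (le_of_eq ?_)
    rw [← hc]
    ring
  have h8 := Finset.sum_le_sum h4
  rw [← Finset.mul_sum, Finset.sum_add_distrib, ← Finset.mul_sum, ← Finset.mul_sum,
    T.sum_revMeasure] at h8
  have h9 := sum_revMeasure_mul_branchResistance_le hq hqQ hN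
  have hq1 : 0 < q - 1 := by linarith
  have h10 : 2 * T.weight / (q - 1) * ∑ v ∈ T.verts, T.revMeasure v * T.branchResistance v ≤
      2 * T.weight * A := by
    rw [hA, div_mul_eq_mul_div, mul_div_assoc, mul_div_assoc]
    refine mul_le_mul_of_nonneg_left ?_ (by linarith)
    rw [← mul_div_assoc]
    exact div_le_div_of_nonneg_right h9 hq1.le
  have hQ : 0 < Q := by linarith
  have hA0 : 0 ≤ A := by rw [hA]; positivity
  have hNQ : 0 ≤ (N : ℝ) ^ 2 * Q ^ N := by positivity
  have h11 : (c + A + 2 * (N ^ 2 * Q ^ N)) * (2 * T.weight - 1) ≤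
      (c + A + 2 * (N ^ 2 * Q ^ N)) * (2 * T.weight) :=
    mul_le_mul_of_nonneg_left (by linarith) (by positivity)
  -- Both the total mass and the spread of `lifetime` bring a factor ω, which cancels against `M = 2
  -- * c * T.weight`.
  have h12 : 2 * (∑ v ∈ T.verts, T.revMeasure v * (|M - T.lifetime e v| * T.potential e v)) / M ≤
      2 * (c + 2 * A + 2 * (N ^ 2 * Q ^ N)) := by
    rw [div_le_iff₀ (by linarith)]
    have h13 : c * ((c + A + 2 * (N ^ 2 * Q ^ N)) * (2 * T.weight - 1) +
        2 * T.weight / (q - 1) * ∑ v ∈ T.verts, T.revMeasure v * T.branchResistance v) ≤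
        c * ((c + A + 2 * (N ^ 2 * Q ^ N)) * (2 * T.weight) + 2 * T.weight * A) :=
      mul_le_mul_of_nonneg_left (add_le_add h11 h10) (by linarith)
    have h14 : 2 * (c + 2 * A + 2 * (N ^ 2 * Q ^ N)) * M =
        2 * (c * ((c + A + 2 * (N ^ 2 * Q ^ N)) * (2 * T.weight) + 2 * T.weight * A)) := by
      rw [hM]
      ring
    rw [h14]
    linarith
  have h15 : |T.lifetime e T.base.1 - M| ≤ c + A := by
    rw [abs_sub_comm, abs_of_nonneg h1]
    exact h2
  linarith

end FiniteWeightedTree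

/-- Products of powers of iterated logarithms are dominated by the square root. -/
theorem exists_polylog_le_sqrt {q Q B : ℝ} (hq : 1 < q) (hqQ : q ≤ Q) (hB : 0 < B) :
    ∃ v₀ C : ℝ, 3 ≤ v₀ ∧ 0 < C ∧ ∀ ω : ℝ, v₀ < ω → ∀ N D : ℕ,
      (N : ℝ) ≤ B * Real.log (Real.log ω) → q ^ D ≤ ω →
        1 + (N * D + 1) * Q ^ N + N ^ 2 * Q ^ N ≤ C * ω ^ (1 / 2 : ℝ) := by
  -- The summand `B * Real.log Q` of the exponent comes from `Q ^ N`, and 2 from the two factors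
  -- among `N` and `D`, each of order log ω at most.
  set p : ℝ := 2 + B * Real.log Q with hp
  have ho := isLittleO_log_rpow_rpow_atTop p (s := 1 / 2) (by norm_num)
  have hb := ho.bound one_pos
  rw [Filter.eventually_atTop] at hb
  obtain ⟨a, ha⟩ := hb
  have hlq : 0 < Real.log q := Real.log_pos hq
  have hlQ : 0 < Real.log Q := Real.log_pos (by linarith)
  -- Beyond `a` the power of the logarithm is below the square root; 3 exceeds e, so that log ω ≥ 1.
  refine ⟨max a 3, 1 + (B / Real.log q + 1) + B ^ 2, le_max_right _ _, by positivity, ?_⟩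
  intro ω hω N D hN hD
  have hω3 : 3 < ω := (le_max_right _ _).trans_lt hω
  have h1 := ha ω ((le_max_left _ _).trans hω.le)
  set l := Real.log ω with hl
  have hl1 : 1 ≤ l := by
    rw [hl, Real.le_log_iff_exp_le (by linarith)]
    linarith [Real.exp_one_lt_d9]
  have hl0 : 0 < l := by linarith
  rw [one_mul, Real.norm_of_nonneg (Real.rpow_nonneg hl0.le _),
    Real.norm_of_nonneg (Real.rpow_nonneg (by linarith) _)] at h1
  have hN1 : (N : ℝ) ≤ B * l := hN.trans (mul_le_mul_of_nonneg_left
    ((Real.log_le_sub_one_of_pos hl0).trans (by linarith)) hB.le)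
  have hD1 : (D : ℝ) ≤ l / Real.log q := by
    rw [le_div_iff₀ hlq, ← Real.log_pow, hl]
    exact Real.log_le_log (by positivity) hD
  have hQN : Q ^ N ≤ l ^ (B * Real.log Q) := by
    have hQ0 : 0 < Q := by linarith
    rw [← Real.rpow_natCast, Real.rpow_def_of_pos hQ0, Real.rpow_def_of_pos hl0]
    refine Real.exp_le_exp.2 ?_
    have := mul_le_mul_of_nonneg_left hN hlQ.le
    linarith
  have hQN0 : 0 ≤ Q ^ N := by
    have : 0 < Q := by linarith
    positivity
  have hlp : l ^ p = l ^ 2 * l ^ (B * Real.log Q) := by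
    rw [hp, Real.rpow_add hl0, Real.rpow_two]
  have hX0 : 0 ≤ l ^ (B * Real.log Q) := Real.rpow_nonneg hl0.le _
  have hl2 : 1 ≤ l ^ 2 := one_le_pow₀ hl1
  have hND : (N : ℝ) * D + 1 ≤ (B / Real.log q + 1) * l ^ 2 := by
    have : (N : ℝ) * D ≤ B * l * (l / Real.log q) :=
      mul_le_mul hN1 hD1 (Nat.cast_nonneg _) (by positivity)
    have h2 : B * l * (l / Real.log q) = B / Real.log q * l ^ 2 := by ring
    linarith
  have hN2 : (N : ℝ) ^ 2 ≤ B ^ 2 * l ^ 2 := by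
    rw [← mul_pow]
    exact pow_le_pow_left₀ (Nat.cast_nonneg _) hN1 2
  have e1 : (N * D + 1) * Q ^ N ≤ (B / Real.log q + 1) * l ^ p := by
    rw [hlp, ← mul_assoc]
    exact mul_le_mul hND hQN hQN0 (by positivity)
  have e2 : (N : ℝ) ^ 2 * Q ^ N ≤ B ^ 2 * l ^ p := by
    rw [hlp, ← mul_assoc]
    exact mul_le_mul hN2 hQN hQN0 (by positivity)
  have e3 : 1 ≤ l ^ p := Real.one_le_rpow hl1 (by positivity)
  calc _ ≤ (1 + (B / Real.log q + 1) + B ^ 2) * l ^ p := by linarith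
    _ ≤ _ := mul_le_mul_of_nonneg_left h1 (by positivity)

/-! ## Coupling of a nearly geometric time with an exponential random variable -/

section ExpLevel

variable {r : ℝ}

/-- The values at which the survival function of an exponential variable of rate `r` is less
than `s`. -/
def expLevel (r s : ℝ) : Set ℝ := {e | Real.exp (-(r * e)) < s}

theorem measurableSet_expLevel (r s : ℝ) : MeasurableSet (expLevel r s) :=
  measurableSet_lt (by fun_prop) measurable_const

/-- For an exponential variable E of rate r, exp(-rE) is uniformly distributed on the unit interval.
-/
theorem expMeasure_expLevel (hr : 0 < r) {s : ℝ} (h0 : 0 ≤ s) (h1 : s ≤ 1) :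
    expMeasure r (expLevel r s) = ENNReal.ofReal s := by
  have := isProbabilityMeasure_expMeasure hr
  rcases h0.eq_or_lt with rfl | h0
  · have : expLevel r 0 = ∅ := Set.eq_empty_of_forall_notMem fun e he =>
      (Real.exp_pos _).not_gt he
    rw [this, measure_empty, ENNReal.ofReal_zero]
  · have h : expLevel r s = (Set.Iic (-Real.log s / r))ᶜ := by
      ext e
      rw [expLevel, Set.mem_ofPred_eq, Set.compl_Iic, Set.mem_Ioi, div_lt_iff₀ hr,
        ← Real.lt_log_iff_exp_lt h0]
      constructor <;> intro h <;> linarith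
    have ha : 0 ≤ -Real.log s / r := div_nonneg (neg_nonneg.2 (Real.log_nonpos h0.le h1)) hr.le
    rw [h, prob_compl_eq_one_sub measurableSet_Iic, ← ofReal_cdf, cdf_expMeasure_eq hr, if_pos ha,
      mul_div_cancel₀ _ hr.ne', neg_neg, Real.exp_log h0, ← ENNReal.ofReal_one,
      ← ENNReal.ofReal_sub _ (by linarith), sub_sub_cancel]

theorem ae_nonneg_expMeasure (hr : 0 < r) : ∀ᵐ e ∂expMeasure r, 0 ≤ e := by
  have := isProbabilityMeasure_expMeasure hr
  have h : expMeasure r (Set.Iic 0) = 0 := by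
    rw [← ofReal_cdf, cdf_expMeasure_eq hr]
    simp
  filter_upwards [measure_eq_zero_iff_ae_notMem.1 h] with e he
  exact (not_le.1 he).le

/-- The number of the levels `f 0, f 1, …` that exceed `exp (-(r * e))`. -/
def levelCount (r : ℝ) (f : ℕ → ℝ) (e : ℝ) : ℝ≥0∞ := ∑' k, (expLevel r (f k)).indicator 1 e

theorem measurable_levelCount (r : ℝ) (f : ℕ → ℝ) : Measurable (levelCount r f) :=
  Measurable.tsum fun k => measurable_one.indicator (measurableSet_expLevel r (f k))

theorem levelCount_eq_encard (r : ℝ) (f : ℕ → ℝ) (e : ℝ) :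
    levelCount r f e = ({k | e ∈ expLevel r (f k)} : Set ℕ).encard := by
  rw [← ENNReal.tsum_set_one, tsum_subtype _ (fun _ => (1 : ℝ≥0∞)), levelCount]
  rfl

theorem lintegral_levelCount (hr : 0 < r) {f : ℕ → ℝ} (h0 : ∀ k, 0 ≤ f k) (h1 : ∀ k, f k ≤ 1) :
    ∫⁻ e, levelCount r f e ∂expMeasure r = ∑' k, ENNReal.ofReal (f k) := by
  unfold levelCount
  rw [lintegral_tsum fun k =>
    (measurable_one.indicator (measurableSet_expLevel r (f k))).aemeasurable]
  refine tsum_congr fun k => ?_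
  rw [lintegral_indicator_one (measurableSet_expLevel r _), expMeasure_expLevel hr (h0 k) (h1 k)]

/-- For decreasing levels the exceeded indices form an initial segment, so `levelCount` is the
quantile coupling: its tail probabilities are the levels themselves. -/
theorem lt_levelCount_iff {f : ℕ → ℝ} (hf : Antitone f) (k : ℕ) (e : ℝ) :
    (k : ℝ≥0∞) < levelCount r f e ↔ e ∈ expLevel r (f k) := by
  rw [levelCount]
  constructor
  · intro h
    by_contra hk
    rw [tsum_eq_sum (s := Finset.range k)] at h
    · refine h.not_ge ((Finset.sum_le_card_nsmul _ _ 1 fun i _ => ?_).trans ?_)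
      · exact Set.indicator_le_self' (fun _ _ => zero_le) e
      · simp
    · intro j hj
      refine Set.indicator_of_notMem (fun hj' => hk ?_) _
      exact lt_of_lt_of_le hj' (hf (by simpa using hj))
  · intro h
    refine lt_of_lt_of_le ?_ (ENNReal.sum_le_tsum (Finset.range (k + 1)))
    rw [Finset.sum_congr rfl fun j hj => Set.indicator_of_mem (show e ∈ expLevel r (f j) from
      lt_of_lt_of_le h (hf (by have := Finset.mem_range.1 hj; omega))) _]
    simp only [Pi.one_apply, Finset.sum_const, Finset.card_range, nsmul_eq_mul, mul_one]
    exact_mod_cast Nat.lt_succ_self k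

/-- With exactly exponential levels, index `k` counts if and only if `k < e`, so the count is `e`
rounded up. -/
theorem abs_levelCount_exp_sub_le (hr : 0 < r) {e : ℝ} (he : 0 ≤ e) :
    levelCount r (fun k => Real.exp (-(r * k))) e ≠ ∞ ∧
      |(levelCount r (fun k => Real.exp (-(r * k))) e).toReal - e| ≤ 1 := by
  have hanti : Antitone fun k : ℕ => Real.exp (-(r * k)) := by
    intro a b hab
    refine Real.exp_le_exp.2 (neg_le_neg (mul_le_mul_of_nonneg_left ?_ hr.le))
    exact_mod_cast hab
  have key : ∀ k : ℕ, (k : ℝ≥0∞) < levelCount r (fun k => Real.exp (-(r * k))) e ↔ (k : ℝ) < e := by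
    intro k
    rw [lt_levelCount_iff hanti, expLevel, Set.mem_ofPred_eq, Real.exp_lt_exp, neg_lt_neg_iff,
      mul_lt_mul_iff_right₀ hr]
  rw [levelCount_eq_encard] at key ⊢
  set m := ({k | e ∈ expLevel r (Real.exp (-(r * k)))} : Set ℕ).encard with hm
  clear_value m
  rcases m with _ | n
  · exfalso
    obtain ⟨k, hk⟩ := exists_nat_ge e
    exact hk.not_gt ((key k).1 (by exact ENNReal.natCast_lt_top k))
  · have key' : ∀ k : ℕ, k < n ↔ (k : ℝ) < e := by
      intro k
      rw [← key k]
      change _ ↔ (k : ℝ≥0∞) < (((n : ℕ∞)) : ℝ≥0∞)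
      simp
    have hcast : ((((n : ℕ∞)) : ℝ≥0∞)).toReal = n := by simp
    refine ⟨?_, ?_⟩
    · change (((n : ℕ∞)) : ℝ≥0∞) ≠ ∞
      simp
    change |((((n : ℕ∞)) : ℝ≥0∞)).toReal - e| ≤ 1
    rw [hcast, abs_le]
    have h1 : e ≤ n := not_lt.1 fun h => lt_irrefl n ((key' n).2 h)
    refine ⟨by linarith, ?_⟩
    rcases n with _ | n
    · simp only [Nat.cast_zero]
      linarith
    · have := (key' n).1 (Nat.lt_succ_self n)
      push_cast
      linarith

theorem ofReal_abs_toReal_sub_le {a b d : ℝ≥0∞} (ha : a ≠ ∞) (hb : b ≠ ∞) (h1 : a ≤ b + d)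
    (h2 : b ≤ a + d) : ENNReal.ofReal |a.toReal - b.toReal| ≤ d := by
  rcases eq_or_ne d ∞ with rfl | hd
  · exact le_top
  rw [← ENNReal.toReal_le_toReal ha (ENNReal.add_ne_top.2 ⟨hb, hd⟩), ENNReal.toReal_add hb hd] at h1
  rw [← ENNReal.toReal_le_toReal hb (ENNReal.add_ne_top.2 ⟨ha, hd⟩), ENNReal.toReal_add ha hd] at h2
  refine ENNReal.ofReal_le_of_le_toReal ?_
  rw [abs_le]
  constructor <;> linarith

theorem expMeasure_symmDiff_expLevel (hr : 0 < r) {s t : ℝ} (hs0 : 0 ≤ s) (hs1 : s ≤ 1)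
    (ht0 : 0 ≤ t) (ht1 : t ≤ 1) :
    expMeasure r (symmDiff (expLevel r s) (expLevel r t)) = ENNReal.ofReal |s - t| := by
  have := isProbabilityMeasure_expMeasure hr
  wlog h : s ≤ t generalizing s t
  · rw [symmDiff_comm, abs_sub_comm]
    exact this ht0 ht1 hs0 hs1 (le_of_not_ge h)
  have hsub : expLevel r s ⊆ expLevel r t := fun e he => lt_of_lt_of_le he h
  have hd : symmDiff (expLevel r s) (expLevel r t) = expLevel r t \ expLevel r s := by
    rw [symmDiff_def, sdiff_eq_bot_iff.2 hsub, bot_sup_eq]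
  rw [hd, measure_sdiff hsub (measurableSet_expLevel r s).nullMeasurableSet (measure_ne_top _ _),
    expMeasure_expLevel hr hs0 hs1, expMeasure_expLevel hr ht0 ht1, ← ENNReal.ofReal_sub _ hs0,
    abs_sub_comm, abs_of_nonneg (sub_nonneg.2 h)]

theorem levelCount_le_add (r : ℝ) (f g : ℕ → ℝ) (e : ℝ) :
    levelCount r f e ≤ levelCount r g e +
      ∑' k, (symmDiff (expLevel r (f k)) (expLevel r (g k))).indicator 1 e := by
  rw [levelCount, levelCount, ← ENNReal.tsum_add]
  refine ENNReal.tsum_le_tsum fun k => ?_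
  by_cases h1 : e ∈ expLevel r (f k)
  · by_cases h2 : e ∈ expLevel r (g k)
    · rw [Set.indicator_of_mem h1, Set.indicator_of_mem h2]
      exact le_self_add
    · rw [Set.indicator_of_mem h1, Set.indicator_of_mem
        (show e ∈ symmDiff (expLevel r (f k)) (expLevel r (g k)) from Or.inl ⟨h1, h2⟩)]
      exact le_add_self
  · rw [Set.indicator_of_notMem h1]
    exact zero_le

/-- An exponential variable is close to the number of levels that it exceeds, if the levels are
close to those of a geometric sequence. -/
theorem lintegral_abs_levelCount_sub_le (hr : 0 < r) {f : ℕ → ℝ} (h0 : ∀ k, 0 ≤ f k)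
    (h1 : ∀ k, f k ≤ 1) (hf : Summable f) {K : ℝ}
    (hK : ∀ n, ∑ k ∈ Finset.range n, |f k - Real.exp (-(r * k))| ≤ K) :
    ∫⁻ e, ENNReal.ofReal |(levelCount r f e).toReal - e| ∂expMeasure r ≤
      ENNReal.ofReal (K + 1) := by
  have := isProbabilityMeasure_expMeasure hr
  set g : ℕ → ℝ := fun k => Real.exp (-(r * k)) with hg
  have hg1 : ∀ k, g k ≤ 1 := fun k => Real.exp_le_one_iff.2 (neg_nonpos.2 (by positivity))
  have hK0 : 0 ≤ K := by simpa using hK 0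
  have hfin : ∀ᵐ e ∂expMeasure r, levelCount r f e < ∞ := by
    refine ae_lt_top (measurable_levelCount r f) ?_
    rw [lintegral_levelCount hr h0 h1]
    exact hf.tsum_ofReal_ne_top
  have hmeas : ∀ k, Measurable
      ((symmDiff (expLevel r (f k)) (expLevel r (g k))).indicator (1 : ℝ → ℝ≥0∞)) := fun k =>
    measurable_one.indicator
      ((measurableSet_expLevel r (f k)).symmDiff (measurableSet_expLevel r (g k)))
  -- The counts for `f` and for the exact levels `g` differ by at most the number of indices at
  -- which the level sets disagree; rounding costs the additional 1.
  have hbound : ∀ᵐ e ∂expMeasure r, ENNReal.ofReal |(levelCount r f e).toReal - e| ≤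
      (∑' k, (symmDiff (expLevel r (f k)) (expLevel r (g k))).indicator 1 e) + 1 := by
    filter_upwards [hfin, ae_nonneg_expMeasure hr] with e he he0
    obtain ⟨hg2, hg3⟩ := abs_levelCount_exp_sub_le hr he0
    have hA := ofReal_abs_toReal_sub_le he.ne hg2 (levelCount_le_add r f g e) (by
      have := levelCount_le_add r g f e
      simpa only [symmDiff_comm] using this)
    refine le_trans ?_ (add_le_add hA (ENNReal.ofReal_le_one.2 hg3))
    rw [← ENNReal.ofReal_add (abs_nonneg _) (abs_nonneg _)]
    exact ENNReal.ofReal_le_ofReal (abs_sub_le _ _ _)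
  refine (lintegral_mono_ae hbound).trans ?_
  rw [lintegral_add_right _ measurable_const, lintegral_tsum fun k => (hmeas k).aemeasurable,
    lintegral_one, measure_univ, ENNReal.ofReal_add hK0 zero_le_one, ENNReal.ofReal_one]
  gcongr
  refine ENNReal.tsum_le_of_sum_range_le fun n => ?_
  rw [Finset.sum_congr rfl fun k _ => (lintegral_indicator_one
    ((measurableSet_expLevel r (f k)).symmDiff (measurableSet_expLevel r (g k)))).trans
    (expMeasure_symmDiff_expLevel hr (h0 k) (h1 k) (Real.exp_pos _).le (hg1 k)),
    ← ENNReal.ofReal_sum_of_nonneg fun _ _ => abs_nonneg _]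
  exact ENNReal.ofReal_le_ofReal (hK n)

end ExpLevel

/-! ### Integer-valued variables and conditional independence -/

theorem ENNReal.lt_coe_enat_iff {a : ℝ≥0∞} (ha : a ≠ ∞) (m : ℕ∞) :
    a < (m : ℝ≥0∞) ↔ ((⌊a.toNNReal⌋₊ : ℕ) : ℝ≥0∞) < m := by
  lift a to NNReal using ha
  rcases m with _ | n
  · exact iff_of_true ENNReal.coe_lt_top (ENNReal.natCast_lt_top _)
  · change (a : ℝ≥0∞) < ((n : ℕ∞) : ℝ≥0∞) ↔ ((⌊(a : ℝ≥0∞).toNNReal⌋₊ : ℕ) : ℝ≥0∞) < ((n : ℕ∞) : ℝ≥0∞)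
    rw [ENNReal.toNNReal_coe, ENat.toENNReal_coe, Nat.cast_lt, Nat.floor_lt zero_le]
    exact_mod_cast Iff.rfl

theorem ENNReal.coe_enat_eq_tsum (m : ℕ∞) :
    (m : ℝ≥0∞) = ∑' k : ℕ, {c : ℝ≥0∞ | (k : ℝ≥0∞) < c}.indicator 1 (m : ℝ≥0∞) := by
  induction m using ENat.recTopCoe with
  | top =>
    rw [ENat.toENNReal_top, tsum_congr fun k : ℕ => Set.indicator_of_mem
      (show (∞ : ℝ≥0∞) ∈ {c : ℝ≥0∞ | (k : ℝ≥0∞) < c} from ENNReal.natCast_lt_top k) _]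
    exact (ENNReal.tsum_const_eq_top_of_ne_zero one_ne_zero).symm
  | coe n =>
    rw [ENat.toENNReal_coe, tsum_eq_sum (s := Finset.range n)]
    · have h : ∀ k ∈ Finset.range n, {c : ℝ≥0∞ | (k : ℝ≥0∞) < c}.indicator 1 (n : ℝ≥0∞) =
          (1 : ℝ≥0∞) := fun k hk =>
        Set.indicator_of_mem (Nat.cast_lt.2 (Finset.mem_range.1 hk)) _
      rw [Finset.sum_congr rfl h]
      simp
    · intro k hk
      refine Set.indicator_of_notMem ?_ _
      have := not_lt.1 (mt Finset.mem_range.2 hk)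
      simpa using this

/-- Two random variables with values in `ℕ ∪ {∞}` have the same law if they have the same
tail probabilities. -/
theorem map_eq_map_of_tail_eq {α β : Type*} [MeasurableSpace α] [MeasurableSpace β]
    {μ : Measure α} {ν : Measure β} [IsProbabilityMeasure μ] [IsProbabilityMeasure ν]
    {f : α → ℝ≥0∞} {g : β → ℝ≥0∞} (hf : Measurable f) (hg : Measurable g)
    (hf' : ∀ x, ∃ m : ℕ∞, f x = m) (hg' : ∀ x, ∃ m : ℕ∞, g x = m)
    (h : ∀ k : ℕ, μ {x | (k : ℝ≥0∞) < f x} = ν {x | (k : ℝ≥0∞) < g x}) :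
    μ.map f = ν.map g := by
  have := Measure.isProbabilityMeasure_map (μ := μ) hf.aemeasurable
  have := Measure.isProbabilityMeasure_map (μ := ν) hg.aemeasurable
  have hIoi : ∀ a : ℝ≥0∞, μ.map f (Set.Ioi a) = ν.map g (Set.Ioi a) := by
    intro a
    rw [Measure.map_apply hf measurableSet_Ioi, Measure.map_apply hg measurableSet_Ioi]
    rcases eq_or_ne a ∞ with rfl | ha
    · simp
    · have e1 : f ⁻¹' Set.Ioi a = {x | ((⌊a.toNNReal⌋₊ : ℕ) : ℝ≥0∞) < f x} := by
        ext x
        obtain ⟨m, hm⟩ := hf' x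
        rw [Set.mem_preimage, Set.mem_Ioi, Set.mem_ofPred_eq, hm]
        exact ENNReal.lt_coe_enat_iff ha m
      have e2 : g ⁻¹' Set.Ioi a = {x | ((⌊a.toNNReal⌋₊ : ℕ) : ℝ≥0∞) < g x} := by
        ext x
        obtain ⟨m, hm⟩ := hg' x
        rw [Set.mem_preimage, Set.mem_Ioi, Set.mem_ofPred_eq, hm]
        exact ENNReal.lt_coe_enat_iff ha m
      rw [e1, e2, h]
  refine Measure.ext_of_Iic _ _ fun a => ?_
  rw [← compl_compl (Set.Iic a), Set.compl_Iic, prob_compl_eq_one_sub measurableSet_Ioi,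
    prob_compl_eq_one_sub measurableSet_Ioi, hIoi]

/-- Taking `C` to be everything identifies the conditional law of `E` with `m` when `F` has positive
mass. If `F` is null, the conditional measure vanishes and so do both sides. -/
theorem indepFun_cond_of_forall {Ω β γ : Type*} [MeasurableSpace Ω] [MeasurableSpace β]
    [MeasurableSpace γ] {μ : Measure Ω} [IsFiniteMeasure μ] {F : Set Ω} (hF : MeasurableSet F)
    {E : Ω → β} {Y : Ω → γ} (m : Set β → ℝ≥0∞)
    (h : ∀ A C, MeasurableSet A → MeasurableSet C →
      μ (F ∩ (E ⁻¹' A ∩ Y ⁻¹' C)) = μ (F ∩ Y ⁻¹' C) * m A) :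
    IndepFun E Y (μ[|F]) := by
  rw [indepFun_iff_measure_inter_preimage_eq_mul]
  intro A C hA hC
  have hA' := h A Set.univ hA MeasurableSet.univ
  simp only [Set.preimage_univ, Set.inter_univ] at hA'
  rw [cond_apply hF, cond_apply hF, cond_apply hF, h A C hA hC, hA']
  rcases eq_or_ne (μ F) 0 with h0 | h0
  · rw [measure_inter_null_of_null_left _ h0]
    simp
  · rw [← mul_assoc (μ F)⁻¹ (μ F), ENNReal.inv_mul_cancel h0 (measure_ne_top _ _), one_mul,
      mul_comm (μ (F ∩ _)), mul_left_comm]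

/-! ## Coupling of the walk with an exponential random variable -/

namespace BackboneTreePair

variable {q Q : ℝ} {V : Type u} (P : BackboneTreePair q Q V)

/-- The time is integer-valued, hence its mean is the sum of its tails, that is, of the survival
probabilities. -/
theorem lintegral_trapTime (hq : 1 < q) (hqQ : q ≤ Q) (x : P.trap.Vertex) :
    ∫⁻ y, P.trapTime y ∂P.law (P.ofTrap x) = ENNReal.ofReal (P.trap.lifetime P.pEsc x.1) := by
  have h : ∀ y, P.trapTime y = ∑' k : ℕ, {y | (k : ℝ≥0∞) < P.trapTime y}.indicator 1 y := by
    intro y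
    conv_lhs => rw [trapTime_eq_encard, ENNReal.coe_enat_eq_tsum, ← trapTime_eq_encard]
    rfl
  rw [lintegral_congr h, lintegral_tsum fun k : ℕ =>
    (measurable_one.indicator (P.measurableSet_lt_trapTime (k : ℝ≥0∞))).aemeasurable]
  have hs := P.trap.hasSum_survival hq (P.pEsc_pos hq hqQ) P.pEsc_le_one x.2
  rw [← hs.tsum_eq, ENNReal.ofReal_tsum_of_nonneg
    (fun k => P.trap.survival_nonneg hq P.pEsc_le_one k x.2) hs.summable]
  refine tsum_congr fun k => ?_
  rw [lintegral_indicator_one (P.measurableSet_lt_trapTime k), ← P.real_lt_trapTime hq k x,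
    ofReal_measureReal]

theorem ae_trapTime_lt_top (hq : 1 < q) (hqQ : q ≤ Q) (x : P.trap.Vertex) :
    ∀ᵐ y ∂P.law (P.ofTrap x), P.trapTime y < ∞ := by
  refine ae_lt_top P.measurable_trapTime ?_
  rw [P.lintegral_trapTime hq hqQ]
  exact ENNReal.ofReal_ne_top

theorem trapTime_afterHit_le (x : ℕ → P.Vertex) :
    P.trapTime (afterHit P.base x) ≤ P.trapTime x := by
  rw [P.trapTime_eq_sum_add x (hitTime x P.base).toNat]
  exact le_add_self

/-- By the strong Markov property the time after the hit has mean P(hit) · L(v_base); subtracting it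
leaves the time before the hit, or the whole time if the base is missed. -/
theorem lintegral_trapTime_before_hit (hq : 1 < q) (hqQ : q ≤ Q) :
    ∫⁻ x, (P.trapTime x - (hits P.base).indicator (fun x => P.trapTime (afterHit P.base x)) x)
      ∂P.law P.ent = ENNReal.ofReal (P.trap.lifetime P.pEsc [] -
        (P.pEsc * P.correction)⁻¹ * P.trap.lifetime P.pEsc P.trap.base.1) := by
  have hm : Measurable ((hits P.base).indicator fun x => P.trapTime (afterHit P.base x)) :=
    (P.measurable_trapTime.comp (measurable_afterHit _)).indicator (measurableSet_hits _)
  have hle : (hits P.base).indicator (fun x => P.trapTime (afterHit P.base x)) ≤ P.trapTime :=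
    Set.indicator_le fun x _ => P.trapTime_afterHit_le x
  have hL := (P.trap.lifetime_pos hq (P.pEsc_pos hq hqQ) P.trap.base.2).le
  have hafter : ∫⁻ x, (hits P.base).indicator (fun x => P.trapTime (afterHit P.base x)) x
      ∂P.law P.ent = ENNReal.ofReal
        ((P.pEsc * P.correction)⁻¹ * P.trap.lifetime P.pEsc P.trap.base.1) := by
    have h := P.tree.lintegral_afterHit P.ent P.base (C := Set.univ) MeasurableSet.univ
      P.measurable_trapTime
    simp only [Set.preimage_univ, Set.inter_univ] at h
    rw [lintegral_indicator (measurableSet_hits _)]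
    refine h.trans ?_
    rw [ENNReal.ofReal_mul' hL, ← P.lintegral_trapTime hq hqQ,
      ← P.real_ent_hits_base_eq_inv hq hqQ, ofReal_measureReal]
    rfl
  rw [lintegral_sub hm (by rw [hafter]; exact ENNReal.ofReal_ne_top) (ae_of_all _ hle), hafter,
    ENNReal.ofReal_sub _ (mul_nonneg (by rw [← P.real_ent_hits_base_eq_inv hq hqQ]; positivity) hL)]
  exact congrArg (· - _) (P.lintegral_trapTime hq hqQ P.trap.root)

/-! ### The joint law of the walk and the coupled variable -/

section Coupling

variable (ν : Measure ℝ) [IsProbabilityMeasure ν] (T : ℝ → ℝ≥0∞)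

open Classical in
/-- The conditional law, given the walk, of a variable with law `ν` which is coupled with the time
that the walk spends in the trap after hitting `v_base`, in such a way that this time is the image
of the variable under `T`; the variable is independent of a walk that does not hit `v_base`. -/
def couplingKernel : Kernel (ℕ → P.Vertex) ℝ :=
  Kernel.piecewise (measurableSet_hits P.base)
    ((condDistrib id T ν).comap (fun x => P.trapTime (afterHit P.base x))
      (P.measurable_trapTime.comp (measurable_afterHit _)))
    (Kernel.const _ ν)

instance : IsMarkovKernel (P.couplingKernel ν T) := by
  unfold couplingKernel
  infer_instance

theorem couplingKernel_of_mem {x : ℕ → P.Vertex} (h : x ∈ hits P.base) :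
    P.couplingKernel ν T x = condDistrib id T ν (P.trapTime (afterHit P.base x)) := by
  classical
  rw [couplingKernel, Kernel.piecewise_apply, if_pos h, Kernel.comap_apply]

theorem couplingKernel_of_notMem {x : ℕ → P.Vertex} (h : x ∉ hits P.base) :
    P.couplingKernel ν T x = ν := by
  classical
  rw [couplingKernel, Kernel.piecewise_apply, if_neg h, Kernel.const_apply]

/-- The joint law of the walk started at `ent` and of the coupled variable. -/
def coupling : Measure ((ℕ → P.Vertex) × ℝ) := P.law P.ent ⊗ₘ P.couplingKernel ν T

instance : IsProbabilityMeasure (P.coupling ν T) := by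
  unfold coupling
  infer_instance

theorem coupling_fst : (P.coupling ν T).fst = P.law P.ent := Measure.fst_compProd _ _

theorem ae_coupling_of_ae {p : (ℕ → P.Vertex) → Prop} (h : ∀ᵐ x ∂P.law P.ent, p x) :
    ∀ᵐ o ∂P.coupling ν T, p o.1 :=
  ae_of_ae_map measurable_fst.aemeasurable (by
    rw [← P.coupling_fst ν T] at h
    exact h)

theorem coupling_prod_of_subset_compl {D : Set (ℕ → P.Vertex)} (hD : MeasurableSet D)
    (h : D ⊆ (hits P.base)ᶜ) {A : Set ℝ} (hA : MeasurableSet A) :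
    P.coupling ν T (D ×ˢ A) = P.law P.ent D * ν A := by
  rw [coupling, Measure.compProd_apply_prod hD hA,
    setLIntegral_congr_fun hD fun x hx => by rw [P.couplingKernel_of_notMem ν T (h hx)],
    setLIntegral_const, mul_comm]

variable {T}

/-- The time from the base has the law of T(E), so drawing E from its conditional law given that
value reconstructs the joint law of T(E) and E. -/
theorem lintegral_condDistrib_trapTime (hT : Measurable T)
    (hlaw : (P.law P.base).map P.trapTime = ν.map T) {g : ℝ≥0∞ × ℝ → ℝ≥0∞} (hg : Measurable g) :
    ∫⁻ y, ∫⁻ e, g (P.trapTime y, e) ∂condDistrib id T ν (P.trapTime y) ∂P.law P.base =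
      ∫⁻ e, g (T e, e) ∂ν := by
  have h := lintegral_map (μ := P.law P.base) (f := fun t => ∫⁻ e, g (t, e) ∂condDistrib id T ν t)
    (g := P.trapTime) (hg.lintegral_kernel_prod_right') P.measurable_trapTime
  rw [← h, hlaw, ← Measure.lintegral_compProd hg, compProd_map_condDistrib aemeasurable_id,
    lintegral_map hg (by fun_prop)]
  rfl

/-- On the event of hitting, the kernel depends on the walk only through the time spent after the
hit, so the strong Markov property separates the stopped walk from the pair of this time and the
coupled variable. All independence statements on this event follow. -/
theorem setLIntegral_coupling (hT : Measurable T)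
    (hlaw : (P.law P.base).map P.trapTime = ν.map T) {g : ℝ≥0∞ × ℝ → ℝ≥0∞} (hg : Measurable g)
    {C : Set (ℕ → P.Vertex)} (hC : MeasurableSet C) :
    ∫⁻ p in (hits P.base ∩ stoppedAt P.base ⁻¹' C) ×ˢ Set.univ,
        g (P.trapTime (afterHit P.base p.1), p.2) ∂P.coupling ν T =
      P.law P.ent (hits P.base ∩ stoppedAt P.base ⁻¹' C) * ∫⁻ e, g (T e, e) ∂ν := by
  have hm : MeasurableSet (hits P.base ∩ stoppedAt P.base ⁻¹' C) :=
    (measurableSet_hits _).inter (measurable_stoppedAt _ hC)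
  have hg' : Measurable fun p : (ℕ → P.Vertex) × ℝ =>
      g (P.trapTime (afterHit P.base p.1), p.2) :=
    hg.comp ((P.measurable_trapTime.comp ((measurable_afterHit _).comp measurable_fst)).prodMk
      measurable_snd)
  rw [coupling, Measure.setLIntegral_compProd hg' hm MeasurableSet.univ,
    setLIntegral_congr_fun hm fun x hx => by
      rw [P.couplingKernel_of_mem ν T hx.1, Measure.restrict_univ],
    ← P.lintegral_condDistrib_trapTime ν hT hlaw hg]
  exact P.tree.lintegral_afterHit P.ent P.base hC
    (g := fun y => ∫⁻ e, g (P.trapTime y, e) ∂condDistrib id T ν (P.trapTime y))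
    ((hg.lintegral_kernel_prod_right' (κ := condDistrib id T ν)).comp P.measurable_trapTime)

theorem coupling_prod_of_hits (hT : Measurable T)
    (hlaw : (P.law P.base).map P.trapTime = ν.map T) {C : Set (ℕ → P.Vertex)}
    (hC : MeasurableSet C) {A : Set ℝ} (hA : MeasurableSet A) :
    P.coupling ν T ((hits P.base ∩ stoppedAt P.base ⁻¹' C) ×ˢ A) =
      P.law P.ent (hits P.base ∩ stoppedAt P.base ⁻¹' C) * ν A := by
  have h := P.setLIntegral_coupling ν hT hlaw
    (g := fun p => A.indicator 1 p.2) ((measurable_one.indicator hA).comp measurable_snd) hC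
  rw [lintegral_indicator_one hA] at h
  rw [← h, ← lintegral_indicator_one (((measurableSet_hits _).inter
    (measurable_stoppedAt _ hC)).prod hA), ← lintegral_indicator (((measurableSet_hits _).inter
    (measurable_stoppedAt _ hC)).prod MeasurableSet.univ)]
  refine lintegral_congr fun p => ?_
  by_cases h1 : p.1 ∈ hits P.base ∩ stoppedAt P.base ⁻¹' C <;> by_cases h2 : p.2 ∈ A <;>
    simp [Set.indicator, Set.mem_prod, h1, h2]

/-- The law `ν` is the same whether or not the base is hit, so the two product formulas add up to
unconditional independence. -/
theorem coupling_prod_stoppedAt (hT : Measurable T)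
    (hlaw : (P.law P.base).map P.trapTime = ν.map T) {C : Set (ℕ → P.Vertex)}
    (hC : MeasurableSet C) {A : Set ℝ} (hA : MeasurableSet A) :
    P.coupling ν T ((stoppedAt P.base ⁻¹' C) ×ˢ A) =
      P.law P.ent (stoppedAt P.base ⁻¹' C) * ν A := by
  have hm := measurable_stoppedAt P.base hC
  have hh := measurableSet_hits P.base
  have hsplit : (stoppedAt P.base ⁻¹' C) ×ˢ A =
      ((hits P.base ∩ stoppedAt P.base ⁻¹' C) ×ˢ A) ∪
        ((stoppedAt P.base ⁻¹' C \ hits P.base) ×ˢ A) := by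
    rw [← Set.union_prod, Set.inter_comm, Set.inter_union_sdiff]
  rw [hsplit, measure_union (Set.disjoint_prod.2 (Or.inl (Set.disjoint_left.2
      fun x h1 h2 => h2.2 h1.1))) ((hm.diff hh).prod hA),
    P.coupling_prod_of_hits ν hT hlaw hC hA,
    P.coupling_prod_of_subset_compl ν T (hm.diff hh) (fun x hx => hx.2) hA, ← add_mul,
    Set.inter_comm, measure_inter_add_sdiff _ hh]

/-- The coupled variable has law `ν`. -/
theorem hasLaw_snd_coupling (hT : Measurable T)
    (hlaw : (P.law P.base).map P.trapTime = ν.map T) :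
    HasLaw Prod.snd ν (P.coupling ν T) := by
  refine ⟨measurable_snd.aemeasurable, Measure.ext fun A hA => ?_⟩
  rw [Measure.map_apply measurable_snd hA]
  have h := P.coupling_prod_stoppedAt ν hT hlaw MeasurableSet.univ hA
  rw [Set.preimage_univ, measure_univ, one_mul, Set.univ_prod] at h
  exact h

theorem coupling_fst_preimage {D : Set (ℕ → P.Vertex)} (hD : MeasurableSet D) :
    P.coupling ν T (Prod.fst ⁻¹' D) = P.law P.ent D := by
  rw [← P.coupling_fst ν T, Measure.fst_apply hD]

theorem indepFun_stoppedAt (hT : Measurable T)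
    (hlaw : (P.law P.base).map P.trapTime = ν.map T) :
    IndepFun Prod.snd (fun o => stoppedAt P.base o.1) (P.coupling ν T) := by
  rw [indepFun_iff_measure_inter_preimage_eq_mul]
  intro A C hA hC
  have h1 : Prod.snd ⁻¹' A ∩ (fun o : (ℕ → P.Vertex) × ℝ => stoppedAt P.base o.1) ⁻¹' C =
      (stoppedAt P.base ⁻¹' C) ×ˢ A := by
    rw [Set.inter_comm]
    rfl
  have h2 := (P.hasLaw_snd_coupling ν hT hlaw).map_eq
  have h3 : P.coupling ν T (Prod.snd ⁻¹' A) = ν A := by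
    rw [← Measure.map_apply measurable_snd hA, h2]
  have h4 := P.coupling_fst_preimage ν (T := T) (measurable_stoppedAt P.base hC)
  rw [h1, h3, P.coupling_prod_stoppedAt ν hT hlaw hC hA, mul_comm, ← h4]
  rfl

theorem indepFun_indicator_hits (hT : Measurable T)
    (hlaw : (P.law P.base).map P.trapTime = ν.map T) :
    IndepFun Prod.snd ((Prod.fst ⁻¹' hits P.base).indicator (1 : (ℕ → P.Vertex) × ℝ → ℝ))
      (P.coupling ν T) := by
  have h := (P.indepFun_stoppedAt ν hT hlaw).comp measurable_id
    (ψ := (hits P.base).indicator (1 : (ℕ → P.Vertex) → ℝ))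
    (measurable_one.indicator (measurableSet_hits _))
  have e : (Prod.fst ⁻¹' hits P.base).indicator (1 : (ℕ → P.Vertex) × ℝ → ℝ) =
      (hits P.base).indicator (1 : (ℕ → P.Vertex) → ℝ) ∘ fun o => stoppedAt P.base o.1 := by
    funext o
    rw [Function.comp_apply]
    by_cases ho : o.1 ∈ hits P.base
    · rw [Set.indicator_of_mem (show o ∈ Prod.fst ⁻¹' hits P.base from ho),
        Set.indicator_of_mem (stoppedAt_mem_hits_iff.2 ho)]
      rfl
    · rw [Set.indicator_of_notMem (show o ∉ Prod.fst ⁻¹' hits P.base from ho),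
        Set.indicator_of_notMem (mt stoppedAt_mem_hits_iff.1 ho)]
  rw [e]
  exact h

theorem indepFun_cond_hits (hT : Measurable T)
    (hlaw : (P.law P.base).map P.trapTime = ν.map T) :
    IndepFun Prod.snd (fun o => stoppedAt P.base o.1)
      ((P.coupling ν T)[|Prod.fst ⁻¹' hits P.base]) := by
  refine indepFun_cond_of_forall (measurable_fst (measurableSet_hits _)) (fun A => ν A) ?_
  intro A C hA hC
  have h1 : Prod.fst ⁻¹' hits P.base ∩ (Prod.snd ⁻¹' A ∩
      (fun o : (ℕ → P.Vertex) × ℝ => stoppedAt P.base o.1) ⁻¹' C) =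
      (hits P.base ∩ stoppedAt P.base ⁻¹' C) ×ˢ A := by
    ext o
    simp only [Set.mem_inter_iff, Set.mem_preimage, Set.mem_prod]
    tauto
  rw [h1, P.coupling_prod_of_hits ν hT hlaw hC hA, ← P.coupling_fst_preimage ν (T := T)
    ((measurableSet_hits _).inter (measurable_stoppedAt _ hC))]
  rfl

theorem indepFun_cond_compl_hits :
    IndepFun Prod.snd Prod.fst ((P.coupling ν T)[|(Prod.fst ⁻¹' hits P.base)ᶜ]) := by
  refine indepFun_cond_of_forall (measurable_fst (measurableSet_hits _)).compl (fun A => ν A) ?_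
  intro A C hA hC
  have h1 : (Prod.fst ⁻¹' hits P.base)ᶜ ∩ (Prod.snd ⁻¹' A ∩
      (Prod.fst : (ℕ → P.Vertex) × ℝ → _) ⁻¹' C) = ((hits P.base)ᶜ ∩ C) ×ˢ A := by
    ext o
    simp only [Set.mem_inter_iff, Set.mem_preimage, Set.mem_prod, Set.mem_compl_iff]
    tauto
  have hm := (measurableSet_hits P.base).compl.inter hC
  rw [h1, P.coupling_prod_of_subset_compl ν T hm Set.inter_subset_left hA,
    ← P.coupling_fst_preimage ν (T := T) hm]
  rfl

/-- The difference between the time in the trap and the coupled variable, the latter being counted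
only for the walks in `D`. -/
def couplingError (D : Set (ℕ → P.Vertex)) (o : (ℕ → P.Vertex) × ℝ) : ℝ :=
  ((P.trapTimes o.1).ncard : ℝ) - (Prod.fst ⁻¹' D).indicator Prod.snd o

/-- The error is at most the time before the hit plus the distance between the later time and the
coupled variable. On the event of hitting, the latter two are distributed as T(E) and E. -/
theorem lintegral_couplingError_le (hq : 1 < q) (hqQ : q ≤ Q) (hT : Measurable T)
    (hlaw : (P.law P.base).map P.trapTime = ν.map T) {D : Set (ℕ → P.Vertex)}
    (hD : ∀ᵐ x ∂P.law P.ent, x ∈ D ↔ x ∈ hits P.base) :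
    ∫⁻ o, ‖P.couplingError D o‖ₑ ∂P.coupling ν T ≤
      ENNReal.ofReal (P.trap.lifetime P.pEsc [] -
        (P.pEsc * P.correction)⁻¹ * P.trap.lifetime P.pEsc P.trap.base.1) +
      ∫⁻ e, ENNReal.ofReal |(T e).toReal - e| ∂ν := by
  have hh := measurableSet_hits P.base
  set pre : (ℕ → P.Vertex) → ℝ≥0∞ := fun x =>
    P.trapTime x - (hits P.base).indicator (fun x => P.trapTime (afterHit P.base x)) x with hpre
  set dev : (ℕ → P.Vertex) × ℝ → ℝ≥0∞ := (hits P.base ×ˢ Set.univ).indicator fun o =>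
    ENNReal.ofReal |(P.trapTime (afterHit P.base o.1)).toReal - o.2| with hdev
  have hprem : Measurable pre := P.measurable_trapTime.sub
    ((P.measurable_trapTime.comp (measurable_afterHit _)).indicator hh)
  have hbound : ∀ᵐ o ∂P.coupling ν T, ‖P.couplingError D o‖ₑ ≤ pre o.1 + dev o := by
    filter_upwards [P.ae_coupling_of_ae ν T hD,
      P.ae_coupling_of_ae ν T (P.ae_trapTime_lt_top hq hqQ P.trap.root)] with o ho hfin
    have htau := (P.finite_trapTimes hfin.ne).2
    rw [← ofReal_norm, Real.norm_eq_abs, couplingError, htau]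
    by_cases hx : o.1 ∈ hits P.base
    · have hle := P.trapTime_afterHit_le o.1
      have hfin' := (hle.trans_lt hfin).ne
      rw [Set.indicator_of_mem (show o ∈ Prod.fst ⁻¹' D from ho.2 hx), hdev,
        Set.indicator_of_mem (show o ∈ hits P.base ×ˢ Set.univ from ⟨hx, trivial⟩), hpre]
      simp only
      rw [Set.indicator_of_mem hx, ← ENNReal.ofReal_toReal (ENNReal.sub_ne_top hfin.ne),
        ENNReal.toReal_sub_of_le hle hfin.ne, ← ENNReal.ofReal_add _ (abs_nonneg _)]
      · refine ENNReal.ofReal_le_ofReal ?_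
        have h1 := (ENNReal.toReal_le_toReal hfin' hfin.ne).2 hle
        have h2 := abs_sub_le (P.trapTime o.1).toReal
          (P.trapTime (afterHit P.base o.1)).toReal o.2
        rw [abs_of_nonneg (sub_nonneg.2 h1)] at h2
        exact h2
      · exact sub_nonneg.2 ((ENNReal.toReal_le_toReal hfin' hfin.ne).2 hle)
    · rw [Set.indicator_of_notMem (show o ∉ Prod.fst ⁻¹' D from mt ho.1 hx), sub_zero,
        abs_of_nonneg ENNReal.toReal_nonneg, ENNReal.ofReal_toReal hfin.ne, hpre]
      simp only
      rw [Set.indicator_of_notMem hx, tsub_zero]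
      exact le_self_add
  refine (lintegral_mono_ae hbound).trans ?_
  rw [lintegral_add_left (f := fun o : (ℕ → P.Vertex) × ℝ => pre o.1)
    (hprem.comp measurable_fst)]
  refine add_le_add ?_ ?_
  · have h : ∫⁻ o, pre o.1 ∂P.coupling ν T = ∫⁻ x, pre x ∂P.law P.ent := by
      rw [← P.coupling_fst ν T, Measure.fst, lintegral_map hprem measurable_fst]
    rw [h, ← P.lintegral_trapTime_before_hit hq hqQ]
  · rw [hdev, lintegral_indicator (hh.prod MeasurableSet.univ)]
    have h := P.setLIntegral_coupling ν hT hlaw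
      (g := fun p => ENNReal.ofReal |p.1.toReal - p.2|) (by fun_prop) MeasurableSet.univ
    simp only [Set.preimage_univ, Set.inter_univ] at h
    rw [h]
    exact mul_le_of_le_one_left' prob_le_one

end Coupling

end BackboneTreePair

/-! ## The total time in a bare trap -/

namespace FiniteWeightedTree

variable {q Q : ℝ} (T : FiniteWeightedTree q Q)

theorem base_ne_root (h : 1 < T.weight) : T.base ≠ T.root := by
  intro hb
  have hd : T.depth = 0 := by
    rw [← T.length_base, hb]
    rfl
  have hv : T.verts ⊆ {[]} := fun v hv => by
    have := T.length_le_depth hv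
    rw [Finset.mem_singleton, ← List.length_eq_zero_iff]
    omega
  have hw : T.weight = 1 := by
    rw [weight, Finset.Subset.antisymm hv (Finset.singleton_subset_iff.2 T.root_mem), Finset.sum_singleton]
    simp [pathWeight]
  exact h.ne' hw

theorem exists_nat_bound_of_isBare {B₀ : ℝ} (hB₀ : 0 < B₀) (hw : 3 < T.weight) (h : T.IsBare B₀) :
    ∃ N : ℕ, (N : ℝ) ≤ B₀ * Real.log (Real.log T.weight) ∧
      ∀ i < T.depth, (T.outgrowth i).ncard ≤ N := by
  -- Cardinalities are integers, so the bound may be rounded down; it is nonnegative because ω > 3 >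
  -- e.
  refine ⟨⌊B₀ * Real.log (Real.log T.weight)⌋₊, Nat.floor_le ?_, fun i hi => Nat.le_floor (h i hi)⟩
  have h1 : 1 ≤ Real.log T.weight := by
    rw [Real.le_log_iff_exp_le (by linarith)]
    exact (Real.exp_one_lt_three.trans hw).le
  exact mul_nonneg hB₀.le (Real.log_nonneg h1)

end FiniteWeightedTree

namespace BackboneTreePair

variable {q Q : ℝ} {V : Type u} (P : BackboneTreePair q Q V)

theorem mean_pos (hq : 1 < q) (hqQ : q ≤ Q) : 0 < 2 * P.correction * P.trap.weight := by
  have h1 := P.trap.potential_pos hq (P.pEsc_pos hq hqQ) P.trap.base.2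
  have h2 := FiniteWeightedTree.one_le_weight (T := P.trap) hq
  rw [P.correction_eq hq]
  positivity

/-- The number of the survival probabilities of the walk started at `v_base` that exceed the value
at `e` of the survival function of the exponential variable of mean `2 * c_f * ω`. -/
def expCount : ℝ → ℝ≥0∞ :=
  levelCount (2 * P.correction * P.trap.weight)⁻¹
    fun k => P.trap.survival P.pEsc k P.trap.base.1

theorem measurable_expCount : Measurable P.expCount := measurable_levelCount _ _

theorem survival_base_le_one (hq : 1 < q) (hqQ : q ≤ Q) (k : ℕ) :
    P.trap.survival P.pEsc k P.trap.base.1 ≤ 1 :=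
  P.trap.survival_antitone hq (P.pEsc_pos hq hqQ) P.pEsc_le_one P.trap.base.2 (Nat.zero_le k)

/-- The time in the trap of the walk started at `v_base` is, in law, a function of an exponential
variable. -/
theorem map_trapTime_eq (hq : 1 < q) (hqQ : q ≤ Q) :
    (P.law P.base).map P.trapTime =
      (expMeasure (2 * P.correction * P.trap.weight)⁻¹).map P.expCount := by
  have hr := inv_pos.2 (P.mean_pos hq hqQ)
  have := isProbabilityMeasure_expMeasure hr
  refine map_eq_map_of_tail_eq P.measurable_trapTime P.measurable_expCount
    (fun x => ⟨_, P.trapTime_eq_encard x⟩) (fun e => ⟨_, levelCount_eq_encard _ _ e⟩) fun k => ?_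
  have h1 : {e | (k : ℝ≥0∞) < P.expCount e} = expLevel (2 * P.correction * P.trap.weight)⁻¹
      (P.trap.survival P.pEsc k P.trap.base.1) := by
    ext e
    exact lt_levelCount_iff
      (P.trap.survival_antitone hq (P.pEsc_pos hq hqQ) P.pEsc_le_one P.trap.base.2) k e
  rw [h1, expMeasure_expLevel hr (P.trap.survival_nonneg hq P.pEsc_le_one k P.trap.base.2)
    (P.survival_base_le_one hq hqQ k), ← P.real_lt_trapTime hq, ofReal_measureReal]
  rfl

variable {N : ℕ}

theorem lintegral_abs_expCount_sub_le (hq : 1 < q) (hqQ : q ≤ Q)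
    (hN : ∀ i < P.trap.depth, (P.trap.outgrowth i).ncard ≤ N) :
    ∫⁻ e, ENNReal.ofReal |(P.expCount e).toReal - e|
        ∂expMeasure (2 * P.correction * P.trap.weight)⁻¹ ≤
      ENNReal.ofReal (5 * ((N * P.trap.depth + 1) * ((1 + Q) * Q ^ N) / (q - 1)) +
        3 * P.correction + 4 * (N ^ 2 * Q ^ N) + 1 + 1) := by
  have hr := inv_pos.2 (P.mean_pos hq hqQ)
  refine lintegral_abs_levelCount_sub_le hr
    (fun k => P.trap.survival_nonneg hq P.pEsc_le_one k P.trap.base.2)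
    (P.survival_base_le_one hq hqQ)
    (P.trap.hasSum_survival hq (P.pEsc_pos hq hqQ) P.pEsc_le_one P.trap.base.2).summable
    fun n => ?_
  have h := FiniteWeightedTree.sum_abs_survival_sub_exp_le_of_bare hq hqQ hN
    (P.pEsc_pos hq hqQ) P.pEsc_le_one n
  rw [← P.correction_eq hq] at h
  simpa only [div_eq_inv_mul] using h

/-- Since L(root) = (2ω - 1)/p_esc, the difference equals (2 c_f ω - L(v_base))/(p_esc c_f) -
1/p_esc. The terms of order ω have cancelled, and p_esc c_f ≥ 1. -/
theorem lifetime_before_hit_le (hq : 1 < q) (hqQ : q ≤ Q)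
    (hN : ∀ i < P.trap.depth, (P.trap.outgrowth i).ncard ≤ N) :
    P.trap.lifetime P.pEsc [] -
        (P.pEsc * P.correction)⁻¹ * P.trap.lifetime P.pEsc P.trap.base.1 ≤
      P.correction + (N * P.trap.depth + 1) * ((1 + Q) * Q ^ N) / (q - 1) := by
  have he := P.pEsc_pos hq hqQ
  have hle := FiniteWeightedTree.weight_sub_lifetime_base_le hq hqQ hN he
  have hnn := FiniteWeightedTree.weight_sub_lifetime_base_nonneg (T := P.trap) hq he
  have hc := FiniteWeightedTree.one_div_le_potential_base (T := P.trap) hq P.pEsc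
  rw [← P.correction_eq hq] at hle hnn hc
  refine le_trans ?_ hle
  have hec : 1 ≤ P.pEsc * P.correction := by
    have := (div_le_iff₀ he).1 hc
    linarith
  have hc0 : 0 < P.correction := (one_div_pos.2 he).trans_le hc
  have h0 : P.trap.lifetime P.pEsc [] = (2 * P.trap.weight - 1) / P.pEsc := by
    rw [FiniteWeightedTree.lifetime, FiniteWeightedTree.pathSum_nil, add_zero]
  rw [h0]
  set L := P.trap.lifetime P.pEsc P.trap.base.1
  have h1 : (2 * P.trap.weight - 1) / P.pEsc - (P.pEsc * P.correction)⁻¹ * L =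
      (2 * P.correction * P.trap.weight - L) / (P.pEsc * P.correction) - 1 / P.pEsc := by
    field_simp
    ring
  rw [h1]
  have h2 := div_le_self hnn hec
  have h3 := one_div_pos.2 he
  linarith

/-- The times before and after the hit contribute one and five copies of the spine term, and one and
three copies of `correction`. The latter is bounded uniformly through `pEsc_ge`. -/
theorem lintegral_couplingError_le_of_bare (hq : 1 < q) (hqQ : q ≤ Q)
    (hN : ∀ i < P.trap.depth, (P.trap.outgrowth i).ncard ≤ N)
    [IsProbabilityMeasure (expMeasure (2 * P.correction * P.trap.weight)⁻¹)]
    (h : P.trap.base ≠ P.trap.root) :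
    ∫⁻ o, ‖P.couplingError P.fallsDeeply o‖ₑ
        ∂P.coupling (expMeasure (2 * P.correction * P.trap.weight)⁻¹) P.expCount ≤
      ENNReal.ofReal ((6 * ((1 + Q) / (q - 1)) + 4 * ((Q + q) / (q - 1) + 1 / (q - 1)) + 6) *
        (1 + (N * P.trap.depth + 1) * Q ^ N + N ^ 2 * Q ^ N)) := by
  refine (P.lintegral_couplingError_le _ hq hqQ P.measurable_expCount (P.map_trapTime_eq hq hqQ)
    (P.fallsDeeply_ae_eq h)).trans ?_
  refine (add_le_add (ENNReal.ofReal_le_ofReal (P.lifetime_before_hit_le hq hqQ hN))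
    (P.lintegral_abs_expCount_sub_le hq hqQ hN)).trans ?_
  have hq1 : 0 < q - 1 := by linarith
  have hQ : 0 < Q := by linarith
  have he := P.pEsc_pos hq hqQ
  have hc0 : 0 ≤ P.correction := by
    rw [P.correction_eq hq]
    exact (P.trap.potential_pos hq he P.trap.base.2).le
  have hc : P.correction ≤ (Q + q) / (q - 1) + 1 / (q - 1) := by
    rw [P.correction_eq hq]
    refine (FiniteWeightedTree.potential_base_le hq _).trans (add_le_add_left ?_ _)
    rw [one_div, ← inv_div]
    exact inv_anti₀ (div_pos hq1 (by linarith)) (P.pEsc_ge hq hqQ)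
  rw [← ENNReal.ofReal_add (by positivity) (by positivity)]
  refine ENNReal.ofReal_le_ofReal ?_
  set K := (Q + q) / (q - 1) + 1 / (q - 1)
  set a : ℝ := (N * P.trap.depth + 1) * Q ^ N with ha
  set b : ℝ := N ^ 2 * Q ^ N with hb
  have ha0 : 0 ≤ a := by positivity
  have hb0 : 0 ≤ b := by positivity
  have hK0 : 0 ≤ K := hc0.trans hc
  set d := (1 + Q) / (q - 1) with hd
  have hd0 : 0 ≤ d := by positivity
  have h1 : (N * P.trap.depth + 1) * ((1 + Q) * Q ^ N) / (q - 1) = a * d := by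
    rw [ha, hd]
    ring
  rw [h1]
  nlinarith [mul_nonneg hd0 hb0, mul_nonneg hK0 ha0, mul_nonneg hK0 hb0]

theorem integrable_couplingError (hq : 1 < q) (hqQ : q ≤ Q) (ν : Measure ℝ)
    [IsProbabilityMeasure ν] (T : ℝ → ℝ≥0∞) (h : P.trap.base ≠ P.trap.root)
    (hfin : ∫⁻ o, ‖P.couplingError P.fallsDeeply o‖ₑ ∂P.coupling ν T < ∞) :
    Integrable (P.couplingError P.fallsDeeply) (P.coupling ν T) := by
  refine ⟨?_, hfin⟩
  -- `couplingError` agrees almost everywhere with this measurable function, built from `trapTime`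
  -- and `hits`.
  have hm : Measurable fun o : (ℕ → P.Vertex) × ℝ =>
      (P.trapTime o.1).toReal - (Prod.fst ⁻¹' hits P.base).indicator Prod.snd o :=
    ((P.measurable_trapTime.comp measurable_fst).ennreal_toReal).sub
      (measurable_snd.indicator (measurable_fst (measurableSet_hits _)))
  refine hm.aestronglyMeasurable.congr ?_
  filter_upwards [P.ae_coupling_of_ae ν T (P.fallsDeeply_ae_eq h),
    P.ae_coupling_of_ae ν T (P.ae_trapTime_lt_top hq hqQ P.trap.root)] with o ho hf
  rw [couplingError, (P.finite_trapTimes hf.ne).2]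
  congr 1
  by_cases hx : o.1 ∈ hits P.base
  · rw [Set.indicator_of_mem (show o ∈ Prod.fst ⁻¹' hits P.base from hx),
      Set.indicator_of_mem (show o ∈ Prod.fst ⁻¹' P.fallsDeeply from ho.2 hx)]
  · rw [Set.indicator_of_notMem (show o ∉ Prod.fst ⁻¹' hits P.base from hx),
      Set.indicator_of_notMem (show o ∉ Prod.fst ⁻¹' P.fallsDeeply from mt ho.1 hx)]

end BackboneTreePair

end

/-! ### The proposition -/

theorem proposition1 (q Q : ℝ) (hq : 1 < q) (hqQ : q ≤ Q) (B₀ : ℝ) (hB₀ : 0 < B₀) :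
    ∃ v₀ C₂ : ℝ, 0 < v₀ ∧ 0 < C₂ ∧
      ∀ (V : Type u) (P : BackboneTreePair q Q V), v₀ < P.trap.weight → P.trap.IsBare B₀ →
        -- the probability of falling deeply
        (P.law P.ent).real P.fallsDeeply = P.pDe / (1 - (1 - P.pEsc) * (1 - P.pDe)) ∧
        -- a probability space carrying the walk `X` started at `ent`, and `E` and `err`
        ∃ (Ω : Type u) (_ : MeasurableSpace Ω) (μ : Measure Ω) (X : Ω → ℕ → P.Vertex)
          (E err : Ω → ℝ),
          IsProbabilityMeasure μ ∧ Measurable X ∧ Measurable E ∧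
          HasLaw X (P.law P.ent) μ ∧
          -- the total time in the trap is finite and equals `E 1_FD + err`
          (∀ᵐ o ∂μ, (P.trapTimes (X o)).Finite ∧
            ((P.trapTimes (X o)).ncard : ℝ) = (X ⁻¹' P.fallsDeeply).indicator E o + err o) ∧
          -- `E` is exponential of mean `2 c_f ω(T_ent)`
          HasLaw E (expMeasure (2 * P.correction * P.trap.weight)⁻¹) μ ∧
          -- `E` is independent of the walk until its arrival at `v_base`
          IndepFun E (fun o => stoppedAt P.base (X o)) μ ∧
          -- that is, it is independent of `FD`; given `FD`, it is independent of the walk until its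
          -- arrival at `v_base`; and given the complement of `FD`, it is independent of the walk
          IndepFun E ((X ⁻¹' P.fallsDeeply).indicator (1 : Ω → ℝ)) μ ∧
          IndepFun E (fun o => stoppedAt P.base (X o)) (μ[|X ⁻¹' P.fallsDeeply]) ∧
          IndepFun E X (μ[|(X ⁻¹' P.fallsDeeply)ᶜ]) ∧
          -- the bound on the error
          Integrable err μ ∧ ∫ o, |err o| ∂μ ≤ C₂ * P.trap.weight ^ (1 / 2 : ℝ) := by
  obtain ⟨v₀, C, hv₀, hC, hbound⟩ := exists_polylog_le_sqrt hq hqQ hB₀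
  have hq1 : 0 < q - 1 := by linarith
  have hQ : 0 < Q := by linarith
  set K : ℝ := 6 * ((1 + Q) / (q - 1)) + 4 * ((Q + q) / (q - 1) + 1 / (q - 1)) + 6 with hK
  have hK0 : 0 < K := by positivity
  -- As `v₀` is at least 3, a weight above `v₀` forces the base to differ from `ent` and makes the
  -- iterated logarithm nonnegative.
  refine ⟨v₀, K * C, by linarith, mul_pos hK0 hC, fun V P hw hbare => ?_⟩
  have hne := P.trap.base_ne_root (by linarith)
  obtain ⟨N, hN, hN'⟩ := P.trap.exists_nat_bound_of_isBare hB₀ (by linarith) hbare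
  have hν := isProbabilityMeasure_expMeasure (inv_pos.2 (P.mean_pos hq hqQ))
  set ν := expMeasure (2 * P.correction * P.trap.weight)⁻¹ with hνd
  have hT := P.measurable_expCount
  have hlaw : (P.law P.base).map P.trapTime = ν.map P.expCount := P.map_trapTime_eq hq hqQ
  -- The coupling is built on the event of hitting the base; this null-set identity carries
  -- independence and conditioning over to falling deeply.
  have hFD : (Prod.fst ⁻¹' P.fallsDeeply : Set ((ℕ → P.Vertex) × ℝ)) =ᵐ[P.coupling ν P.expCount]
      Prod.fst ⁻¹' hits P.base :=
    Filter.eventuallyEq_set.2 (P.ae_coupling_of_ae ν P.expCount (P.fallsDeeply_ae_eq hne))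
  have hcond : ∀ s t : Set ((ℕ → P.Vertex) × ℝ), s =ᵐ[P.coupling ν P.expCount] t →
      (P.coupling ν P.expCount)[|s] = (P.coupling ν P.expCount)[|t] := fun s t h => by
    rw [ProbabilityTheory.cond, ProbabilityTheory.cond, measure_congr h,
      Measure.restrict_congr_set h]
  have herr := (P.lintegral_couplingError_le_of_bare hq hqQ hN' hne).trans
    (ENNReal.ofReal_le_ofReal (mul_le_mul_of_nonneg_left (hbound _ hw N P.trap.depth hN
      (FiniteWeightedTree.pow_depth_le_weight hq)) hK0.le))
  have hint := P.integrable_couplingError hq hqQ ν P.expCount hne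
    (herr.trans_lt ENNReal.ofReal_lt_top)
  refine ⟨P.real_fallsDeeply hq hqQ hne, (ℕ → P.Vertex) × ℝ, inferInstance,
    P.coupling ν P.expCount, Prod.fst, Prod.snd, P.couplingError P.fallsDeeply, inferInstance,
    measurable_fst, measurable_snd, ⟨measurable_fst.aemeasurable, P.coupling_fst ν P.expCount⟩, ?_,
    P.hasLaw_snd_coupling ν hT hlaw, P.indepFun_stoppedAt ν hT hlaw, ?_, ?_, ?_, hint, ?_⟩
  · filter_upwards [P.ae_coupling_of_ae ν P.expCount (P.ae_trapTime_lt_top hq hqQ P.trap.root)]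
      with o ho
    refine ⟨(P.finite_trapTimes ho.ne).1, ?_⟩
    rw [BackboneTreePair.couplingError, add_sub_cancel]
  · exact (P.indepFun_indicator_hits ν hT hlaw).congr (Filter.EventuallyEq.refl _ _)
      (indicator_ae_eq_of_ae_eq_set hFD.symm)
  · rw [hcond _ _ hFD]
    exact P.indepFun_cond_hits ν hT hlaw
  · rw [hcond _ _ hFD.compl]
    exact P.indepFun_cond_compl_hits ν
  · have h := integral_norm_eq_lintegral_enorm hint.aestronglyMeasurable
    simp only [Real.norm_eq_abs] at h
    rw [h, mul_assoc]
    exact ENNReal.toReal_le_of_le_ofReal (mul_nonneg hK0.le (mul_nonneg hC.le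
      (Real.rpow_nonneg (by linarith) _))) herr
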